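/- Let $g\ge 1$, let $\Sigma_{g,1}$ be a surface of genus $g$ with one boundary component, $\pi_1$ its fundamental group, free on standard symplectic generators $\mathbf u_1,\mathbf v_1,\dots,\mathbf u_g,\mathbf v_g$ with $\partial=\prod_{i=1}^g[\mathbf u_i,\mathbf v_i]$, and let the mapping class group $\mathcal M_{g,1}$ be identified with $\{\varphi\in\mathrm{Aut}(\pi_1):\varphi(\partial)=\partial\}$. Let $H=H_1(\Sigma_{g,1};\mathbb Q)$, with basis $u_i,v_i$ (the classes of $\mathbf u_i,\mathbf v_i$) and intersection pairing $u_i\cdot v_j=\delta_{ij}$, $u_i\cdot u_j=v_i\cdot v_j=0$; let $\mathcal L_n\subset H^{\otimes n}$ be the degree $n$ part of the free Lie algebra on $H$, and identify $H\otimes\mathcal L_n\cong\mathrm{Hom}(H,\mathcal L_n)$ by $a\otimes t\mapsto(x\mapsto (a\cdot x)\,t)$. Let $\varpi:\Lambda^2H\otimes\Lambda^2H\to H\otimes\mathcal L_3$ be $\varpi(a\wedge b\otimes c\wedge d)=a\otimes[b,[c,d]]-b\otimes[a,[c,d]]$; write $t^{\otimes2}=\varpi(t\otimes t)$, $t_1\leftrightarrow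 t_2=\varpi(t_1\otimes t_2+t_2\otimes t_1)$, and identify $\Lambda^2H=\mathcal L_2$ by $a\wedge b=[a,b]$. Let $\overline{\phantom{x}}$ be the linear map on $H\otimes\mathcal L_3$ with $\overline{x\otimes[y,[z,w]]}=\frac14[x,y]\leftrightarrow[z,w]$, and put $\omega=\sum_{i=1}^g[u_i,v_i]$. Let $T_\partial\in\mathcal M_{g,1}$ be the right-handed Dehn twist along the boundary, $T_\partial(x)=\partial^{-1}x\,\partial$. Then $T_\partial\in\mathcal M_{g,1}[2]$, i.e. $T_\partial$ acts trivially on $\pi_1/\Gamma_2$, where $\Gamma_0=\pi_1$ and $\Gamma_{k+1}=[\Gamma_k,\Gamma_0]$. For its second Johnson homomorphism $\tau_2(T_\partial)$ (the homomorphism $H\to\mathcal L_3$ induced by $x\mapsto T_\partial(x)x^{-1}\in\Gamma_2/\Gamma_3$; equivalently the component in $\mathrm{Hom}(H,H^{\otimes3})$ of the total Johnson map $\theta\circ T_\partial\circ\theta^{-1}$ of any generalized Magnus expansion $\theta$, whose component $\tau_1(T_\partial)\in\mathrm{Hom}(H,H^{\otimes2})$ is $0$) and for $\bar\tau_2(T_\partial)=\overline{\tau_2(T_\partial)}$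 one has $$\tau_2(T_\partial)=\bar\tau_2(T_\partial)=\sum_{i=1}^g\tfrac12[u_i,v_i]\leftrightarrow\omega=\omega^{\otimes2}=\sum_{i=1}^g\big(u_i\otimes[v_i,\omega]-v_i\otimes[u_i,\omega]\big).$$ Moreover this value is computed by Whitehead moves, as follows. Let $G_0$ be the symplectic trivalent marked once-bordered fatgraph of genus $g$. Write $\mathbf x$ also for the marking of an oriented edge, $\bar{\mathbf x}$ for the reversed edge, and give the vertices as the cyclically ordered incoming edges, whose markings multiply to $1$. Then $G_0$ has for each $i$ edges $\mathbf u_i,\mathbf v_i,\mathbf p_i,\mathbf q_i,\mathbf s_i$ and vertices $(\mathbf u_i,\mathbf v_i,\mathbf p_i)$, $(\bar{\mathbf u}_i,\bar{\mathbf v}_i,\bar{\mathbf q}_i)$, $(\mathbf s_i,\bar{\mathbf p}_i,\mathbf q_i)$, and it has trunk edges $\mathbf r_1=\mathbf s_1,\mathbf r_2,\dots,\mathbf r_g$ and vertices $(\mathbf r_h,\bar{\mathbf r}_{h-1},\bar{\mathbf s}_h)$ for $2\le h\le g$; its tail is $\mathbf r_g$, pointing away from the univalent vertex. Starting from $G_0$,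 perform $12g-6$ times the Whitehead move on the edge to the right of the tail, i.e. on the edge along which the boundary cycle (from an incoming edge to the outgoing edge next to it in the cyclic order) continues after the tail. All these moves are possible and lead through marked trivalent once-bordered fatgraphs $G_0\to G_1\to\dots\to G_{12g-6}$, and $G_{12g-6}\cong T_\partial(G_0)$, so that the sequence represents $T_\partial$. For a trivalent marked once-bordered fatgraph $G$ let $\theta^G$ be its fatgraph Magnus expansion: the generalized Magnus expansion with $\theta^G(\mathbf x)=\exp\ell(\mathbf x)$ for all oriented edges $\mathbf x$, where $\ell_1(\mathbf x)=[\mathbf x]$ and, for $n\ge2$, $\ell_n(\mathbf x)=-\frac13\sum_{i=1}^kh(\ell(\mathbf f_{i-1}),-\ell(\mathbf f_i))_{(n)}$ over the path $\mathbf x=\mathbf f_0,\dots,\mathbf f_k=\bar{\mathbf x}$ along the boundary cycle if that path avoids the tail (does not pass from $\bar{\mathbf t}$ to $\mathbf t$, for $\mathbf t$ the tail), and $\ell_n(\mathbf x)=-\ell_n(\bar{\mathbf x})$ otherwise, with $h(X,Y)=\log(\exp X\exp Y)-X-Y$. For a Whitehead move $W:G\to G'$ let $\tau_m(W)\in\mathrm{Hom}(H,H^{\otimes(m+1)})$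 be the components of $\theta^{G}\circ(\theta^{G'})^{-1}$. For the graphs $G_i$ and the moves $W_i:G_{i-1}\to G_i$ these expansions and maps exist and are unique, $\tau_1(W_i)=0$, $\tau_2(W_i)\in H\otimes\mathcal L_3$, and $$\sum_{i=1}^{12g-6}\tau_2(W_i)=\tau_2(T_\partial)=\omega^{\otimes2},\qquad \sum_{i=1}^{12g-6}\overline{\tau_2(W_i)}=\bar\tau_2(T_\partial)=\omega^{\otimes2}.$$ -/

import Mathlib

open scoped TensorProduct

namespace FatgraphJohnson

noncomputable section

/-! ### The free group, its homology, and mapping classes -/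

/-- Index set of the symplectic generators: `Sum.inl i` is `u_i`, `Sum.inr i` is `v_i`. -/
abbrev Gen (g : ℕ) : Type := Fin g ⊕ Fin g

/-- The fundamental group of the genus `g` surface with one boundary component, free on the
standard symplectic generators. -/
abbrev Pi1 (g : ℕ) : Type := FreeGroup (Gen g)

/-- The first homology with rational coefficients, with its basis `u_i`, `v_i`. -/
abbrev H (g : ℕ) : Type := Gen g → ℚ

variable {g : ℕ}

def uGen (i : Fin g) : Pi1 g := FreeGroup.of (Sum.inl i)
def vGen (i : Fin g) : Pi1 g := FreeGroup.of (Sum.inr i)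
def uH (i : Fin g) : H g := Pi.single (Sum.inl i) 1
def vH (i : Fin g) : H g := Pi.single (Sum.inr i) 1

/-- The homology class of an element of the fundamental group, as a homomorphism. -/
def clsHom (g : ℕ) : Pi1 g →* Multiplicative (H g) :=
  FreeGroup.lift fun i => Multiplicative.ofAdd (Pi.single i 1)

def cls (x : Pi1 g) : H g := Multiplicative.toAdd (clsHom g x)

/-- The group commutator `x y x⁻¹ y⁻¹`. -/
def comm (x y : Pi1 g) : Pi1 g := x * y * x⁻¹ * y⁻¹

/-- `[u_1, v_1] ⋯ [u_h, v_h]`. -/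
def partialBoundary (g h : ℕ) : Pi1 g :=
  ((List.ofFn fun i : Fin g => comm (uGen i) (vGen i)).take h).prod

/-- The boundary element `∂ = [u_1, v_1] ⋯ [u_g, v_g]`. -/
def boundary (g : ℕ) : Pi1 g := partialBoundary g g

/-- The mapping class group, as the group of automorphisms of the fundamental group that fix the
boundary element (Dehn-Nielsen). -/
def mappingClassGroup (g : ℕ) : Subgroup (MulAut (Pi1 g)) :=
  MulAction.stabilizer (MulAut (Pi1 g)) (boundary g)

/-- `φ` belongs to the `k`-th Torelli group: it is a mapping class acting trivially on
`π₁ / Γ_k`, where `Γ_0 = π₁` and `Γ_{k+1} = [Γ_k, Γ_0]`. -/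
def IsTorelli (k : ℕ) (φ : MulAut (Pi1 g)) : Prop :=
  φ ∈ mappingClassGroup g ∧
    ∀ x : Pi1 g, φ x * x⁻¹ ∈ (⊤ : Subgroup (Pi1 g)).lowerCentralSeries k

/-- The right-handed Dehn twist along the boundary, `x ↦ ∂⁻¹ x ∂`.  (For the orientation with
`u_i · v_i = 1`, the boundary curve run with the surface on its left is `∂⁻¹`.) -/
def boundaryTwist (g : ℕ) : MulAut (Pi1 g) := MulAut.conj (boundary g)⁻¹

/-! ### Tensors -/

/-- The tensor algebra of `H`; its product is the tensor product, and `⁅a, b⁆ = a * b - b * a`. -/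
abbrev T (g : ℕ) : Type := TensorAlgebra ℚ (H g)

def inc : H g →ₗ[ℚ] T g := TensorAlgebra.ι ℚ

/-- The homogeneous tensors of degree `n`, that is, `H^{⊗ n}`. -/
def deg (g n : ℕ) : Submodule ℚ (T g) := LinearMap.range (TensorAlgebra.ι ℚ : H g →ₗ[ℚ] T g) ^ n

/-- The homology intersection pairing, with `u_i · v_i = 1 = - v_i · u_i`. -/
def inter : H g →ₗ[ℚ] H g →ₗ[ℚ] ℚ :=
  LinearMap.mk₂ ℚ
    (fun a b => ∑ i : Fin g, (a (Sum.inl i) * b (Sum.inr i) - a (Sum.inr i) * b (Sum.inl i)))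
    (by intro a a' b; simp only [Pi.add_apply, ← Finset.sum_add_distrib]
        exact Finset.sum_congr rfl fun i _ => by ring)
    (by intro c a b; simp only [Pi.smul_apply, smul_eq_mul, Finset.mul_sum]
        exact Finset.sum_congr rfl fun i _ => by ring)
    (by intro a b b'; simp only [Pi.add_apply, ← Finset.sum_add_distrib]
        exact Finset.sum_congr rfl fun i _ => by ring)
    (by intro c a b; simp only [Pi.smul_apply, smul_eq_mul, Finset.mul_sum]
        exact Finset.sum_congr rfl fun i _ => by ring)

/-- `a ⊗ t` regarded as the homomorphism `x ↦ (a · x) t`. -/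
def toHom : H g ⊗[ℚ] T g →ₗ[ℚ] (H g →ₗ[ℚ] T g) :=
  dualTensorHom ℚ (H g) (T g) ∘ₗ LinearMap.rTensor (T g) inter

theorem toHom_tmul (a x : H g) (t : T g) : toHom (a ⊗ₜ[ℚ] t) x = inter a x • t := by
  simp [toHom]

/-- The tensor of a homomorphism: `f ↦ ∑ u_i ⊗ f(v_i) - v_i ⊗ f(u_i)`. -/
def ofHom : (H g →ₗ[ℚ] T g) →ₗ[ℚ] H g ⊗[ℚ] T g :=
  ∑ i : Fin g, (TensorProduct.mk ℚ (H g) (T g) (uH i) ∘ₗ LinearMap.applyₗ (vH i)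
    - TensorProduct.mk ℚ (H g) (T g) (vH i) ∘ₗ LinearMap.applyₗ (uH i))

theorem sum_basis (x : H g) :
    x = ∑ i : Fin g, (x (Sum.inl i) • uH i + x (Sum.inr i) • vH i) := by
  funext j
  rcases j with j | j <;>
    simp [uH, vH, Finset.sum_apply, Pi.single_apply]

theorem inter_uH (i : Fin g) (x : H g) : inter (uH i) x = x (Sum.inr i) := by
  simp [inter, uH, Pi.single_apply]

theorem inter_vH (i : Fin g) (x : H g) : inter (vH i) x = - x (Sum.inl i) := by
  simp [inter, vH, Pi.single_apply]

/-- Poincaré duality `H ⊗ T ≅ Hom(H, T)`, sending `a ⊗ t` to `x ↦ (a · x) t`. -/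
def poincare : H g ⊗[ℚ] T g ≃ₗ[ℚ] (H g →ₗ[ℚ] T g) :=
  LinearEquiv.ofLinearMap toHom ofHom
    (by
      refine LinearMap.ext fun f => LinearMap.ext fun x => ?_
      conv_rhs => rw [sum_basis x]
      simp [ofHom, toHom_tmul, inter_uH, inter_vH, LinearMap.sum_apply, add_comm, Finset.sum_add_distrib])
    (by
      refine TensorProduct.ext' fun a t => ?_
      conv_rhs => rw [sum_basis a]
      simp only [ofHom, LinearMap.comp_apply, LinearMap.sum_apply, LinearMap.sub_apply,
        TensorProduct.mk_apply, LinearMap.applyₗ_apply_apply, toHom_tmul, LinearMap.id_apply,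
        TensorProduct.sum_tmul, TensorProduct.add_tmul, TensorProduct.tmul_smul,
        TensorProduct.smul_tmul']
      refine Finset.sum_congr rfl fun i _ => ?_
      have h1 : inter a (vH i) = a (Sum.inl i) := by simp [inter, vH, Pi.single_apply]
      have h2 : inter a (uH i) = - a (Sum.inr i) := by simp [inter, uH, Pi.single_apply]
      rw [h1, h2, neg_smul, TensorProduct.neg_tmul, sub_neg_eq_add])

theorem poincare_tmul (a x : H g) (t : T g) : poincare (a ⊗ₜ[ℚ] t) x = inter a x • t :=
  toHom_tmul a x t

/-- `a ∧ b = a ⊗ b - b ⊗ a`, as an element of `Λ² H ⊂ H ⊗ H`. -/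
def wedge : H g →ₗ[ℚ] H g →ₗ[ℚ] H g ⊗[ℚ] H g :=
  LinearMap.mk₂ ℚ (fun a b => a ⊗ₜ[ℚ] b - b ⊗ₜ[ℚ] a)
    (by intro a a' b; simp only [TensorProduct.add_tmul, TensorProduct.tmul_add]; abel)
    (by intro c a b; simp [TensorProduct.smul_tmul', smul_sub])
    (by intro a b b'; simp only [TensorProduct.add_tmul, TensorProduct.tmul_add]; abel)
    (by intro c a b; simp [TensorProduct.smul_tmul', smul_sub])

theorem wedge_apply (a b : H g) : wedge a b = a ⊗ₜ[ℚ] b - b ⊗ₜ[ℚ] a := rfl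

/-- The inclusion `H ⊗ H → T`, which takes `a ∧ b` to `⁅a, b⁆`. -/
def toT : H g ⊗[ℚ] H g →ₗ[ℚ] T g :=
  LinearMap.mul' ℚ (T g) ∘ₗ TensorProduct.map inc inc

theorem toT_wedge (a b : H g) : toT (wedge a b) = ⁅inc a, inc b⁆ := by
  simp [toT, wedge_apply, Ring.lie_def]

/-- The bilinear map `(a ⊗ b, t) ↦ a ⊗ [b, t]`. -/
def bracketSnd : H g ⊗[ℚ] H g →ₗ[ℚ] T g →ₗ[ℚ] H g ⊗[ℚ] T g :=
  TensorProduct.lift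
    ((LinearMap.llcomp ℚ (T g) (T g) (H g ⊗[ℚ] T g) ∘ₗ TensorProduct.mk ℚ (H g) (T g)).compl₂
      ((LinearMap.mul ℚ (T g) - (LinearMap.mul ℚ (T g)).flip) ∘ₗ inc))

theorem bracketSnd_tmul (a b : H g) (t : T g) :
    bracketSnd (a ⊗ₜ[ℚ] b) t = a ⊗ₜ[ℚ] ⁅inc b, t⁆ := by
  simp [bracketSnd, Ring.lie_def, TensorProduct.tmul_sub]

/-- The map `ϖ : Λ² H ⊗ Λ² H → H ⊗ 𝓛₃`,
`(a ∧ b) ⊗ (c ∧ d) ↦ a ⊗ [b, [c, d]] - b ⊗ [a, [c, d]]`, as a bilinear map. -/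
def varpi : H g ⊗[ℚ] H g →ₗ[ℚ] H g ⊗[ℚ] H g →ₗ[ℚ] H g ⊗[ℚ] T g :=
  bracketSnd.compl₂ toT

theorem varpi_wedge (a b c d : H g) : varpi (wedge a b) (wedge c d) =
    a ⊗ₜ[ℚ] ⁅inc b, ⁅inc c, inc d⁆⁆ - b ⊗ₜ[ℚ] ⁅inc a, ⁅inc c, inc d⁆⁆ := by
  rw [varpi, LinearMap.compl₂_apply, toT_wedge, wedge_apply, map_sub, LinearMap.sub_apply,
    bracketSnd_tmul, bracketSnd_tmul]

/-- `t₁ ↔ t₂`, the image under `ϖ` of `t₁ ⊗ t₂ + t₂ ⊗ t₁`. -/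
def arrow : H g ⊗[ℚ] H g →ₗ[ℚ] H g ⊗[ℚ] H g →ₗ[ℚ] H g ⊗[ℚ] T g :=
  varpi + varpi.flip

theorem arrow_apply (s t : H g ⊗[ℚ] H g) : arrow s t = varpi s t + varpi t s := rfl

/-- `t^{⊗ 2}`, the image under `ϖ` of `t ⊗ t`. -/
def tensorSq (t : H g ⊗[ℚ] H g) : H g ⊗[ℚ] T g := varpi t t

/-- The symplectic class `ω = ∑ u_i ∧ v_i` in `Λ² H`. -/
def omega (g : ℕ) : H g ⊗[ℚ] H g := ∑ i : Fin g, wedge (uH i) (vH i)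

/-- `H ⊗ 𝓛₃`, where `𝓛₃` is the degree three part of the free Lie algebra on `H`. -/
def HL3 (g : ℕ) : Submodule ℚ (H g ⊗[ℚ] T g) :=
  Submodule.span ℚ {t | ∃ x y z w : H g, t = x ⊗ₜ[ℚ] ⁅inc y, ⁅inc z, inc w⁆⁆}

/-- Auxiliary to `bar`: `(y, z, w) ↦ (x ↦ 1/12 (x ∧ y) ↔ (z ∧ w))`. -/
def barAux : MultilinearMap ℚ (fun _ : Fin 3 => H g) (H g →ₗ[ℚ] H g ⊗[ℚ] T g) where
  toFun v := (1 / 12 : ℚ) • (arrow.flip (wedge (v 1) (v 2)) ∘ₗ wedge.flip (v 0))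
  map_update_add' := by
    intro inst v i x y
    obtain rfl : inst = instDecidableEqFin 3 := Subsingleton.elim _ _
    obtain rfl | rfl | rfl : i = 0 ∨ i = 1 ∨ i = 2 := by omega
    all_goals simp [LinearMap.comp_add, LinearMap.add_comp, smul_add]
  map_update_smul' := by
    intro inst v i c x
    obtain rfl : inst = instDecidableEqFin 3 := Subsingleton.elim _ _
    obtain rfl | rfl | rfl : i = 0 ∨ i = 1 ∨ i = 2 := by omega
    all_goals simp [LinearMap.comp_smul, LinearMap.smul_comp, smul_smul, mul_comm]

/-- The map `H ⊗ 𝓛₃ → 𝓗₂`, `x ⊗ [y, [z, w]] ↦ 1/4 (x ∧ y) ↔ (z ∧ w)` (see `bar_bracket`), given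
by `x ⊗ (y ⊗ z ⊗ w) ↦ 1/12 (x ∧ y) ↔ (z ∧ w)` on `H ⊗ H^{⊗ 3}`.  Only its values on `HL3 g`
matter. -/
def bar : H g ⊗[ℚ] T g →ₗ[ℚ] H g ⊗[ℚ] T g :=
  TensorProduct.lift
    (PiTensorProduct.lift barAux ∘ₗ DirectSum.component ℚ ℕ (fun n => ⨂[ℚ]^n (H g)) 3 ∘ₗ
      (TensorAlgebra.toDirectSum (R := ℚ) (M := H g)).toLinearMap).flip

theorem bar_word (x y z w : H g) : bar (x ⊗ₜ[ℚ] (inc y * (inc z * inc w))) =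
    (1 / 12 : ℚ) • arrow (wedge x y) (wedge z w) := by
  have h : inc y * (inc z * inc w) = TensorAlgebra.tprod ℚ (H g) 3 ![y, z, w] := by
    simp [TensorAlgebra.tprod_apply, inc, List.ofFn_succ]
  rw [h]
  simp only [bar, TensorProduct.lift.tmul, LinearMap.flip_apply, LinearMap.comp_apply,
    AlgHom.toLinearMap_apply, TensorAlgebra.toDirectSum_tensorPower_tprod]
  erw [DirectSum.component.of]
  simp [barAux]

theorem bar_bracket (x y z w : H g) : bar (x ⊗ₜ[ℚ] ⁅inc y, ⁅inc z, inc w⁆⁆) =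
    (1 / 4 : ℚ) • arrow (wedge x y) (wedge z w) := by
  have h : ⁅inc y, ⁅inc z, inc w⁆⁆ = inc y * (inc z * inc w) - inc y * (inc w * inc z)
      - inc z * (inc w * inc y) + inc w * (inc z * inc y) := by
    simp only [Ring.lie_def]; noncomm_ring
  rw [h]
  simp only [TensorProduct.tmul_add, TensorProduct.tmul_sub, map_add, map_sub, bar_word]
  simp only [arrow_apply, varpi_wedge, Ring.lie_def, mul_sub, sub_mul, mul_assoc,
    TensorProduct.tmul_sub]
  module

/-! ### The completed tensor algebra and Magnus expansions -/

/-- The completed tensor algebra `∏ H^{⊗ n}`, realised as the algebra of the power series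
`∑ tₙ Xⁿ` over the tensor algebra in which `tₙ` is homogeneous of degree `n`. -/
def That (g : ℕ) : Subalgebra ℚ (PowerSeries (T g)) where
  carrier := {f | ∀ n, PowerSeries.coeff n f ∈ deg g n}
  mul_mem' := by
    intro a b ha hb n
    rw [PowerSeries.coeff_mul]
    refine Submodule.sum_mem _ fun p hp => ?_
    rw [← Finset.HasAntidiagonal.mem_antidiagonal.mp hp, deg, pow_add]
    exact Submodule.mul_mem_mul (ha _) (hb _)
  add_mem' := by
    intro a b ha hb n
    rw [map_add]
    exact Submodule.add_mem _ (ha n) (hb n)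
  algebraMap_mem' := by
    intro r n
    rw [Algebra.algebraMap_eq_smul_one, LinearMap.map_smul_of_tower, PowerSeries.coeff_one]
    refine Submodule.smul_mem _ _ ?_
    split_ifs with h
    · subst h
      simp [deg]
    · exact Submodule.zero_mem _

/-- The component of degree `n`. -/
def comp (n : ℕ) (f : That g) : T g := PowerSeries.coeff n (f : PowerSeries (T g))

/-- Membership in the ideal `∏_{n ≥ p} H^{⊗ n}`. -/
def InFilt (p : ℕ) (f : That g) : Prop := ∀ n < p, comp n f = 0

/-- The inclusion of `H` in the completed tensor algebra, in degree one. -/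
def hat (x : H g) : That g :=
  ⟨PowerSeries.monomial 1 (inc x), by
    intro n
    rw [PowerSeries.coeff_monomial]
    split_ifs with h
    · subst h
      rw [deg, pow_one]
      exact ⟨x, rfl⟩
    · exact Submodule.zero_mem _⟩

/-- A generalized Magnus expansion: a homomorphism `θ` from the fundamental group to the
multiplicative group `1 + ∏_{n ≥ 1} H^{⊗ n}` with `θ(x) = 1 + [x] + (terms of degree ≥ 2)`. -/
structure MagnusExpansion (g : ℕ) where
  toMonoidHom : Pi1 g →* That g
  comp_zero : ∀ x, comp 0 (toMonoidHom x) = 1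
  comp_one : ∀ x, comp 1 (toMonoidHom x) = inc (cls x)

/-- `IA`: the filtration preserving algebra automorphisms of the completed tensor algebra that
act trivially on the quotient of the first by the second filtration step. -/
structure IA (g : ℕ) where
  toAlgEquiv : That g ≃ₐ[ℚ] That g
  filtered : ∀ p f, InFilt p (toAlgEquiv f) ↔ InFilt p f
  unipotent : ∀ f, InFilt 1 f → InFilt 2 (toAlgEquiv f - f)

/-- The `m`-th component of an element of `IA`, as a homomorphism `H → H^{⊗ (m+1)}`. -/
def IA.hom (U : IA g) (m : ℕ) : H g →ₗ[ℚ] T g where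
  toFun x := comp (m + 1) (U.toAlgEquiv (hat x))
  map_add' x y := by
    have h : hat (x + y) = hat x + hat y := Subtype.ext (by simp [hat])
    simp [h, comp]
  map_smul' c x := by
    have h : hat (c • x) = c • hat x := by
      refine Subtype.ext (PowerSeries.ext fun n => ?_)
      simp only [hat, Subalgebra.coe_smul, PowerSeries.coeff_monomial, map_smul,
        LinearMap.map_smul_of_tower]
    simp [h, comp, LinearMap.map_smul_of_tower]

/-- The `m`-th component of an element of `IA`, as a tensor in `H ⊗ H^{⊗ (m+1)}`. -/
def IA.tau (U : IA g) (m : ℕ) : H g ⊗[ℚ] T g := poincare.symm (U.hom m)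

/-- `U` is the total Johnson map `θ ∘ φ ∘ θ⁻¹` of `φ` with respect to `θ`. -/
def IsTotalJohnson (θ : MagnusExpansion g) (φ : MulAut (Pi1 g)) (U : IA g) : Prop :=
  ∀ x, U.toAlgEquiv (θ.toMonoidHom x) = θ.toMonoidHom (φ x)

/-- `t` is the value at `φ` of the `m`-th Johnson homomorphism: for every `x`, the class of
`φ(x) x⁻¹` in `Γ_m / Γ_{m+1} ≅ 𝓛_{m+1}` is the value at `[x]` of the homomorphism given by `t`.
The isomorphism sends the class of `y` to the lowest term of `θ(y) - 1`, in degree `m + 1`, for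
any Magnus expansion `θ`. -/
def IsJohnson (m : ℕ) (φ : MulAut (Pi1 g)) (t : H g ⊗[ℚ] T g) : Prop :=
  IsTorelli m φ ∧ ∀ (θ : MagnusExpansion g) (x : Pi1 g),
    InFilt (m + 1) (θ.toMonoidHom (φ x * x⁻¹) - 1) ∧
      comp (m + 1) (θ.toMonoidHom (φ x * x⁻¹)) = poincare t (cls x)

/-! ### Exponential, logarithm and the Hausdorff series -/

/-- The exponential of a series without constant term. -/
def expS (f : PowerSeries (T g)) : PowerSeries (T g) :=
  PowerSeries.mk fun n =>
    PowerSeries.coeff n (∑ k ∈ Finset.range (n + 1), ((k.factorial : ℚ)⁻¹) • f ^ k)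

/-- The logarithm of a series with constant term `1`. -/
def logS (f : PowerSeries (T g)) : PowerSeries (T g) :=
  PowerSeries.mk fun n =>
    PowerSeries.coeff n (∑ k ∈ Finset.Icc 1 n, ((-1 : ℚ) ^ (k + 1) / k) • (f - 1) ^ k)

/-- The nonlinear part `h(X, Y) = log (exp X exp Y) - X - Y` of the Hausdorff series. -/
def hausdorff (x y : PowerSeries (T g)) : PowerSeries (T g) :=
  logS (expS x * expS y) - x - y

/-! ### Marked trivalent bordered fatgraphs -/

/-- The data of a marked bordered fatgraph with set `D` of oriented edges: `next e` is the oriented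
edge which follows `e` in the cyclic order of the oriented edges pointing into the head of `e`;
`rev` reverses orientation; `tail` is the tail, pointing away from its univalent vertex; and
`mark` is the marking by elements of the fundamental group. -/
@[ext]
structure Fatgraph (g : ℕ) (D : Type) where
  next : D → D
  rev : D → D
  tail : D
  mark : D → Pi1 g

namespace Fatgraph

variable {D : Type}

/-- The step along the boundary cycle: from an incoming edge to the outgoing edge next to it in the
cyclic order. -/
def bdry (G : Fatgraph g D) (e : D) : D := G.rev (G.next e)

/-- `G` is a trivalent once-bordered fatgraph of genus `g`, and `mark` is a `π`-marking of it.
Since `#D = 2E`, and there are `V = 1 + (#D - 1) / 3` vertices, `#D + 2 = 12 g` is the Euler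
characteristic condition `V - E = 1 - 2 g`.  Connectedness is part of `one_boundary`. -/
structure IsMarkedTrivalent (G : Fatgraph g D) : Prop where
  rev_rev : ∀ e, G.rev (G.rev e) = e
  rev_ne : ∀ e, G.rev e ≠ e
  /-- All vertices have valence three or one. -/
  next_next_next : ∀ e, G.next (G.next (G.next e)) = e
  /-- The only univalent vertex is the one at the tail. -/
  univalent : ∀ e, G.next e = e ↔ e = G.rev G.tail
  /-- There is only one boundary cycle. -/
  one_boundary : ∀ e, ∃ n : ℕ, G.bdry^[n] G.tail = e
  genus : Nat.card D + 2 = 12 * g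
  orientation : ∀ e, G.mark (G.rev e) * G.mark e = 1
  vertex : ∀ e, G.next e ≠ e → G.mark e * G.mark (G.next e) * G.mark (G.next (G.next e)) = 1
  full_rank : Subgroup.closure (Set.range G.mark) = ⊤
  geometric : G.mark (G.rev G.tail) = boundary g

/-- The marked fatgraph `φ(G)`. -/
def act (φ : MulAut (Pi1 g)) (G : Fatgraph g D) : Fatgraph g D :=
  { G with mark := fun e => φ (G.mark e) }

/-- Isomorphism of marked fatgraphs. -/
def Iso {D' : Type} (G : Fatgraph g D) (G' : Fatgraph g D') : Prop :=
  ∃ f : D ≃ D', (∀ e, f (G.next e) = G'.next (f e)) ∧ (∀ e, f (G.rev e) = G'.rev (f e)) ∧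
    f G.tail = G'.tail ∧ ∀ e, G.mark e = G'.mark (f e)

/-- A Whitehead move can be performed on `e`: it is not the tail and has distinct endpoints. -/
def CanMove (G : Fatgraph g D) (e : D) : Prop :=
  e ≠ G.tail ∧ e ≠ G.rev G.tail ∧
    G.rev e ≠ e ∧ G.rev e ≠ G.next e ∧ G.rev e ≠ G.next (G.next e)

/-- The Whitehead move on `e`.  If the vertices at the two ends of `e` have the cyclically ordered
incoming edges `(e, a, b)` and `(ē, c, d)`, collapsing `e` gives a vertex with `(a, b, c, d)`, and
uncollapsing it in the other way gives the vertices `(f, b, c)` and `(f̄, d, a)` with a new edge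
`f`, for which the name `e` is used again.  The markings of the other edges are unchanged, and
vertex compatibility determines the marking of `f`. -/
def whitehead [DecidableEq D] (G : Fatgraph g D) (e : D) : Fatgraph g D :=
  let e' := G.rev e
  let a := G.next e
  let b := G.next a
  let c := G.next e'
  let d := G.next c
  { next := fun x =>
      if x = e then b else if x = b then c else if x = c then e
      else if x = e' then d else if x = d then a else if x = a then e'
      else G.next x
    rev := G.rev
    tail := G.tail
    mark := fun x =>
      if x = e then (G.mark b * G.mark c)⁻¹ else if x = e' then G.mark b * G.mark c
      else G.mark x }

/-- The edge to the right of the tail: the one along which the boundary cycle continues. -/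
def rightEdge (G : Fatgraph g D) : D := G.next G.tail

/-- The Whitehead move on the edge to the right of the tail. -/
def moveRight [DecidableEq D] (G : Fatgraph g D) : Fatgraph g D := G.whitehead G.rightEdge

/-! ### Fatgraph Magnus expansions -/

/-- The position of an oriented edge in the boundary cycle that starts with the tail. -/
def pos (G : Fatgraph g D) (e : D) : ℕ := sInf {n | G.bdry^[n] G.tail = e}

/-- The `n`-th component `ℓₙ(x)`.  If `x` precedes `x̄` in the boundary cycle started at the tail,
then `ℓₙ(x) = - 1/3 ∑ h(ℓ(f_{i-1}), - ℓ(f_i))ₙ` for `n ≥ 2`, where `f_0 = x, …, f_k = x̄` is the path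
from `x` to `x̄` along the boundary cycle; otherwise `ℓₙ(x) = - ℓₙ(x̄)`.  Moreover `ℓ₀ = 0`, and
`ℓ₁(x)` is the homology class of `x`. -/
def ell (G : Fatgraph g D) (n : ℕ) (x : D) : T g :=
  if n = 0 then 0
  else if n = 1 then inc (cls (G.mark x))
  else
    let low : D → PowerSeries (T g) := fun y =>
      PowerSeries.mk fun m => if _h : m < n then ell G m y else 0
    let integral : D → T g := fun y =>
      -((1 / 3 : ℚ) • ∑ j ∈ Finset.Ico (G.pos y) (G.pos (G.rev y)),
        PowerSeries.coeff n
          (hausdorff (low (G.bdry^[j] G.tail)) (-low (G.bdry^[j + 1] G.tail))))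
    if G.pos x < G.pos (G.rev x) then integral x else -integral (G.rev x)
termination_by n

/-- `θ` is the fatgraph Magnus expansion of `G`: its value on every oriented edge `x` is
`exp (ℓ(x))`. -/
def IsFatgraphMagnus (G : Fatgraph g D) (θ : MagnusExpansion g) : Prop :=
  ∀ x : D, (θ.toMonoidHom (G.mark x) : PowerSeries (T g)) =
    expS (PowerSeries.mk fun n => G.ell n x)

end Fatgraph

/-- `U` is the fatgraph Johnson map `θ ∘ θ'⁻¹` of a Whitehead move `G → G'`, where `θ` and `θ'`
are the fatgraph Magnus expansions of `G` and `G'`. -/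
def IsFatgraphJohnson (θ θ' : MagnusExpansion g) (U : IA g) : Prop :=
  ∀ x, U.toAlgEquiv (θ'.toMonoidHom x) = θ.toMonoidHom x

/-! ### The symplectic fatgraph -/

/-- The edges of the symplectic fatgraph of genus `g`.  For every handle `i` there are edges
`u i`, `v i`, `p i`, `q i` and the edge `s i` at which the handle is attached; the edge `r j` is the
trunk edge beyond which the handles `0, …, j + 1` lie. -/
inductive SympEdge (g : ℕ) : Type
  | u (i : Fin g)
  | v (i : Fin g)
  | p (i : Fin g)
  | q (i : Fin g)
  | s (i : Fin g)
  | r (j : Fin (g - 1))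
  deriving DecidableEq

/-- Oriented edges; `false` stands for the reversed orientation. -/
abbrev SympDart (g : ℕ) : Type := SympEdge g × Bool

/-- The edge beyond which exactly the handles `0, …, j` lie. -/
def trunk (j : Fin g) : SympEdge g :=
  if h : j.val = 0 then .s j else .r ⟨j.val - 1, by have := j.isLt; omega⟩

/-- The cyclic order of the incoming edges at the vertices of the symplectic fatgraph.  The vertices
of the handle `i` are `(u, v, p)`, `(ū, v̄, q̄)` and `(s, p̄, q)`; those of the trunk are
`(r_j, x̄, s̄_{j+1})`, where `x` is the edge beyond which the handles `0, …, j` lie.  The remaining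
vertex is the univalent one. -/
def sympNext : SympDart g → SympDart g
  | (.u i, true) => (.v i, true)
  | (.v i, true) => (.p i, true)
  | (.p i, true) => (.u i, true)
  | (.u i, false) => (.v i, false)
  | (.v i, false) => (.q i, false)
  | (.q i, false) => (.u i, false)
  | (.s i, true) => (.p i, false)
  | (.p i, false) => (.q i, true)
  | (.q i, true) => (.s i, true)
  | (.r j, true) => (trunk ⟨j.val, by have := j.isLt; omega⟩, false)
  | (.s i, false) =>
      if _h0 : i.val = 0 then
        if h : 1 < g then (.s ⟨1, h⟩, false) else (.s i, false)
      else (.r ⟨i.val - 1, by have := i.isLt; omega⟩, true)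
  | (.r j, false) =>
      if h : j.val + 2 < g then (.s ⟨j.val + 2, h⟩, false) else (.r j, false)

/-- The markings of the edges of the symplectic fatgraph. -/
def sympMark : SympEdge g → Pi1 g
  | .u i => uGen i
  | .v i => vGen i
  | .p i => (uGen i * vGen i)⁻¹
  | .q i => (vGen i * uGen i)⁻¹
  | .s i => (comm (uGen i) (vGen i))⁻¹
  | .r j => (partialBoundary g (j.val + 2))⁻¹

/-- The symplectic fatgraph `G₀` of genus `g`, with its standard marking. -/
def sympFatgraph (g : ℕ) (hg : 0 < g) : Fatgraph g (SympDart g) where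
  next := sympNext
  rev := fun e => (e.1, !e.2)
  tail := (trunk ⟨g - 1, by omega⟩, true)
  mark := fun e => if e.2 then sympMark e.1 else (sympMark e.1)⁻¹

/-- The marked fatgraph obtained from `G₀` by `i` successive Whitehead moves, each on the edge to
the right of the tail. -/
def tailSequence (g : ℕ) (hg : 0 < g) (i : ℕ) : Fatgraph g (SympDart g) :=
  Fatgraph.moveRight^[i] (sympFatgraph g hg)

end

end FatgraphJohnson

open FatgraphJohnson

open scoped TensorProduct

namespace FatgraphJohnson

variable {g : ℕ}

/-! The boundary twist is conjugation by `∂`. Since `∂` is a product of commutators, every Magnus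
expansion has `θ(∂) = 1 + ω + (degree ≥ 3)`. Hence `θ(∂⁻¹x∂)` and `θ(x)` first differ in degree
three, by `[[x], ω]` (`comp_two_boundary`, `comp_three_conj`). Poincaré duality turns `x ↦ [x, ω]`
into `ω^{⊗2}` (`poincare_tensorSq_omega`). This tensor is fixed by `bar`, because `u_i ∧ v_i = -v_i
∧ u_i` lets the two quarters coming from handle `i` add up to the coefficient one half.

For fatgraph expansions, let `Sₙ(y)` be the sum of the Hausdorff terms of degree `n` along the
boundary cycle from the tail to `y`. Whichever of `x`, `x̄` comes first, `ℓₙ(x) = (Sₙ(x) -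
Sₙ(x̄))/3` (`ell_eq`), so the three `ℓₙ` at a trivalent vertex add up to minus a third of its three
corner terms. If the product of the three exponentials, truncated below degree `n`, is `1 + ε` up to
degree `n`, then cyclic invariance makes each corner equal to `ε`, and adding the `ℓₙ` removes the
error. This proves the vertex relations (`expS_vertex`). Because the marking presents `π₁`, the
expansion then exists and is unique.

A move on the edge to the right of the tail slides the tail over that edge. Up to renaming, the
result is the same closed graph with the tail attached at the next edge, and only the marking of the
passed edge changes (`moveRight_attach`). A full tour passes each of the `12g - 6` oriented edges of
the closed graph once. Each marking is thereby multiplied by `∂⁻¹` on the left and by `∂` on the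
right, which is the action of the twist.

No single `τ₂(Wᵢ)` is computed. The tail is null-homologous, so a slide shifts `S₂` by one constant
on all edges except the tail and the moved edge. There `ℓ₂` is unchanged and `τ₁(Wᵢ) = 0`
(`partialSum_two`, `hom_one_eq_zero`). Each `τ₂(Wᵢ)` is then the difference of the degree three
parts of consecutive expansions, and the sum telescopes. As `ℓ` sees markings only through their
homology classes, the last expansion precomposed with the twist is the first one. The total is
therefore the degree three variation of one expansion under the twist, which is `ω^{⊗2}`
(`sum_tau_two`). -/

/-! ### Tensor identities for `ω^{⊗2}` -/

/-- The commutator of tensors as a bilinear map. -/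
noncomputable def lieT : T g →ₗ[ℚ] T g →ₗ[ℚ] T g :=
  LinearMap.mul ℚ (T g) - (LinearMap.mul ℚ (T g)).flip

theorem lieT_apply (a b : T g) : lieT a b = ⁅a, b⁆ := by simp [lieT, Ring.lie_def]

theorem toT_omega : toT (omega g) = ∑ i : Fin g, ⁅inc (uH i), inc (vH i)⁆ := by
  simp [omega, toT_wedge]

theorem varpi_wedge_left (a b : H g) (t : H g ⊗[ℚ] H g) :
    varpi (wedge a b) t = a ⊗ₜ[ℚ] ⁅inc b, toT t⁆ - b ⊗ₜ[ℚ] ⁅inc a, toT t⁆ := by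
  rw [varpi, LinearMap.compl₂_apply, wedge_apply, map_sub, LinearMap.sub_apply,
    bracketSnd_tmul, bracketSnd_tmul]

theorem tensorSq_omega : tensorSq (omega g) =
    ∑ i : Fin g, (uH i ⊗ₜ[ℚ] ⁅inc (vH i), toT (omega g)⁆
      - vH i ⊗ₜ[ℚ] ⁅inc (uH i), toT (omega g)⁆) := by
  simp only [← varpi_wedge_left]
  rw [tensorSq]
  conv_lhs => enter [1]; rw [omega]
  simp [LinearMap.sum_apply]

/-- By linearity the sum collapses to `½ (ω ↔ ω)`, and symmetrizing at a diagonal pair doubles `ϖ(ω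
⊗ ω)`. -/
theorem sum_half_arrow_omega :
    ∑ i : Fin g, (1 / 2 : ℚ) • arrow (wedge (uH i) (vH i)) (omega g) = tensorSq (omega g) := by
  rw [← Finset.smul_sum, ← LinearMap.sum_apply, ← map_sum, ← omega, arrow_apply, tensorSq]
  module

/-- The terms `u_i ⊗ [v_i, ω]` and `-v_i ⊗ [u_i, ω]` have the same image `¼ (u_i ∧ v_i) ↔ ω`, by
antisymmetry of the wedge. Together they give the half that appears in `sum_half_arrow_omega`. -/
theorem bar_tensorSq_omega : bar (tensorSq (omega g)) = tensorSq (omega g) := by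
  have key (x y : H g) : bar (x ⊗ₜ[ℚ] ⁅inc y, toT (omega g)⁆) =
      (1 / 4 : ℚ) • arrow (wedge x y) (omega g) := by
    rw [toT_omega, ← lieT_apply, map_sum, TensorProduct.tmul_sum, map_sum]
    simp only [lieT_apply, bar_bracket, ← Finset.smul_sum]
    rw [← map_sum, ← omega]
  -- The first rewriting expands both sides; the right one is folded back and put in its arrow form,
  -- so that the sums match handle by handle.
  rw [tensorSq_omega, map_sum, ← tensorSq_omega, ← sum_half_arrow_omega]
  refine Finset.sum_congr rfl fun i _ => ?_
  have h : wedge (vH i) (uH i) = -wedge (uH i) (vH i) := by simp [wedge_apply]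
  rw [map_sub, key, key, h, map_neg, LinearMap.neg_apply]
  module

/-- Pairing with the symplectic basis reads off the coordinates of `x`. The bracket form is the one
in which conjugation by `∂` meets the tensor. -/
theorem poincare_tensorSq_omega (x : H g) :
    poincare (tensorSq (omega g)) x = ⁅inc x, toT (omega g)⁆ := by
  rw [tensorSq_omega, map_sum, LinearMap.sum_apply]
  conv_rhs => rw [sum_basis x]
  simp only [map_sum, map_sub, LinearMap.sub_apply, poincare_tmul, inter_uH, inter_vH,
    map_add, map_smul, ← lieT_apply, LinearMap.sum_apply, LinearMap.add_apply,
    LinearMap.smul_apply]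
  refine Finset.sum_congr rfl fun i _ => ?_
  module

/-! ### Lie elements of degree two and three -/

/-- The degree three part of the free Lie algebra on `H`. -/
def lieThree (g : ℕ) : Submodule ℚ (T g) :=
  Submodule.span ℚ {t | ∃ y z w : H g, t = ⁅inc y, ⁅inc z, inc w⁆⁆}

/-- The degree two part of the free Lie algebra on `H`. -/
def lieTwo (g : ℕ) : Submodule ℚ (T g) :=
  Submodule.span ℚ {t | ∃ z w : H g, t = ⁅inc z, inc w⁆}

theorem lie_mem_lieTwo (z w : H g) : ⁅inc z, inc w⁆ ∈ lieTwo g :=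
  Submodule.subset_span ⟨z, w, rfl⟩

theorem lie_mem_lieThree (y : H g) {t : T g} (ht : t ∈ lieTwo g) : ⁅inc y, t⁆ ∈ lieThree g := by
  rw [← lieT_apply]
  induction ht using Submodule.span_induction with
  | mem t ht =>
    obtain ⟨z, w, rfl⟩ := ht
    exact Submodule.subset_span ⟨y, z, w, lieT_apply _ _⟩
  | zero => simp
  | add a b _ _ ha hb => rw [map_add]; exact add_mem ha hb
  | smul c a _ ha => rw [map_smul]; exact Submodule.smul_mem _ _ ha

theorem tmul_mem_HL3 (x : H g) {t : T g} (ht : t ∈ lieThree g) : x ⊗ₜ[ℚ] t ∈ HL3 g := by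
  induction ht using Submodule.span_induction with
  | mem t ht =>
    obtain ⟨y, z, w, rfl⟩ := ht
    exact Submodule.subset_span ⟨x, y, z, w, rfl⟩
  | zero => simp
  | add a b _ _ ha hb => rw [TensorProduct.tmul_add]; exact add_mem ha hb
  | smul c a _ ha => rw [TensorProduct.tmul_smul]; exact Submodule.smul_mem _ _ ha

/-- The inverse of Poincaré duality is the explicit sum of `u_i ⊗ f(v_i) - v_i ⊗ f(u_i)`, so
membership may be tested on values. -/
theorem poincare_symm_mem_HL3 {f : H g →ₗ[ℚ] T g} (hf : ∀ x, f x ∈ lieThree g) :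
    poincare.symm f ∈ HL3 g := by
  change ofHom f ∈ _
  rw [ofHom, LinearMap.sum_apply]
  exact sum_mem fun i _ => sub_mem (tmul_mem_HL3 _ (hf _)) (tmul_mem_HL3 _ (hf _))

theorem tensorSq_omega_mem_HL3 : tensorSq (omega g) ∈ HL3 g := by
  rw [← poincare.symm_apply_apply (tensorSq (omega g))]
  refine poincare_symm_mem_HL3 fun x => ?_
  rw [poincare_tensorSq_omega, toT_omega]
  exact lie_mem_lieThree _ (sum_mem fun i _ => lie_mem_lieTwo _ _)

/-! ### Homology classes -/

theorem cls_one : cls (1 : Pi1 g) = 0 := by simp [cls]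

theorem cls_mul (x y : Pi1 g) : cls (x * y) = cls x + cls y := by simp [cls]

theorem cls_inv (x : Pi1 g) : cls x⁻¹ = -cls x := by simp [cls]

theorem cls_of (i : Gen g) : cls (FreeGroup.of i) = Pi.single i 1 := by simp [cls, clsHom]

theorem cls_comm (x y : Pi1 g) : cls (comm x y) = 0 := by
  simp only [comm, cls_mul, cls_inv]; abel

theorem cls_prod_of_forall {l : List (Pi1 g)} (h : ∀ x ∈ l, cls x = 0) : cls l.prod = 0 := by
  induction l with
  | nil => simpa using cls_one
  | cons a l ih =>
    rw [List.prod_cons, cls_mul, h a (by simp), ih fun x hx => h x (by simp [hx]), add_zero]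

theorem cls_boundary : cls (boundary g) = 0 := by
  refine cls_prod_of_forall fun x hx => ?_
  obtain ⟨i, rfl⟩ := List.mem_ofFn.1 (List.mem_of_mem_take hx)
  exact cls_comm _ _

theorem boundaryTwist_apply (x : Pi1 g) :
    boundaryTwist g x = (boundary g)⁻¹ * x * boundary g := by
  simp [boundaryTwist]

theorem cls_boundaryTwist (x : Pi1 g) : cls (boundaryTwist g x) = cls x := by
  simp [boundaryTwist_apply, cls_mul, cls_inv]

/-- A submodule of `H` which contains the classes of a generating set is everything. -/
theorem mem_of_cls_mem {ι : Type*} {m : ι → Pi1 g} (hm : Subgroup.closure (Set.range m) = ⊤)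
    {S : Submodule ℚ (H g)} (h : ∀ i, cls (m i) ∈ S) (x : H g) : x ∈ S := by
  have hall (y : Pi1 g) : cls y ∈ S := by
    have hy : y ∈ Subgroup.closure (Set.range m) := hm ▸ Subgroup.mem_top y
    induction hy using Subgroup.closure_induction with
    | mem y hy => obtain ⟨i, rfl⟩ := hy; exact h i
    | one => rw [cls_one]; exact zero_mem _
    | mul a b _ _ ha hb => rw [cls_mul]; exact add_mem ha hb
    | inv a _ ha => rw [cls_inv]; exact neg_mem ha
  rw [sum_basis x]
  refine sum_mem fun i _ => add_mem (Submodule.smul_mem _ _ ?_) (Submodule.smul_mem _ _ ?_)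
  · rw [uH, ← cls_of]; exact hall _
  · rw [vH, ← cls_of]; exact hall _

/-- Homology classes span `H`. This lets Johnson components be compared through elements of `π₁`,
where Magnus expansions can be evaluated. -/
theorem linearMap_ext_cls {M : Type*} [AddCommGroup M] [Module ℚ M] {f f' : H g →ₗ[ℚ] M}
    (h : ∀ x : Pi1 g, f (cls x) = f' (cls x)) : f = f' := by
  refine LinearMap.ext fun x => ?_
  have := mem_of_cls_mem (m := fun y : Pi1 g => y) (S := LinearMap.eqLocus f f')
    (by rw [Set.range_id', Subgroup.closure_univ]) h x
  exact this

/-! ### Components in the completed tensor algebra -/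

theorem comp_ext {f f' : That g} (h : ∀ n, comp n f = comp n f') : f = f' :=
  Subtype.ext (PowerSeries.ext h)

theorem comp_add (n : ℕ) (f f' : That g) : comp n (f + f') = comp n f + comp n f' := by
  simp [comp]

theorem comp_sub (n : ℕ) (f f' : That g) : comp n (f - f') = comp n f - comp n f' := by
  simp [comp]

theorem comp_smul (n : ℕ) (c : ℚ) (f : That g) : comp n (c • f) = c • comp n f := by
  simp [comp, LinearMap.map_smul_of_tower]

theorem comp_zero_right (n : ℕ) : comp n (0 : That g) = 0 := by simp [comp]

theorem comp_one_right (n : ℕ) : comp n (1 : That g) = if n = 0 then 1 else 0 := by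
  simp [comp, PowerSeries.coeff_one]

theorem comp_sum {ι : Type*} (n : ℕ) (s : Finset ι) (f : ι → That g) :
    comp n (∑ i ∈ s, f i) = ∑ i ∈ s, comp n (f i) := by
  simp [comp]

theorem comp_mul (n : ℕ) (f f' : That g) :
    comp n (f * f') = ∑ p ∈ Finset.HasAntidiagonal.antidiagonal n, comp p.1 f * comp p.2 f' := by
  simp [comp, PowerSeries.coeff_mul]

theorem comp_zero_mul (f f' : That g) : comp 0 (f * f') = comp 0 f * comp 0 f' := by
  simp [comp_mul]

theorem comp_one_mul (f f' : That g) :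
    comp 1 (f * f') = comp 0 f * comp 1 f' + comp 1 f * comp 0 f' := by
  rw [comp_mul, Finset.Nat.sum_antidiagonal_eq_sum_range_succ_mk]
  simp [Finset.sum_range_succ]

theorem comp_two_mul (f f' : That g) :
    comp 2 (f * f') = comp 0 f * comp 2 f' + comp 1 f * comp 1 f' + comp 2 f * comp 0 f' := by
  rw [comp_mul, Finset.Nat.sum_antidiagonal_eq_sum_range_succ_mk]
  simp [Finset.sum_range_succ]

theorem comp_three_mul (f f' : That g) :
    comp 3 (f * f') = comp 0 f * comp 3 f' + comp 1 f * comp 2 f' + comp 2 f * comp 1 f'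
      + comp 3 f * comp 0 f' := by
  rw [comp_mul, Finset.Nat.sum_antidiagonal_eq_sum_range_succ_mk]
  simp [Finset.sum_range_succ]

theorem comp_mem (n : ℕ) (f : That g) : comp n f ∈ deg g n := f.2 n

theorem comp_hat (n : ℕ) (x : H g) : comp n (hat x) = if n = 1 then inc x else 0 := by
  simp [comp, hat, PowerSeries.coeff_monomial]

theorem InFilt.mul {p q : ℕ} {f f' : That g} (hf : InFilt p f) (hf' : InFilt q f') :
    InFilt (p + q) (f * f') := by
  intro n hn
  rw [comp_mul]
  refine Finset.sum_eq_zero fun a ha => ?_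
  have := Finset.HasAntidiagonal.mem_antidiagonal.1 ha
  rcases lt_or_ge a.1 p with h | h
  · rw [hf _ h, zero_mul]
  · rw [hf' a.2 (by omega), mul_zero]

theorem InFilt.add {p : ℕ} {f f' : That g} (hf : InFilt p f) (hf' : InFilt p f') :
    InFilt p (f + f') := fun n hn => by rw [comp_add, hf n hn, hf' n hn, add_zero]

theorem InFilt.sub {p : ℕ} {f f' : That g} (hf : InFilt p f) (hf' : InFilt p f') :
    InFilt p (f - f') := fun n hn => by rw [comp_sub, hf n hn, hf' n hn, sub_zero]

theorem InFilt.mono {p q : ℕ} {f : That g} (hf : InFilt p f) (h : q ≤ p) : InFilt q f :=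
  fun n hn => hf n (by omega)

theorem deg_zero_eq {t : T g} (ht : t ∈ deg g 0) : ∃ c : ℚ, t = algebraMap ℚ (T g) c := by
  rw [deg, pow_zero, Submodule.mem_one] at ht
  obtain ⟨c, hc⟩ := ht
  exact ⟨c, hc.symm⟩

/-- Induction on tensors by splitting off the leftmost letter, using `H^{⊗(n+1)} = H · H^{⊗n}`. -/
theorem deg_succ_induction {n : ℕ} {C : T g → Prop} {t : T g} (ht : t ∈ deg g (n + 1))
    (hmul : ∀ (x : H g) (s : T g), s ∈ deg g n → C (inc x * s))
    (hadd : ∀ s s', C s → C s' → C (s + s')) : C t := by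
  rw [deg, pow_succ'] at ht
  induction ht using Submodule.mul_induction_on' with
  | mem_mul_mem m hm s hs => obtain ⟨x, rfl⟩ := hm; exact hmul x s hs
  | add x _ y _ hx hy => exact hadd x y hx hy

/-! ### Filtered endomorphisms of the completed tensor algebra -/

section Extension

variable (φ : H g →ₗ[ℚ] That g)

/-- Each letter is replaced by a series without constant term, so a word of length `k` lands in
filtration `k`. -/
theorem lift_filt (h0 : ∀ x, comp 0 (φ x) = 0) {k : ℕ} {t : T g} (ht : t ∈ deg g k) :
    InFilt k (TensorAlgebra.lift ℚ φ t) := by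
  induction k generalizing t with
  | zero => exact fun n hn => absurd hn (by omega)
  | succ k ih =>
    refine deg_succ_induction (C := fun t => InFilt (k + 1) (TensorAlgebra.lift ℚ φ t)) ht
      (fun x s hs => ?_) fun s s' hs hs' => ?_
    · rw [map_mul, inc, TensorAlgebra.lift_ι_apply, add_comm k 1]
      refine InFilt.mul (fun n hn => ?_) (ih hs)
      rw [Nat.lt_one_iff.1 hn, h0]
    · rw [map_add]; exact hs.add hs'

/-- Only the linear term of every letter can reach the lowest degree, and it is the letter itself:
the extension is unitriangular for the grading. -/
theorem comp_lift_self (h0 : ∀ x, comp 0 (φ x) = 0) (h1 : ∀ x, comp 1 (φ x) = inc x) {k : ℕ}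
    {t : T g} (ht : t ∈ deg g k) : comp k (TensorAlgebra.lift ℚ φ t) = t := by
  induction k generalizing t with
  | zero =>
    obtain ⟨c, rfl⟩ := deg_zero_eq ht
    rw [AlgHom.commutes, Algebra.algebraMap_eq_smul_one, comp_smul, comp_one_right, if_pos rfl,
      Algebra.algebraMap_eq_smul_one]
  | succ k ih =>
    refine deg_succ_induction (C := fun t => comp (k + 1) (TensorAlgebra.lift ℚ φ t) = t) ht
      (fun x s hs => ?_) fun s s' hs hs' => ?_
    · rw [map_mul, inc, TensorAlgebra.lift_ι_apply, comp_mul,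
        Finset.sum_eq_single (1, k), h1, ih hs, inc]
      · rintro ⟨a, b⟩ hab hne
        have hab := Finset.HasAntidiagonal.mem_antidiagonal.1 hab
        simp only at hab ⊢
        rcases Nat.eq_zero_or_pos a with rfl | ha
        · rw [h0, zero_mul]
        · rw [lift_filt φ h0 hs b, mul_zero]
          rcases lt_or_ge b k with h | h
          · exact h
          · exact absurd (Prod.ext (by simp; omega) (by simp; omega)) hne
      · intro h
        exact absurd (Finset.HasAntidiagonal.mem_antidiagonal.2 (by simp; omega)) h
    · rw [map_add, comp_add, hs, hs']

/-- The continuous extension to the completed tensor algebra of the algebra homomorphism determined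
by a linear map on `H`. -/
noncomputable def extend (f : That g) : That g :=
  ⟨PowerSeries.mk fun n => ∑ k ∈ Finset.range (n + 1),
      comp n (TensorAlgebra.lift ℚ φ (comp k f)), fun n => by
    rw [PowerSeries.coeff_mk]
    exact sum_mem fun k _ => comp_mem _ _⟩

theorem comp_extend (n : ℕ) (f : That g) : comp n (extend φ f) =
    ∑ k ∈ Finset.range (n + 1), comp n (TensorAlgebra.lift ℚ φ (comp k f)) := by
  rw [comp, extend, PowerSeries.coeff_mk]

/-- Words longer than `n` do not reach degree `n`. The freedom in `N` lets all factors of a product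
share one summation range. -/
theorem comp_extend_of_lt (h0 : ∀ x, comp 0 (φ x) = 0) {n N : ℕ} (hN : n < N) (f : That g) :
    comp n (extend φ f) =
      ∑ k ∈ Finset.range N, comp n (TensorAlgebra.lift ℚ φ (comp k f)) := by
  rw [comp_extend]
  refine Finset.sum_subset (Finset.range_mono hN) fun k _ hk => ?_
  exact lift_filt φ h0 (comp_mem k f) n (by simpa using hk)

theorem extend_hat (h0 : ∀ x, comp 0 (φ x) = 0) (x : H g) : extend φ (hat x) = φ x := by
  refine comp_ext fun n => ?_
  rw [comp_extend_of_lt φ h0 (show n < n + 2 by omega), Finset.sum_eq_single 1]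
  · rw [comp_hat, if_pos rfl, inc, TensorAlgebra.lift_ι_apply]
  · intro k _ hk
    rw [comp_hat, if_neg hk, map_zero, comp_zero_right]
  · intro h
    simp at h

theorem extend_mul (h0 : ∀ x, comp 0 (φ x) = 0) (f f' : That g) :
    extend φ (f * f') = extend φ f * extend φ f' := by
  refine comp_ext fun n => ?_
  set L := TensorAlgebra.lift ℚ φ with hL
  have h1 : comp n (extend φ f * extend φ f') =
      ∑ p ∈ Finset.range (n + 1) ×ˢ Finset.range (n + 1),
        comp n (L (comp p.1 f * comp p.2 f')) := by
    rw [comp_mul]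
    have : ∀ a ∈ Finset.HasAntidiagonal.antidiagonal n, comp a.1 (extend φ f) * comp a.2 (extend φ f') =
        ∑ p ∈ Finset.range (n + 1) ×ˢ Finset.range (n + 1),
          comp a.1 (L (comp p.1 f)) * comp a.2 (L (comp p.2 f')) := by
      intro a ha
      have ha := Finset.HasAntidiagonal.mem_antidiagonal.1 ha
      rw [comp_extend_of_lt φ h0 (show a.1 < n + 1 by omega),
        comp_extend_of_lt φ h0 (show a.2 < n + 1 by omega), Finset.sum_mul_sum,
        Finset.sum_product]
    rw [Finset.sum_congr rfl this, Finset.sum_comm]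
    refine Finset.sum_congr rfl fun p _ => ?_
    rw [map_mul, comp_mul]
  rw [h1, comp_extend]
  simp only [comp_mul _ f f', map_sum, comp_sum]
  -- In the square of index pairs only those with sum at most `n` contribute, by the filtration;
  -- grouping them by their sum gives the degrees of the product.
  rw [← Finset.sum_filter_of_ne (s := _ ×ˢ _) (p := fun p : ℕ × ℕ => p.1 + p.2 < n + 1), ←
    Finset.sum_fiberwise_of_maps_to (s := Finset.filter _ _) (g := fun p : ℕ × ℕ => p.1 + p.2)
      (t := Finset.range (n + 1))]
  · refine Finset.sum_congr rfl fun k hk => Finset.sum_congr ?_ fun _ _ => rfl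
    have hk := Finset.mem_range.1 hk
    ext ⟨a, b⟩
    simp only [Finset.HasAntidiagonal.mem_antidiagonal, Finset.mem_filter, Finset.mem_product,
      Finset.mem_range]
    omega
  · intro p hp
    simpa using (Finset.mem_filter.1 hp).2
  · rintro ⟨a, b⟩ _ hne
    by_contra hlt
    refine hne ?_
    rw [map_mul]
    exact InFilt.mul (lift_filt φ h0 (comp_mem a f)) (lift_filt φ h0 (comp_mem b f')) n
      (by simp only at hlt; omega)

theorem extend_add (f f' : That g) : extend φ (f + f') = extend φ f + extend φ f' := by
  refine comp_ext fun n => ?_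
  simp only [comp_add, comp_extend, map_add, Finset.sum_add_distrib]

theorem extend_algebraMap (c : ℚ) :
    extend φ (algebraMap ℚ (That g) c) = algebraMap ℚ (That g) c := by
  refine comp_ext fun n => ?_
  rw [comp_extend, Finset.sum_eq_single 0]
  · rw [Algebra.algebraMap_eq_smul_one, comp_smul, comp_smul, comp_one_right, if_pos rfl,
      map_smul, map_one, comp_smul]
  · intro k _ hk
    rw [Algebra.algebraMap_eq_smul_one, comp_smul, comp_one_right, if_neg hk, smul_zero, map_zero,
      comp_zero_right]
  · intro h
    simp at h

theorem comp_extend_eq (h0 : ∀ x, comp 0 (φ x) = 0) (h1 : ∀ x, comp 1 (φ x) = inc x) (n : ℕ)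
    (f : That g) : comp n (extend φ f) =
      ∑ k ∈ Finset.range n, comp n (TensorAlgebra.lift ℚ φ (comp k f)) + comp n f := by
  rw [comp_extend, Finset.sum_range_succ, comp_lift_self φ h0 h1 (comp_mem n f)]

/-- The components of the solution `f` of `extend φ f = f'`. -/
noncomputable def extendInv (f' : That g) (n : ℕ) : T g :=
  comp n f' - ∑ k : Fin n, comp n (TensorAlgebra.lift ℚ φ (extendInv f' k))
termination_by n

theorem extendInv_mem (f' : That g) (n : ℕ) : extendInv φ f' n ∈ deg g n := by
  rw [extendInv]
  exact sub_mem (comp_mem _ _) (sum_mem fun _ _ => comp_mem _ _)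

/-- Unitriangularity: degree `n` of the image is degree `n` of `f` plus a contribution of the lower
degrees of `f`, so vanishing below `p` passes both ways. -/
theorem inFilt_extend_iff (h0 : ∀ x, comp 0 (φ x) = 0) (h1 : ∀ x, comp 1 (φ x) = inc x) (p : ℕ)
    (f : That g) : InFilt p (extend φ f) ↔ InFilt p f := by
  constructor
  · intro h n
    induction n using Nat.strong_induction_on with
    | _ n ih =>
      intro hn
      have := h n hn
      rwa [comp_extend_eq φ h0 h1, Finset.sum_eq_zero, zero_add] at this
      intro k hk
      have hk := Finset.mem_range.1 hk
      rw [ih k hk (by omega), map_zero, comp_zero_right]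
  · intro h n hn
    rw [comp_extend_eq φ h0 h1, h n hn, add_zero]
    refine Finset.sum_eq_zero fun k hk => ?_
    have hk := Finset.mem_range.1 hk
    rw [h k (by omega), map_zero, comp_zero_right]

/-- The unitriangular system is solved degree by degree: injectivity comes from the filtration, and
the recursion `extendInv` gives a preimage. -/
theorem extend_bijective (h0 : ∀ x, comp 0 (φ x) = 0) (h1 : ∀ x, comp 1 (φ x) = inc x) :
    Function.Bijective (extend φ) := by
  constructor
  · intro f f' h
    refine comp_ext fun n => ?_
    have hs : extend φ (f - f') = 0 := by
      rw [eq_sub_of_add_eq (extend_add φ (f - f') f').symm, sub_add_cancel, h, sub_self]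
    have := (inFilt_extend_iff φ h0 h1 (n + 1) (f - f')).1
      (fun m _ => by rw [hs, comp_zero_right]) n (by omega)
    rwa [comp_sub, sub_eq_zero] at this
  · intro f'
    refine ⟨⟨PowerSeries.mk (extendInv φ f'), fun n => ?_⟩, comp_ext fun n => ?_⟩
    · rw [PowerSeries.coeff_mk]; exact extendInv_mem φ f' n
    · rw [comp_extend_eq φ h0 h1]
      simp only [comp, PowerSeries.coeff_mk]
      rw [extendInv, ← Fin.sum_univ_eq_sum_range]
      exact add_sub_cancel _ _

/-- The element of `IA` determined by a linear map on `H`. -/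
noncomputable def extendIA (h0 : ∀ x, comp 0 (φ x) = 0) (h1 : ∀ x, comp 1 (φ x) = inc x) :
    IA g where
  toAlgEquiv := AlgEquiv.ofBijective
    { toFun := extend φ
      map_one' := by simpa using extend_algebraMap φ 1
      map_zero' := by simpa using extend_algebraMap φ 0
      map_mul' := extend_mul φ h0
      map_add' := extend_add φ
      commutes' := extend_algebraMap φ } (extend_bijective φ h0 h1)
  filtered := inFilt_extend_iff φ h0 h1
  unipotent f hf n hn := by
    change comp n (extend φ f - f) = 0
    rw [comp_sub, comp_extend_eq φ h0 h1, add_sub_cancel_right]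
    refine Finset.sum_eq_zero fun k hk => ?_
    have hk := Finset.mem_range.1 hk
    rw [hf k (by omega), map_zero, comp_zero_right]

theorem extendIA_hat (h0 : ∀ x, comp 0 (φ x) = 0) (h1 : ∀ x, comp 1 (φ x) = inc x) (x : H g) :
    (extendIA φ h0 h1).toAlgEquiv (hat x) = φ x :=
  extend_hat φ h0 x

end Extension

theorem IA.ext' {U V : IA g} (h : ∀ f, U.toAlgEquiv f = V.toAlgEquiv f) : U = V := by
  have : U.toAlgEquiv = V.toAlgEquiv := AlgEquiv.ext h
  cases U; cases V; simpa using this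

/-- The inclusion of `H` as a linear map. -/
noncomputable def hatLin : H g →ₗ[ℚ] That g where
  toFun := hat
  map_add' x y := comp_ext fun n => by
    rw [comp_add, comp_hat, comp_hat, comp_hat]; split_ifs <;> simp
  map_smul' c x := comp_ext fun n => by
    rw [RingHom.id_apply, comp_smul, comp_hat, comp_hat]; split_ifs <;> simp

theorem hatLin_apply (x : H g) : hatLin x = hat x := rfl

theorem comp_zero_hatLin (x : H g) : comp 0 (hatLin x) = 0 := by simp [hatLin_apply, comp_hat]

theorem comp_one_hatLin (x : H g) : comp 1 (hatLin x) = inc x := by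
  simp [hatLin_apply, comp_hat]

/-- Continuity: a filtered automorphism is determined by its values on `H`. -/
theorem IA.ext_hat {U V : IA g} (h : ∀ x, U.toAlgEquiv (hat x) = V.toAlgEquiv (hat x)) :
    U = V := by
  let E : Subalgebra ℚ (That g) := AlgHom.equalizer U.toAlgEquiv.toAlgHom V.toAlgEquiv.toAlgHom
  have hE (f : That g) : f ∈ E ↔ U.toAlgEquiv f = V.toAlgEquiv f := Iff.rfl
  have hmem (t : T g) : TensorAlgebra.lift ℚ hatLin t ∈ E := by
    induction t using TensorAlgebra.induction with
    | algebraMap r => rw [AlgHom.commutes]; exact E.algebraMap_mem r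
    | ι x => rw [TensorAlgebra.lift_ι_apply]; exact h x
    | mul a b ha hb => rw [map_mul]; exact E.mul_mem ha hb
    | add a b ha hb => rw [map_add]; exact E.add_mem ha hb
  refine IA.ext' fun f => comp_ext fun n => ?_
  -- Polynomials, on which the two maps agree, approximate `f` modulo every filtration step, and
  -- filtered maps preserve the order of approximation.
  have key (p : ℕ) : ∃ s ∈ E, InFilt p (f - s) := by
    induction p with
    | zero => exact ⟨0, E.zero_mem, fun n hn => absurd hn (by omega)⟩
    | succ p ih =>
      obtain ⟨s, hs, hf⟩ := ih
      refine ⟨s + TensorAlgebra.lift ℚ hatLin (comp p (f - s)), E.add_mem hs (hmem _),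
        fun m hm => ?_⟩
      rw [← sub_sub, comp_sub]
      rcases Nat.lt_succ_iff_lt_or_eq.1 hm with hm | rfl
      · rw [hf m hm, lift_filt hatLin comp_zero_hatLin (comp_mem p (f - s)) m hm, sub_zero]
      · rw [comp_lift_self hatLin comp_zero_hatLin comp_one_hatLin (comp_mem _ _), sub_self]
  obtain ⟨s, hs, hf⟩ := key (n + 1)
  have h1 := (U.filtered _ _).2 hf n (by omega)
  have h2 := (V.filtered _ _).2 hf n (by omega)
  rw [map_sub, comp_sub, sub_eq_zero] at h1 h2
  rw [h1, h2, (hE s).1 hs]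

/-! ### Magnus expansions -/

namespace MagnusExpansion

variable (θ θ' : MagnusExpansion g)

theorem ext' {θ θ' : MagnusExpansion g} (h : ∀ x, θ.toMonoidHom x = θ'.toMonoidHom x) :
    θ = θ' := by
  have : θ.toMonoidHom = θ'.toMonoidHom := MonoidHom.ext h
  cases θ; cases θ'; simpa using this

/-- The linear map on `H` with `[xᵢ] ↦ θ(xᵢ) - 1` for the generators `xᵢ`. -/
noncomputable def linear : H g →ₗ[ℚ] That g :=
  Fintype.linearCombination ℚ fun i => θ.toMonoidHom (FreeGroup.of i) - 1

theorem comp_zero_linear (x : H g) : comp 0 (θ.linear x) = 0 := by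
  rw [linear, Fintype.linearCombination_apply, comp_sum]
  simp [comp_smul, comp_sub, θ.comp_zero, comp_one_right]

theorem comp_one_linear (x : H g) : comp 1 (θ.linear x) = inc x := by
  rw [linear, Fintype.linearCombination_apply, comp_sum]
  conv_rhs => rw [pi_eq_sum_univ' x]
  simp only [comp_smul, comp_sub, θ.comp_one, comp_one_right, cls_of, map_sum, map_smul]
  refine Finset.sum_congr rfl fun i _ => ?_
  rw [if_neg one_ne_zero, sub_zero]

theorem linear_single (i : Gen g) :
    θ.linear (Pi.single i 1) = θ.toMonoidHom (FreeGroup.of i) - 1 := by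
  rw [linear, Fintype.linearCombination_apply_single, one_smul]

/-- The element of `IA` which takes the standard Magnus expansion to `θ`. -/
noncomputable def toIA : IA g := extendIA θ.linear θ.comp_zero_linear θ.comp_one_linear

theorem toIA_hat (i : Gen g) :
    θ.toIA.toAlgEquiv (hat (Pi.single i 1)) = θ.toMonoidHom (FreeGroup.of i) - 1 := by
  rw [toIA, extendIA_hat, linear_single]

theorem map_eq_of_forall_of (U : IA g)
    (h : ∀ i, U.toAlgEquiv (θ'.toMonoidHom (FreeGroup.of i)) = θ.toMonoidHom (FreeGroup.of i))
    (x : Pi1 g) : U.toAlgEquiv (θ'.toMonoidHom x) = θ.toMonoidHom x := by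
  have : (U.toAlgEquiv.toAlgHom : That g →* That g).comp θ'.toMonoidHom = θ.toMonoidHom := by
    refine MonoidHom.eq_of_eqOn_dense (FreeGroup.closure_range_of (Gen g)) ?_
    rintro _ ⟨i, rfl⟩
    exact h i
  exact DFunLike.congr_fun this x

end MagnusExpansion

/-- The composition of `U` with the inverse of `V`. -/
noncomputable def IA.compInv (U V : IA g) : IA g where
  toAlgEquiv := V.toAlgEquiv.symm.trans U.toAlgEquiv
  filtered p f := by
    rw [AlgEquiv.trans_apply, U.filtered, ← V.filtered, AlgEquiv.apply_symm_apply]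
  unipotent f hf := by
    obtain ⟨f, rfl⟩ := V.toAlgEquiv.surjective f
    rw [V.filtered] at hf
    rw [AlgEquiv.trans_apply, AlgEquiv.symm_apply_apply, ← sub_sub_sub_cancel_right _ _ f]
    exact (U.unipotent f hf).sub (V.unipotent f hf)

/-- The composition of `U` with `V`. -/
noncomputable def IA.after (U V : IA g) : IA g where
  toAlgEquiv := V.toAlgEquiv.trans U.toAlgEquiv
  filtered p f := by
    rw [AlgEquiv.trans_apply, U.filtered, V.filtered]
  unipotent f hf := by
    rw [AlgEquiv.trans_apply, ← sub_add_sub_cancel _ (V.toAlgEquiv f) f]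
    exact (U.unipotent _ ((V.filtered 1 f).2 hf)).add (V.unipotent f hf)

theorem IA.ext_single {U V : IA g} (h : ∀ i, U.toAlgEquiv (hat (Pi.single i 1)) =
    V.toAlgEquiv (hat (Pi.single i 1))) : U = V := by
  have key : U.toAlgEquiv.toLinearMap ∘ₗ hatLin = V.toAlgEquiv.toLinearMap ∘ₗ hatLin :=
    (Pi.basisFun ℚ (Gen g)).ext fun i => by
      rw [Pi.basisFun_apply]
      exact h i
  exact IA.ext_hat fun x => LinearMap.congr_fun key x

/-- Any two Magnus expansions are related by a unique element of `IA`. -/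
theorem existsUnique_isFatgraphJohnson (θ θ' : MagnusExpansion g) :
    ∃! U : IA g, IsFatgraphJohnson θ θ' U := by
  -- The map passes through the standard expansion, which sends each generator `xᵢ` to `1 + [xᵢ]`.
  refine ⟨θ.toIA.compInv θ'.toIA, θ.map_eq_of_forall_of θ' _ fun i => ?_, fun V hV => ?_⟩
  · have h := θ'.toIA_hat i
    rw [eq_sub_iff_add_eq] at h
    rw [IA.compInv, AlgEquiv.trans_apply, ← h, map_add, AlgEquiv.symm_apply_apply, map_one,
      map_add, map_one, MagnusExpansion.toIA_hat, sub_add_cancel]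
  · have hU (i : Gen g) : hat (Pi.single i 1) =
        θ'.toIA.toAlgEquiv.symm (θ'.toMonoidHom (FreeGroup.of i) - 1) := by
      rw [← θ'.toIA_hat, AlgEquiv.symm_apply_apply]
    -- Both sides send `[xᵢ]` to `θ(xᵢ) - 1`, and elements of `IA` are determined on the basis of
    -- `H`.
    have key : (V.after θ'.toIA) = θ.toIA := by
      refine IA.ext_single fun i => ?_
      rw [IA.after, AlgEquiv.trans_apply, θ'.toIA_hat, map_sub, map_one, hV, θ.toIA_hat]
    refine IA.ext' fun f => ?_
    rw [← key]
    simp [IA.compInv, IA.after]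

/-! ### Low degree components of Johnson maps -/

theorem inFilt_hat (x : H g) : InFilt 1 (hat x) := fun n hn => by
  rw [comp_hat, if_neg (by omega)]

theorem IA.inFilt_apply (U : IA g) {p : ℕ} {f : That g} (hf : InFilt p f) :
    InFilt p (U.toAlgEquiv f) := (U.filtered p f).2 hf

/-- If `U - 1` raises degrees on `H` by `d`, then everywhere. -/
theorem IA.inFilt_apply_sub (U : IA g) {d : ℕ}
    (hU : ∀ x, InFilt (1 + d) (U.toAlgEquiv (hat x) - hat x)) {p : ℕ} {f : That g}
    (hf : InFilt p f) : InFilt (p + d) (U.toAlgEquiv f - f) := by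
  have homog (k : ℕ) (t : T g) (ht : t ∈ deg g k) :
      InFilt (k + d) (U.toAlgEquiv (TensorAlgebra.lift ℚ hatLin t)
        - TensorAlgebra.lift ℚ hatLin t) := by
    induction k generalizing t with
    | zero =>
      obtain ⟨c, rfl⟩ := deg_zero_eq ht
      rw [AlgHom.commutes, AlgEquiv.commutes, sub_self]
      exact fun n _ => comp_zero_right n
    | succ k ih =>
      refine deg_succ_induction (C := fun t => InFilt (k + 1 + d)
        (U.toAlgEquiv (TensorAlgebra.lift ℚ hatLin t) - TensorAlgebra.lift ℚ hatLin t)) ht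
        (fun x s hs => ?_) fun s s' hs hs' => ?_
      · rw [map_mul, inc, TensorAlgebra.lift_ι_apply, map_mul, hatLin_apply]
        set y := TensorAlgebra.lift ℚ hatLin s with hy
        -- A Leibniz splitting: each summand contains one difference, which supplies the gain of `d`
        -- degrees.
        have e : U.toAlgEquiv (hat x) * U.toAlgEquiv y - hat x * y =
            (U.toAlgEquiv (hat x) - hat x) * U.toAlgEquiv y
              + hat x * (U.toAlgEquiv y - y) := by
          rw [sub_mul, mul_sub, sub_add_sub_cancel]
        rw [e]
        refine InFilt.add ?_ ?_
        · exact ((hU x).mul (U.inFilt_apply (lift_filt hatLin comp_zero_hatLin hs))).mono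
            (by omega)
        · exact ((inFilt_hat x).mul (ih s hs)).mono (by omega)
      · rw [map_add, map_add, add_sub_add_comm]
        exact hs.add hs'
  -- Only the `d` homogeneous parts of degrees `p, …, p + d - 1` need the gain; the remainder
  -- already lies in filtration `p + d` and stays there.
  have key (j : ℕ) : ∃ s, InFilt (p + j) (f - s) ∧ InFilt (p + d) (U.toAlgEquiv s - s) := by
    induction j with
    | zero =>
      refine ⟨0, by simpa using hf, ?_⟩
      rw [map_zero, sub_zero]
      exact fun n _ => comp_zero_right n
    | succ j ih =>
      obtain ⟨s, hs, hd⟩ := ih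
      refine ⟨s + TensorAlgebra.lift ℚ hatLin (comp (p + j) (f - s)), fun m hm => ?_, ?_⟩
      · rw [← sub_sub, comp_sub]
        rcases Nat.lt_succ_iff_lt_or_eq.1 (show m < (p + j) + 1 from hm) with hm | rfl
        · rw [hs m hm, lift_filt hatLin comp_zero_hatLin (comp_mem (p + j) (f - s)) m hm,
            sub_zero]
        · rw [comp_lift_self hatLin comp_zero_hatLin comp_one_hatLin (comp_mem _ _), sub_self]
      · rw [map_add, add_sub_add_comm]
        exact hd.add ((homog _ _ (comp_mem _ _)).mono (by omega))
  obtain ⟨s, hs, hd⟩ := key d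
  rw [show U.toAlgEquiv f - f = (U.toAlgEquiv (f - s) - (f - s)) + (U.toAlgEquiv s - s) by
    rw [map_sub]; abel]
  exact ((U.inFilt_apply hs).sub hs).add hd

/-- The difference `f - x` starts in degree two, so `U` alters it only from degree `d + 2` on. In
degree `d + 1` the change of `f` is thus that of its linear part. -/
theorem IA.comp_apply (U : IA g) {d : ℕ} (hd : 1 ≤ d)
    (hU : ∀ x, InFilt (1 + d) (U.toAlgEquiv (hat x) - hat x)) {f : That g} (hf : InFilt 1 f)
    {x : H g} (hx : comp 1 f = inc x) :
    comp (d + 1) (U.toAlgEquiv f) = comp (d + 1) f + U.hom d x := by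
  have h2 : InFilt 2 (f - hat x) := by
    intro n hn
    rw [comp_sub, comp_hat]
    rcases (show n = 0 ∨ n = 1 by omega) with rfl | rfl
    · rw [hf 0 (by omega), if_neg (by omega), sub_zero]
    · rw [hx, if_pos rfl, sub_self]
  have := U.inFilt_apply_sub hU h2 (d + 1) (by omega)
  rw [map_sub, comp_sub, comp_sub, comp_sub, comp_hat, if_neg (by omega), sub_zero,
    sub_eq_zero, sub_eq_iff_eq_add] at this
  exact this

theorem IA.inFilt_two (U : IA g) (x : H g) : InFilt (1 + 1) (U.toAlgEquiv (hat x) - hat x) :=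
  U.unipotent _ (inFilt_hat x)

theorem IA.inFilt_three (U : IA g) (hU : U.hom 1 = 0) (x : H g) :
    InFilt (1 + 2) (U.toAlgEquiv (hat x) - hat x) := by
  intro n hn
  rcases (show n < 2 ∨ n = 2 by omega) with h | rfl
  · exact U.inFilt_two x n h
  · rw [comp_sub, comp_hat, if_neg (by omega), sub_zero]
    exact LinearMap.congr_fun hU x

/-- `IA.comp_apply` for `f = θ'(x) - 1`, whose linear part is the class of `x`. It reads the first
possibly nonzero Johnson component from the two expansions alone. -/
theorem IsFatgraphJohnson.comp_apply {θ θ' : MagnusExpansion g} {U : IA g}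
    (h : IsFatgraphJohnson θ θ' U) {d : ℕ} (hd : 1 ≤ d)
    (hU : ∀ x, InFilt (1 + d) (U.toAlgEquiv (hat x) - hat x)) (x : Pi1 g) :
    U.hom d (cls x) = comp (d + 1) (θ.toMonoidHom x) - comp (d + 1) (θ'.toMonoidHom x) := by
  have h1 : InFilt 1 (θ'.toMonoidHom x - 1) := fun n hn => by
    rw [Nat.lt_one_iff.1 hn, comp_sub, θ'.comp_zero, comp_one_right, if_pos rfl, sub_self]
  have := U.comp_apply hd hU h1 (x := cls x)
    (by rw [comp_sub, θ'.comp_one, comp_one_right, if_neg one_ne_zero, sub_zero])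
  rw [map_sub, map_one, h x, comp_sub, comp_sub, comp_one_right, if_neg (by omega), sub_zero,
    sub_zero] at this
  exact eq_sub_of_add_eq' this.symm

/-- The first Johnson component is the difference of the second components. -/
theorem IsFatgraphJohnson.hom_one {θ θ' : MagnusExpansion g} {U : IA g}
    (h : IsFatgraphJohnson θ θ' U) (x : Pi1 g) :
    U.hom 1 (cls x) = comp 2 (θ.toMonoidHom x) - comp 2 (θ'.toMonoidHom x) :=
  h.comp_apply le_rfl U.inFilt_two x

/-- If the first Johnson component vanishes, the second one is the difference of the third
components. -/
theorem IsFatgraphJohnson.hom_two {θ θ' : MagnusExpansion g} {U : IA g}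
    (h : IsFatgraphJohnson θ θ' U) (hU : U.hom 1 = 0) (x : Pi1 g) :
    U.hom 2 (cls x) = comp 3 (θ.toMonoidHom x) - comp 3 (θ'.toMonoidHom x) :=
  h.comp_apply one_le_two (U.inFilt_three hU) x

/-! ### The boundary twist -/

namespace MagnusExpansion

variable (θ : MagnusExpansion g)

theorem comp_two_mul' (x y : Pi1 g) : comp 2 (θ.toMonoidHom (x * y)) =
    comp 2 (θ.toMonoidHom x) + inc (cls x) * inc (cls y) + comp 2 (θ.toMonoidHom y) := by
  rw [map_mul, comp_two_mul, θ.comp_zero, θ.comp_zero, θ.comp_one, θ.comp_one, one_mul, mul_one]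
  abel

theorem comp_two_inv (x : Pi1 g) : comp 2 (θ.toMonoidHom x⁻¹) =
    inc (cls x) * inc (cls x) - comp 2 (θ.toMonoidHom x) := by
  have := θ.comp_two_mul' x x⁻¹
  rw [mul_inv_cancel, map_one, comp_one_right, if_neg two_ne_zero, cls_inv, map_neg, mul_neg]
    at this
  rw [eq_sub_iff_add_eq, ← sub_eq_zero, this]
  abel

theorem comp_two_comm (x y : Pi1 g) :
    comp 2 (θ.toMonoidHom (comm x y)) = ⁅inc (cls x), inc (cls y)⁆ := by
  simp only [comm, comp_two_mul', comp_two_inv, cls_mul, cls_inv, map_add, map_neg, Ring.lie_def]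
  noncomm_ring

theorem comp_two_prod {l : List (Pi1 g)} (h : ∀ x ∈ l, cls x = 0) :
    comp 2 (θ.toMonoidHom l.prod) = (l.map fun x => comp 2 (θ.toMonoidHom x)).sum := by
  induction l with
  | nil => simp [comp_one_right]
  | cons a l ih =>
    rw [List.prod_cons, comp_two_mul', h a (by simp), ih fun x hx => h x (by simp [hx])]
    simp

/-- The quadratic part of a commutator is the bracket of the classes, and quadratic parts of
null-homologous elements add. The value therefore does not depend on `θ`. -/
theorem comp_two_boundary : comp 2 (θ.toMonoidHom (boundary g)) = toT (omega g) := by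
  have hl : (List.ofFn fun i : Fin g => comm (uGen i) (vGen i)).take g =
      List.ofFn fun i : Fin g => comm (uGen i) (vGen i) := List.take_of_length_le (by simp)
  rw [boundary, partialBoundary, hl, comp_two_prod, toT_omega, List.map_ofFn, List.sum_ofFn]
  · refine Finset.sum_congr rfl fun i _ => ?_
    rw [Function.comp_apply, comp_two_comm, uGen, vGen, cls_of, cls_of, uH, vH]
  · intro x hx
    obtain ⟨i, rfl⟩ := List.mem_ofFn.1 hx
    exact cls_comm _ _

/-- With `θ(b) = 1 + b₂ + ⋯`, the first effect of conjugation pairs `b₂` with the linear part of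
`θ(x)`, in degree three. -/
theorem comp_three_conj (b x : Pi1 g) (hb : cls b = 0) :
    comp 2 (θ.toMonoidHom (b⁻¹ * x * b)) = comp 2 (θ.toMonoidHom x) ∧
    comp 3 (θ.toMonoidHom (b⁻¹ * x * b)) = comp 3 (θ.toMonoidHom x) +
      ⁅inc (cls x), comp 2 (θ.toMonoidHom b)⁆ := by
  have hb' : cls b⁻¹ = 0 := by rw [cls_inv, hb, neg_zero]
  have h3 : comp 3 (θ.toMonoidHom b⁻¹) = -comp 3 (θ.toMonoidHom b) := by
    have : comp 3 (θ.toMonoidHom (b⁻¹ * b)) = 0 := by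
      rw [inv_mul_cancel, map_one, comp_one_right, if_neg three_ne_zero]
    rw [map_mul, comp_three_mul, θ.comp_zero, θ.comp_zero, θ.comp_one, θ.comp_one, hb, hb',
      map_zero, zero_mul, mul_zero, one_mul, mul_one, add_zero, add_zero] at this
    rw [eq_neg_iff_add_eq_zero, add_comm, this]
  constructor
  · simp only [comp_two_mul', comp_two_inv, hb, hb', cls_mul, map_zero, zero_mul, mul_zero]
    abel
  · simp only [map_mul, comp_three_mul, comp_two_mul, comp_one_mul, comp_zero_mul, θ.comp_zero,
      θ.comp_one, comp_two_inv, h3, hb, hb', map_zero, zero_mul, mul_zero, one_mul, mul_one,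
      Ring.lie_def]
    noncomm_ring

theorem comp_two_boundaryTwist (x : Pi1 g) :
    comp 2 (θ.toMonoidHom (boundaryTwist g x)) = comp 2 (θ.toMonoidHom x) := by
  rw [boundaryTwist_apply, (θ.comp_three_conj _ x cls_boundary).1]

theorem comp_three_boundaryTwist (x : Pi1 g) :
    comp 3 (θ.toMonoidHom (boundaryTwist g x)) = comp 3 (θ.toMonoidHom x) +
      poincare (tensorSq (omega g)) (cls x) := by
  rw [boundaryTwist_apply, (θ.comp_three_conj _ x cls_boundary).2, comp_two_boundary,
    poincare_tensorSq_omega]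

/-- The Magnus expansion `θ ∘ φ`, for `φ` acting trivially on homology. -/
noncomputable def compAut (φ : MulAut (Pi1 g)) (h : ∀ x, cls (φ x) = cls x) : MagnusExpansion g where
  toMonoidHom := θ.toMonoidHom.comp φ.toMonoidHom
  comp_zero x := θ.comp_zero _
  comp_one x := by
    rw [← h x]
    exact θ.comp_one _

end MagnusExpansion

theorem boundaryTwist_mem : boundaryTwist g ∈ mappingClassGroup g := by
  rw [mappingClassGroup, MulAction.mem_stabilizer_iff, MulAut.smul_def, boundaryTwist_apply]
  group

/-- `T_∂(x) x⁻¹` is the commutator of `∂⁻¹`, which lies in `Γ₁`, with `x`. -/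
theorem isTorelli_boundaryTwist : IsTorelli 2 (boundaryTwist g) := by
  refine ⟨boundaryTwist_mem, fun x => ?_⟩
  have hb : boundary g ∈ (⊤ : Subgroup (Pi1 g)).lowerCentralSeries 1 := by
    refine Subgroup.list_prod_mem _ fun y hy => ?_
    obtain ⟨i, rfl⟩ := List.mem_ofFn.1 (List.mem_of_mem_take hy)
    exact Subgroup.commutator_mem_commutator (Subgroup.mem_top _) (Subgroup.mem_top _)
  have := Subgroup.commutator_mem_commutator (inv_mem hb) (Subgroup.mem_top x)
  rw [commutatorElement_def, inv_inv] at this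
  rw [boundaryTwist_apply]
  exact this

/-- Write `θ(T_∂(x) x⁻¹) - 1 = (θ(T_∂(x)) - θ(x)) θ(x⁻¹)`. The first factor starts in degree three
and the second has constant term one, so the leading term is the degree three variation of `θ`. -/
theorem isJohnson_boundaryTwist : IsJohnson 2 (boundaryTwist g) (tensorSq (omega g)) := by
  refine ⟨isTorelli_boundaryTwist, fun θ x => ?_⟩
  have hd : InFilt 3 (θ.toMonoidHom (boundaryTwist g x) - θ.toMonoidHom x) := by
    intro n hn
    rw [comp_sub]
    rcases (show n = 0 ∨ n = 1 ∨ n = 2 by omega) with rfl | rfl | rfl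
    · rw [θ.comp_zero, θ.comp_zero, sub_self]
    · rw [θ.comp_one, θ.comp_one, cls_boundaryTwist, sub_self]
    · rw [θ.comp_two_boundaryTwist, sub_self]
  have e : θ.toMonoidHom (boundaryTwist g x * x⁻¹) - 1 =
      (θ.toMonoidHom (boundaryTwist g x) - θ.toMonoidHom x) * θ.toMonoidHom x⁻¹ := by
    rw [sub_mul, ← map_mul, ← map_mul, mul_inv_cancel, map_one]
  have h3 : InFilt (3 + 0) (θ.toMonoidHom (boundaryTwist g x * x⁻¹) - 1) := by
    rw [e]
    exact hd.mul fun n hn => absurd hn (by omega)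
  refine ⟨h3, ?_⟩
  have : comp 3 (θ.toMonoidHom (boundaryTwist g x * x⁻¹)) =
      comp 3 (θ.toMonoidHom (boundaryTwist g x * x⁻¹) - 1) := by
    rw [comp_sub, comp_one_right, if_neg three_ne_zero, sub_zero]
  rw [this, e, comp_three_mul, hd 0 (by omega), hd 1 (by omega), hd 2 (by omega), θ.comp_zero,
    comp_sub, θ.comp_three_boundaryTwist]
  simp

/-- `θ ∘ T_∂` is again a Magnus expansion, so total Johnson maps are transition maps between two
expansions and the general results on those apply. -/
theorem isTotalJohnson_iff (θ : MagnusExpansion g) (U : IA g) :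
    IsTotalJohnson θ (boundaryTwist g) U ↔
      IsFatgraphJohnson (θ.compAut (boundaryTwist g) cls_boundaryTwist) θ U := Iff.rfl

theorem IsTotalJohnson.hom_one_boundaryTwist {θ : MagnusExpansion g} {U : IA g}
    (h : IsTotalJohnson θ (boundaryTwist g) U) : U.hom 1 = 0 := by
  refine linearMap_ext_cls fun x => ?_
  rw [((isTotalJohnson_iff θ U).1 h).hom_one x, LinearMap.zero_apply, sub_eq_zero]
  exact θ.comp_two_boundaryTwist x

theorem IsTotalJohnson.tau_two_boundaryTwist {θ : MagnusExpansion g} {U : IA g}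
    (h : IsTotalJohnson θ (boundaryTwist g) U) : U.tau 2 = tensorSq (omega g) := by
  rw [IA.tau, LinearEquiv.symm_apply_eq]
  refine linearMap_ext_cls fun x => ?_
  rw [((isTotalJohnson_iff θ U).1 h).hom_two h.hom_one_boundaryTwist x, sub_eq_iff_eq_add']
  exact θ.comp_three_boundaryTwist x

/-! ### Exponential and logarithm of noncommutative series -/

section ExpLog

open PowerSeries

theorem coeff_pow_eq_zero {R : Type*} [Ring R] {f : PowerSeries R} (hf : coeff 0 f = 0) {n k : ℕ} (h : n < k) :
    coeff n (f ^ k) = 0 := by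
  induction k generalizing n with
  | zero => omega
  | succ k ih =>
    rw [pow_succ, coeff_mul]
    refine Finset.sum_eq_zero fun p hp => ?_
    have hp := Finset.HasAntidiagonal.mem_antidiagonal.1 hp
    rcases Nat.eq_zero_or_pos p.2 with h0 | h0
    · rw [h0, hf, mul_zero]
    · rw [ih (by omega), zero_mul]

section Agree

variable {R : Type*} [Ring R]

/-- The series `f` and `f'` agree in degrees below `n`, and differ by `d` in degree `n`. -/
def AgreeTo (n : ℕ) (f f' : PowerSeries R) (d : R) : Prop :=
  (∀ m < n, coeff m f = coeff m f') ∧ coeff n f = coeff n f' + d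

theorem AgreeTo.refl (n : ℕ) (f : PowerSeries R) : AgreeTo n f f 0 :=
  ⟨fun _ _ => rfl, (add_zero _).symm⟩

theorem coeff_mul_eq_of_forall_lt_left {f f' : PowerSeries R} {n : ℕ}
    (h : ∀ m < n, coeff m f = 0) : coeff n (f * f') = coeff n f * coeff 0 f' := by
  rw [coeff_mul, Finset.sum_eq_single (n, 0)]
  · rintro ⟨a, b⟩ hab hne
    have hab := Finset.HasAntidiagonal.mem_antidiagonal.1 hab
    simp only at hab
    rw [h a, zero_mul]
    rcases Nat.eq_zero_or_pos b with rfl | hb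
    · exact absurd (Prod.ext (x := (a, 0)) (y := (n, 0)) hab rfl) hne
    · omega
  · intro hn
    exact absurd (Finset.HasAntidiagonal.mem_antidiagonal.2 (by simp)) hn

theorem coeff_mul_eq_of_forall_lt_right {f f' : PowerSeries R} {n : ℕ}
    (h : ∀ m < n, coeff m f' = 0) : coeff n (f * f') = coeff 0 f * coeff n f' := by
  rw [coeff_mul, Finset.sum_eq_single (0, n)]
  · rintro ⟨a, b⟩ hab hne
    have hab := Finset.HasAntidiagonal.mem_antidiagonal.1 hab
    simp only at hab
    rw [h b, mul_zero]
    rcases Nat.eq_zero_or_pos a with rfl | hb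
    · exact absurd (Prod.ext (x := (0, b)) (y := (0, n)) rfl ((zero_add b).symm.trans hab)) hne
    · omega
  · intro hn
    exact absurd (Finset.HasAntidiagonal.mem_antidiagonal.2 (by simp)) hn

theorem AgreeTo.mul {n : ℕ} (hn : 1 ≤ n) {a a' b b' : PowerSeries R} {d e : R}
    (ha : AgreeTo n a a' d) (hb : AgreeTo n b b' e) :
    AgreeTo n (a * b) (a' * b') (d * coeff 0 b' + coeff 0 a' * e) := by
  -- In each error term one factor starts in degree `n`, so the other contributes only its constant
  -- term; `1 ≤ n` makes the constant terms of `b` and `b'` agree.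
  have e1 : a * b = a' * b' + ((a - a') * b + a' * (b - b')) := by noncomm_ring
  have ha' : ∀ m < n, coeff m (a - a') = 0 := fun m hm => by rw [map_sub, ha.1 m hm, sub_self]
  have hb' : ∀ m < n, coeff m (b - b') = 0 := fun m hm => by rw [map_sub, hb.1 m hm, sub_self]
  rw [e1]
  refine ⟨fun m hm => ?_, ?_⟩
  · rw [map_add, map_add, coeff_mul_eq_of_forall_lt_left fun k hk => ha' k (by omega),
      coeff_mul_eq_of_forall_lt_right fun k hk => hb' k (by omega), ha' m hm, hb' m hm,
      zero_mul, mul_zero, add_zero, add_zero]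
  · rw [map_add, map_add, coeff_mul_eq_of_forall_lt_left ha',
      coeff_mul_eq_of_forall_lt_right hb', map_sub, map_sub, ha.2, hb.2, hb.1 0 (by omega),
      add_sub_cancel_left, add_sub_cancel_left]

theorem AgreeTo.pow {n : ℕ} (hn : 1 ≤ n) {a a' : PowerSeries R} {d : R}
    (ha : AgreeTo n a a' d) (h0 : coeff 0 a' = 0) (k : ℕ) :
    AgreeTo n (a ^ k) (a' ^ k) (if k = 1 then d else 0) := by
  induction k with
  | zero => simpa using AgreeTo.refl n (1 : PowerSeries R)
  | succ k ih =>
    rcases Nat.eq_zero_or_pos k with rfl | hk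
    · simpa using ha
    · have := ih.mul hn ha
      rw [h0, coeff_pow_eq_zero h0 hk, mul_zero, zero_mul, add_zero] at this
      rw [pow_succ, pow_succ, if_neg (by omega)]
      exact this

end Agree

/-! ### Substitution of a noncommutative series into rational power series -/

variable {R : Type*} [Ring R] [Algebra ℚ R]

/-- The substitution of a series `f` without constant term in a rational series. -/
noncomputable def substQ (f : PowerSeries R) (p : PowerSeries ℚ) : PowerSeries R :=
  mk fun n => ∑ k ∈ Finset.range (n + 1), coeff k p • coeff n (f ^ k)

theorem coeff_substQ (f : PowerSeries R) (p : PowerSeries ℚ) (n : ℕ) :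
    coeff n (substQ f p) = ∑ k ∈ Finset.range (n + 1), coeff k p • coeff n (f ^ k) :=
  coeff_mk _ _

theorem coeff_substQ_of_lt {f : PowerSeries R} (hf : coeff 0 f = 0) (p : PowerSeries ℚ)
    {n N : ℕ} (h : n < N) :
    coeff n (substQ f p) = ∑ k ∈ Finset.range N, coeff k p • coeff n (f ^ k) := by
  rw [coeff_substQ]
  refine Finset.sum_subset (Finset.range_mono h) fun k _ hk => ?_
  rw [coeff_pow_eq_zero hf (by simpa using hk), smul_zero]

/-- Powers of one series commute with each other, so substitution is multiplicative even over a
noncommutative ring. Identities between `exp` and `log` in one variable thereby reduce to rational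
series. -/
theorem substQ_mul {f : PowerSeries R} (hf : coeff 0 f = 0) (p q : PowerSeries ℚ) :
    substQ f (p * q) = substQ f p * substQ f q := by
  ext n
  have h1 : coeff n (substQ f p * substQ f q) =
      ∑ a ∈ Finset.range (n + 1) ×ˢ Finset.range (n + 1),
        (coeff a.1 p * coeff a.2 q) • coeff n (f ^ (a.1 + a.2)) := by
    rw [coeff_mul]
    have : ∀ a ∈ Finset.HasAntidiagonal.antidiagonal n,
        coeff a.1 (substQ f p) * coeff a.2 (substQ f q) =
        ∑ b ∈ Finset.range (n + 1) ×ˢ Finset.range (n + 1),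
          (coeff b.1 p * coeff b.2 q) • (coeff a.1 (f ^ b.1) * coeff a.2 (f ^ b.2)) := by
      intro a ha
      have ha := Finset.HasAntidiagonal.mem_antidiagonal.1 ha
      rw [coeff_substQ_of_lt hf p (show a.1 < n + 1 by omega),
        coeff_substQ_of_lt hf q (show a.2 < n + 1 by omega), Finset.sum_mul_sum,
        Finset.sum_product]
      simp only [smul_mul_smul_comm]
    rw [Finset.sum_congr rfl this, Finset.sum_comm]
    refine Finset.sum_congr rfl fun b _ => ?_
    rw [← Finset.smul_sum, pow_add, coeff_mul]
  rw [h1, coeff_substQ]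
  simp only [coeff_mul _ p q, Finset.sum_smul]
  rw [← Finset.sum_filter_of_ne (s := _ ×ˢ _) (p := fun p : ℕ × ℕ => p.1 + p.2 < n + 1), ←
    Finset.sum_fiberwise_of_maps_to (s := Finset.filter _ _) (g := fun p : ℕ × ℕ => p.1 + p.2)
      (t := Finset.range (n + 1))]
  · refine Finset.sum_congr rfl fun k hk => Finset.sum_congr ?_ fun b hb => ?_
    · have hk := Finset.mem_range.1 hk
      ext ⟨a, b⟩
      simp only [Finset.HasAntidiagonal.mem_antidiagonal, Finset.mem_filter, Finset.mem_product,
        Finset.mem_range]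
      omega
    · rw [(Finset.mem_filter.1 hb).2]
  · intro p hp
    simpa using (Finset.mem_filter.1 hp).2
  · rintro ⟨a, b⟩ _ hne
    by_contra hlt
    refine hne ?_
    rw [coeff_pow_eq_zero hf (by simp only at hlt ⊢; omega), smul_zero]

theorem substQ_add (f : PowerSeries R) (p q : PowerSeries ℚ) :
    substQ f (p + q) = substQ f p + substQ f q := by
  ext n
  simp only [coeff_substQ, map_add, add_smul, Finset.sum_add_distrib]

theorem substQ_smul (f : PowerSeries R) (c : ℚ) (p : PowerSeries ℚ) :
    substQ f (c • p) = c • substQ f p := by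
  ext n
  simp only [coeff_substQ, coeff_smul, smul_eq_mul, mul_smul, ← Finset.smul_sum]

theorem substQ_one (f : PowerSeries R) : substQ f 1 = 1 := by
  ext n
  rw [coeff_substQ, Finset.sum_eq_single 0]
  · simp
  · intro k _ hk
    rw [coeff_one, if_neg hk, zero_smul]
  · intro h
    simp at h

theorem substQ_pow {f : PowerSeries R} (hf : coeff 0 f = 0) (p : PowerSeries ℚ) (k : ℕ) :
    substQ f (p ^ k) = substQ f p ^ k := by
  induction k with
  | zero => rw [pow_zero, pow_zero, substQ_one]
  | succ k ih => rw [pow_succ, pow_succ, substQ_mul hf, ih]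

theorem substQ_sum {ι : Type*} (f : PowerSeries R) (s : Finset ι) (p : ι → PowerSeries ℚ) :
    substQ f (∑ i ∈ s, p i) = ∑ i ∈ s, substQ f (p i) := by
  classical
  induction s using Finset.induction_on with
  | empty => ext n; simp [coeff_substQ]
  | insert a s ha ih => rw [Finset.sum_insert ha, Finset.sum_insert ha, substQ_add, ih]

theorem coeff_substQ_X_of_le {f : PowerSeries R} {p : PowerSeries ℚ} {n : ℕ}
    (hp : ∀ k ≤ n, coeff k p = if k = 1 then 1 else 0) (hn : 1 ≤ n) :
    coeff n (substQ f p) = coeff n f := by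
  rw [coeff_substQ, Finset.sum_eq_single 1]
  · rw [hp 1 hn, if_pos rfl, one_smul, pow_one]
  · intro k hk hk1
    have := Finset.mem_range.1 hk
    rw [hp k (by omega), if_neg hk1, zero_smul]
  · intro h
    simp at h; omega

/-- The truncated logarithm of the exponential series. -/
theorem coeff_log_exp {n k : ℕ} (hk : k ≤ n) :
    coeff k (∑ j ∈ Finset.Icc 1 n, ((-1 : ℚ) ^ (j + 1) / j) • (exp ℚ - 1) ^ j) =
      if k = 1 then 1 else 0 := by
  set F := ∑ j ∈ Finset.Icc 1 n, ((-1 : ℚ) ^ (j + 1) / j) • (exp ℚ - 1) ^ j with hF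
  -- As `exp' = exp = 1 - (1 - exp)`, the derivative is a telescoping geometric sum; the remainder
  -- `(1 - exp)ⁿ` vanishes below degree `n`.
  have hd : derivative ℚ F = 1 - (1 - exp ℚ) ^ n := by
    rw [hF]
    clear hF F hk
    induction n with
    | zero => simp
    | succ n ih =>
      have hn : ((n + 1 : ℕ) : ℚ) ≠ 0 := Nat.cast_ne_zero.2 n.succ_ne_zero
      have h1 : (1 - exp ℚ) ^ n = ((-1 : ℚ) ^ n) • (exp ℚ - 1) ^ n := by
        rw [← neg_sub, neg_pow, smul_eq_C_mul, map_pow, map_neg, map_one]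
      rw [Finset.sum_Icc_succ_top (by omega), map_add, ih, Derivation.map_smul, derivative_pow,
        map_sub, derivative_exp, derivative_one, sub_zero, Nat.add_sub_cancel, pow_succ (1 - _), h1,
        ← map_natCast (C (R := ℚ)), mul_assoc, ← smul_eq_C_mul, smul_smul, div_mul_cancel₀ _ hn]
      simp only [smul_eq_C_mul, map_pow, map_neg, map_one]
      ring
  have h0 : coeff 0 F = 0 := by
    rw [hF, map_sum]
    refine Finset.sum_eq_zero fun j hj => ?_
    have := (Finset.mem_Icc.1 hj).1
    rw [coeff_smul, coeff_pow_eq_zero (by simp) (by omega), smul_zero]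
  rcases k with _ | k
  · simpa using h0
  · have := congrArg (coeff k) hd
    rw [coeff_derivative, map_sub, coeff_pow_eq_zero (by simp) (by omega), sub_zero, coeff_one]
      at this
    rcases Nat.eq_zero_or_pos k with rfl | hk0
    · simpa using this
    · rw [if_neg (by omega)] at this ⊢
      exact (mul_eq_zero.1 this).resolve_right (by positivity)

theorem AgreeTo.substQ {n : ℕ} (hn : 1 ≤ n) {a a' : PowerSeries R} {d : R}
    (ha : AgreeTo n a a' d) (h0 : coeff 0 a' = 0) (p : PowerSeries ℚ) :
    AgreeTo n (substQ a p) (substQ a' p) (coeff 1 p • d) := by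
  refine ⟨fun m hm => ?_, ?_⟩
  · rw [coeff_substQ, coeff_substQ]
    exact Finset.sum_congr rfl fun k _ => by rw [(ha.pow hn h0 k).1 m hm]
  · rw [coeff_substQ, coeff_substQ, Finset.sum_congr rfl fun k _ => by
      rw [(ha.pow hn h0 k).2, smul_add], Finset.sum_add_distrib, Finset.sum_eq_single_of_mem 1
      (f := fun k => coeff k p • if k = 1 then d else 0) (by simp; omega)]
    · rw [if_pos rfl]
    · intro k _ hk
      rw [if_neg hk, smul_zero]

end ExpLog

/-! ### Exponential and logarithm over the tensor algebra -/

section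

open PowerSeries

theorem expS_eq (f : PowerSeries (T g)) : expS f = substQ f (exp ℚ) := by
  ext n
  rw [expS, coeff_mk, coeff_substQ, map_sum]
  refine Finset.sum_congr rfl fun k _ => ?_
  rw [LinearMap.map_smul_of_tower, coeff_exp]
  simp

theorem logS_eq (f : PowerSeries (T g)) : logS f = substQ (f - 1) (log ℚ) := by
  ext n
  rw [logS, coeff_mk, coeff_substQ, map_sum]
  refine (Finset.sum_congr rfl fun k hk => ?_).trans (Finset.sum_subset (fun k hk => ?_)
    fun k hk hk' => ?_)
  · have := (Finset.mem_Icc.1 hk).1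
    rw [LinearMap.map_smul_of_tower, coeff_log, if_neg (by omega)]
    rfl
  · have := (Finset.mem_Icc.1 hk).2
    exact Finset.mem_range.2 (by omega)
  · have h0 : k = 0 := by
      rw [Finset.mem_Icc] at hk'
      have := Finset.mem_range.1 hk
      omega
    rw [h0, coeff_log, if_pos rfl, zero_smul]

/-- In each degree this is a substitution of `f` into the truncated logarithm of the rational
exponential, which is `X` as far as that degree by `coeff_log_exp`. -/
theorem logS_expS {f : PowerSeries (T g)} (hf : coeff 0 f = 0) : logS (expS f) = f := by
  have h1 : expS f - 1 = substQ f (exp ℚ - 1) := by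
    have := substQ_add f (exp ℚ - 1) 1
    rw [sub_add_cancel, substQ_one, ← expS_eq] at this
    rw [this, add_sub_cancel_right]
  ext n
  rw [logS, coeff_mk, h1]
  simp only [← substQ_pow hf, ← substQ_smul, ← substQ_sum]
  rcases Nat.eq_zero_or_pos n with rfl | hn
  · simp [coeff_substQ, hf]
  · exact coeff_substQ_X_of_le (fun k hk => coeff_log_exp hk) hn

theorem coeff_zero_expS (f : PowerSeries (T g)) : coeff 0 (expS f) = 1 := by
  simp [expS]

/-- Substitution of `f` in the rational identity `exp(X) exp(-X) = 1`. -/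
theorem expS_mul_expS_neg {f : PowerSeries (T g)} (hf : coeff 0 f = 0) :
    expS f * expS (-f) = 1 := by
  have : expS (-f) = substQ f (evalNegHom (exp ℚ)) := by
    ext n
    rw [expS_eq, coeff_substQ, coeff_substQ]
    refine Finset.sum_congr rfl fun k _ => ?_
    rw [← neg_one_smul ℚ f, smul_pow, LinearMap.map_smul_of_tower, evalNegHom, coeff_rescale,
      smul_smul, mul_comm]
  rw [this, expS_eq, ← substQ_mul hf, exp_mul_exp_neg_eq_one, substQ_one]

theorem expS_neg_mul_expS {f : PowerSeries (T g)} (hf : coeff 0 f = 0) :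
    expS (-f) * expS f = 1 := by
  have := expS_mul_expS_neg (f := -f) (by rw [map_neg, hf, neg_zero])
  rwa [neg_neg] at this

theorem AgreeTo.exp_map {n : ℕ} (hn : 1 ≤ n) {a a' : PowerSeries (T g)} {d : T g}
    (ha : AgreeTo n a a' d) (h0 : coeff 0 a' = 0) : AgreeTo n (expS a) (expS a') d := by
  have := ha.substQ hn h0 (exp ℚ)
  rwa [coeff_exp, Nat.factorial_one, Nat.cast_one, div_one, map_one, one_smul, ← expS_eq,
    ← expS_eq] at this

theorem AgreeTo.log_map {n : ℕ} (hn : 1 ≤ n) {a a' : PowerSeries (T g)} {d : T g}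
    (ha : AgreeTo n a a' d) (h0 : coeff 0 a' = 1) : AgreeTo n (logS a) (logS a') d := by
  have h1 : AgreeTo n (a - 1) (a' - 1) d :=
    ⟨fun m hm => by rw [map_sub, map_sub, ha.1 m hm], by rw [map_sub, map_sub, ha.2]; abel⟩
  have := h1.substQ hn (by rw [map_sub, h0]; simp) (log ℚ)
  rwa [coeff_one_log, one_smul, ← logS_eq, ← logS_eq] at this

/-- If `exp a exp b exp c = 1 + ε + ⋯`, with `ε` of degree `n`, then `ε = h(a, b) + a + b + c` in
degree `n`. -/
theorem coeff_hausdorff {n : ℕ} (hn : 1 ≤ n) {a b c : PowerSeries (T g)} {ε : T g}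
    (hc : coeff 0 c = 0) (h : AgreeTo n (expS a * expS b * expS c) 1 ε) :
    coeff n (hausdorff a b) = ε - coeff n a - coeff n b - coeff n c := by
  -- Cancelling `exp c` shows that `exp a exp b` agrees with `exp(-c)` up to `ε` in degree `n`; the
  -- logarithm carries this to `-c + ε`.
  have h1 := h.mul hn (AgreeTo.refl n (expS (-c)))
  rw [mul_assoc, expS_mul_expS_neg hc, mul_one, one_mul, coeff_zero_expS, mul_one, mul_zero,
    add_zero] at h1
  have h2 := (h1.log_map hn (coeff_zero_expS _)).2
  rw [logS_expS (by rw [map_neg, hc, neg_zero]), map_neg] at h2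
  rw [hausdorff, map_sub, map_sub, h2]
  abel

/-- The leading term of `exp a exp b exp c - 1` is cyclically invariant. -/
theorem AgreeTo.rotate {n : ℕ} (hn : 1 ≤ n) {a b c : PowerSeries (T g)} {ε : T g}
    (ha : coeff 0 a = 0) (h : AgreeTo n (expS a * expS b * expS c) 1 ε) :
    AgreeTo n (expS b * expS c * expS a) 1 ε := by
  -- Conjugation by a series with constant term one does not change a leading term.
  have h1 := ((AgreeTo.refl n (expS (-a))).mul hn h).mul hn (AgreeTo.refl n (expS a))
  rw [mul_one, expS_neg_mul_expS ha, mul_assoc (expS a), ← mul_assoc,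
    expS_neg_mul_expS ha, one_mul] at h1
  simpa [coeff_zero_expS] using h1

/-! ### The Hausdorff series in low degrees -/

theorem coeff_pow_two_two {R : Type*} [Ring R] {f : PowerSeries R} (hf : coeff 0 f = 0) :
    coeff 2 (f ^ 2) = coeff 1 f * coeff 1 f := by
  rw [pow_two, coeff_mul, Finset.Nat.sum_antidiagonal_eq_sum_range_succ_mk]
  simp [Finset.sum_range_succ, hf]

theorem coeff_three_pow_two {R : Type*} [Ring R] {f : PowerSeries R} (hf : coeff 0 f = 0) :
    coeff 3 (f ^ 2) = coeff 1 f * coeff 2 f + coeff 2 f * coeff 1 f := by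
  rw [pow_two, coeff_mul, Finset.Nat.sum_antidiagonal_eq_sum_range_succ_mk]
  simp [Finset.sum_range_succ, hf]

theorem coeff_three_pow_three {R : Type*} [Ring R] {f : PowerSeries R} (hf : coeff 0 f = 0) :
    coeff 3 (f ^ 3) = coeff 1 f * coeff 1 f * coeff 1 f := by
  rw [pow_succ, coeff_mul, Finset.Nat.sum_antidiagonal_eq_sum_range_succ_mk]
  have h0 : coeff 0 (f ^ 2) = 0 := coeff_pow_eq_zero hf (by omega)
  have h1 : coeff 1 (f ^ 2) = 0 := coeff_pow_eq_zero hf (by omega)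
  simp only [Finset.sum_range_succ, Finset.sum_range_zero, h0, h1, hf, coeff_pow_two_two hf,
    zero_mul, mul_zero, zero_add, add_zero, Nat.reduceSub, tsub_self]

theorem coeff_one_substQ {R : Type*} [Ring R] [Algebra ℚ R] (f : PowerSeries R)
    (p : PowerSeries ℚ) : coeff 1 (substQ f p) = coeff 1 p • coeff 1 f := by
  simp [coeff_substQ, Finset.sum_range_succ, coeff_one]

theorem coeff_two_substQ {R : Type*} [Ring R] [Algebra ℚ R] {f : PowerSeries R}
    (hf : coeff 0 f = 0) (p : PowerSeries ℚ) : coeff 2 (substQ f p) =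
      coeff 1 p • coeff 2 f + coeff 2 p • (coeff 1 f * coeff 1 f) := by
  simp [coeff_substQ, Finset.sum_range_succ, coeff_one, coeff_pow_two_two hf]

theorem coeff_three_substQ {R : Type*} [Ring R] [Algebra ℚ R] {f : PowerSeries R}
    (hf : coeff 0 f = 0) (p : PowerSeries ℚ) : coeff 3 (substQ f p) =
      coeff 1 p • coeff 3 f + coeff 2 p • (coeff 1 f * coeff 2 f + coeff 2 f * coeff 1 f)
        + coeff 3 p • (coeff 1 f * coeff 1 f * coeff 1 f) := by
  simp [coeff_substQ, Finset.sum_range_succ, coeff_one, coeff_three_pow_two hf,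
    coeff_three_pow_three hf]

theorem coeff_one_expS (f : PowerSeries (T g)) : coeff 1 (expS f) = coeff 1 f := by
  rw [expS_eq, coeff_one_substQ, coeff_exp]; simp

theorem coeff_two_expS {f : PowerSeries (T g)} (hf : coeff 0 f = 0) :
    coeff 2 (expS f) = coeff 2 f + (1 / 2 : ℚ) • (coeff 1 f * coeff 1 f) := by
  rw [expS_eq, coeff_two_substQ hf, coeff_exp, coeff_exp]; simp

theorem coeff_three_expS {f : PowerSeries (T g)} (hf : coeff 0 f = 0) :
    coeff 3 (expS f) = coeff 3 f + (1 / 2 : ℚ) • (coeff 1 f * coeff 2 f + coeff 2 f * coeff 1 f)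
      + (1 / 6 : ℚ) • (coeff 1 f * coeff 1 f * coeff 1 f) := by
  rw [expS_eq, coeff_three_substQ hf, coeff_exp, coeff_exp, coeff_exp]
  simp [Nat.factorial]

theorem coeff_expS_mul_expS {x y : PowerSeries (T g)} (hx : coeff 0 x = 0) (hy : coeff 0 y = 0) :
    coeff 0 (expS x * expS y - 1) = 0 ∧
    coeff 1 (expS x * expS y - 1) = coeff 1 x + coeff 1 y ∧
    coeff 2 (expS x * expS y - 1) = coeff 2 x + coeff 2 y + coeff 1 x * coeff 1 y +
      (1 / 2 : ℚ) • (coeff 1 x * coeff 1 x) + (1 / 2 : ℚ) • (coeff 1 y * coeff 1 y) ∧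
    coeff 3 (expS x * expS y - 1) = coeff 3 (expS x) + coeff 3 (expS y)
      + coeff 1 x * coeff 2 (expS y) + coeff 2 (expS x) * coeff 1 y := by
  refine ⟨?_, ?_, ?_, ?_⟩
  · rw [map_sub, coeff_mul_eq_of_forall_lt_left fun m hm => absurd hm (by omega),
      coeff_zero_expS, coeff_zero_expS, coeff_one, if_pos rfl, mul_one, sub_self]
  all_goals
    rw [map_sub, coeff_one, if_neg (by omega), sub_zero, coeff_mul,
      Finset.Nat.sum_antidiagonal_eq_sum_range_succ_mk]
    simp [Finset.sum_range_succ, coeff_zero_expS, coeff_one_expS, coeff_two_expS hx,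
      coeff_two_expS hy, -one_div]
    try abel

theorem coeff_two_hausdorff {x y : PowerSeries (T g)} (hx : coeff 0 x = 0) (hy : coeff 0 y = 0) :
    coeff 2 (hausdorff x y) = (1 / 2 : ℚ) • ⁅coeff 1 x, coeff 1 y⁆ := by
  obtain ⟨h0, h1, h2, -⟩ := coeff_expS_mul_expS hx hy
  rw [hausdorff, map_sub, map_sub, logS_eq, coeff_two_substQ h0, h1, h2, coeff_log, coeff_log]
  simp only [mul_add, add_mul, Ring.lie_def]
  norm_num
  module

theorem coeff_three_hausdorff {x y : PowerSeries (T g)} (hx : coeff 0 x = 0)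
    (hy : coeff 0 y = 0) : coeff 3 (hausdorff x y) =
      (1 / 2 : ℚ) • (⁅coeff 1 x, coeff 2 y⁆ - ⁅coeff 1 y, coeff 2 x⁆) +
      (1 / 12 : ℚ) • (⁅coeff 1 x, ⁅coeff 1 x, coeff 1 y⁆⁆ - ⁅coeff 1 y, ⁅coeff 1 x, coeff 1 y⁆⁆) := by
  obtain ⟨h0, h1, h2, h3⟩ := coeff_expS_mul_expS hx hy
  rw [hausdorff, map_sub, map_sub, logS_eq, coeff_three_substQ h0, h1, h2, h3, coeff_log,
    coeff_log, coeff_log, coeff_two_expS hx, coeff_two_expS hy, coeff_three_expS hx,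
    coeff_three_expS hy]
  simp only [mul_add, add_mul, mul_sub, sub_mul, Ring.lie_def, mul_smul_comm, smul_mul_assoc,
    mul_assoc]
  norm_num
  module

/-! ### Homogeneity -/

theorem substQ_mem {f : PowerSeries (T g)} (hf : f ∈ That g) (p : PowerSeries ℚ) :
    substQ f p ∈ That g := fun n => by
  rw [coeff_substQ]
  exact sum_mem fun k _ => Submodule.smul_mem _ _ ((That g).pow_mem hf k n)

theorem expS_mem {f : PowerSeries (T g)} (hf : f ∈ That g) : expS f ∈ That g := by
  rw [expS_eq]; exact substQ_mem hf _

theorem hausdorff_mem {f f' : PowerSeries (T g)} (hf : f ∈ That g) (hf' : f' ∈ That g) :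
    hausdorff f f' ∈ That g := by
  rw [hausdorff, logS_eq]
  exact (That g).sub_mem ((That g).sub_mem (substQ_mem ((That g).sub_mem ((That g).mul_mem
    (expS_mem hf) (expS_mem hf')) (That g).one_mem) _) hf) hf'

end

namespace Fatgraph

variable {D D' : Type} {G : Fatgraph g D}

/-! ### Positions in the boundary cycle -/

namespace IsMarkedTrivalent

variable (hG : G.IsMarkedTrivalent)

include hG

theorem next_injective : Function.Injective G.next := fun a b h => by
  rw [← hG.next_next_next a, h, hG.next_next_next]

theorem rev_injective : Function.Injective G.rev := fun a b h => by
  rw [← hG.rev_rev a, h, hG.rev_rev]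

theorem bdry_injective : Function.Injective G.bdry :=
  hG.rev_injective.comp hG.next_injective

theorem next_rev_tail : G.next (G.rev G.tail) = G.rev G.tail := (hG.univalent _).2 rfl

theorem bdry_rev_tail : G.bdry (G.rev G.tail) = G.tail := by
  rw [bdry, hG.next_rev_tail, hG.rev_rev]

theorem iterate_pos (e : D) : G.bdry^[G.pos e] G.tail = e :=
  Nat.sInf_mem (hG.one_boundary e)

/-- Positions are minimal step counts. Since the boundary step is injective, they can drop only at
the step that returns to the tail. -/
theorem pos_bdry {y : D} (hy : y ≠ G.rev G.tail) : G.pos (G.bdry y) = G.pos y + 1 := by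
  refine le_antisymm (Nat.sInf_le ?_) ?_
  · rw [Set.mem_ofPred_eq, Function.iterate_succ_apply', hG.iterate_pos]
  · have h := hG.iterate_pos (G.bdry y)
    cases hk : G.pos (G.bdry y) with
    | zero =>
      rw [hk, Function.iterate_zero_apply, ← hG.bdry_rev_tail] at h
      exact absurd (hG.bdry_injective h).symm hy
    | succ k =>
      rw [hk, Function.iterate_succ_apply'] at h
      exact Nat.succ_le_succ (Nat.sInf_le (hG.bdry_injective h))

theorem cls_mark_rev (e : D) : cls (G.mark (G.rev e)) = -cls (G.mark e) := by
  have := congrArg cls (hG.orientation e)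
  rw [cls_mul, cls_one] at this
  exact eq_neg_of_add_eq_zero_left this

end IsMarkedTrivalent

theorem pos_tail : G.pos G.tail = 0 := Nat.sInf_eq_zero.2 (Or.inl rfl)

/-! ### The logarithms of the fatgraph Magnus expansion -/

variable (G)

/-- The series `∑ ℓₙ(x)`. -/
noncomputable def logSeries (x : D) : PowerSeries (T g) := PowerSeries.mk fun n => G.ell n x

/-- The part of degree less than `n` of the series `∑ ℓₙ(x)`. -/
noncomputable def lowSeries (n : ℕ) (x : D) : PowerSeries (T g) :=
  PowerSeries.mk fun m => if m < n then G.ell m x else 0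

/-- The sum in degree `n` of the Hausdorff terms along the boundary cycle from the tail to `y`. -/
noncomputable def partialSum (n : ℕ) (y : D) : T g :=
  ∑ j ∈ Finset.range (G.pos y), PowerSeries.coeff n
    (hausdorff (G.lowSeries n (G.bdry^[j] G.tail)) (-G.lowSeries n (G.bdry^[j + 1] G.tail)))

/-- The Hausdorff term in degree `n` of the corner which follows `y`. -/
noncomputable def corner (n : ℕ) (y : D) : T g :=
  PowerSeries.coeff n (hausdorff (G.lowSeries n y) (G.lowSeries n (G.next y)))

theorem ell_zero (x : D) : G.ell 0 x = 0 := by rw [ell, if_pos rfl]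

theorem ell_one (x : D) : G.ell 1 x = inc (cls (G.mark x)) := by
  rw [ell, if_neg one_ne_zero, if_pos rfl]

variable {G}

theorem partialSum_tail (n : ℕ) : G.partialSum n G.tail = 0 := by
  rw [partialSum, pos_tail, Finset.sum_range_zero]

theorem coeff_zero_lowSeries (n : ℕ) (x : D) : PowerSeries.coeff 0 (G.lowSeries n x) = 0 := by
  rw [lowSeries, PowerSeries.coeff_mk, ell_zero, ite_self]

theorem coeff_zero_logSeries (x : D) : PowerSeries.coeff 0 (G.logSeries x) = 0 := by
  rw [logSeries, PowerSeries.coeff_mk, ell_zero]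

theorem coeff_lowSeries_self (n : ℕ) (x : D) : PowerSeries.coeff n (G.lowSeries n x) = 0 := by
  rw [lowSeries, PowerSeries.coeff_mk, if_neg (lt_irrefl n)]

theorem coeff_lowSeries_of_lt {m n : ℕ} (h : m < n) (x : D) :
    PowerSeries.coeff m (G.lowSeries n x) = G.ell m x := by
  rw [lowSeries, PowerSeries.coeff_mk, if_pos h]

theorem agreeTo_logSeries (n : ℕ) (x : D) :
    AgreeTo n (G.logSeries x) (G.lowSeries n x) (G.ell n x) := by
  refine ⟨fun m hm => ?_, ?_⟩
  · rw [coeff_lowSeries_of_lt hm, logSeries, PowerSeries.coeff_mk]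
  · rw [coeff_lowSeries_self, logSeries, PowerSeries.coeff_mk, zero_add]

theorem ell_eq_ite {n : ℕ} (hn : 2 ≤ n) (x : D) : G.ell n x =
    if G.pos x < G.pos (G.rev x) then
      -((1 / 3 : ℚ) • ∑ j ∈ Finset.Ico (G.pos x) (G.pos (G.rev x)), PowerSeries.coeff n
        (hausdorff (G.lowSeries n (G.bdry^[j] G.tail)) (-G.lowSeries n (G.bdry^[j + 1] G.tail))))
    else
      - -((1 / 3 : ℚ) • ∑ j ∈ Finset.Ico (G.pos (G.rev x)) (G.pos (G.rev (G.rev x))),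
        PowerSeries.coeff n (hausdorff (G.lowSeries n (G.bdry^[j] G.tail))
          (-G.lowSeries n (G.bdry^[j + 1] G.tail)))) := by
  rw [ell, if_neg (by omega), if_neg (by omega)]
  simp only [lowSeries, dite_eq_ite]

/-- The Hausdorff terms at a trivalent vertex. -/
theorem corner_eq {n : ℕ} (hn : 1 ≤ n) {e : D} {ε : T g}
    (h : AgreeTo n (expS (G.lowSeries n e) * expS (G.lowSeries n (G.next e)) *
      expS (G.lowSeries n (G.next (G.next e)))) 1 ε) : G.corner n e = ε := by
  -- The truncated series have no part of degree `n`, so only `ε` survives.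
  rw [corner, coeff_hausdorff hn (coeff_zero_lowSeries _ _) h]
  simp [coeff_lowSeries_self]

namespace IsMarkedTrivalent

variable (hG : G.IsMarkedTrivalent)

include hG

/-- The sum over the path from `x` to `x̄` is a difference of sums started at the tail. In this form
both cases of the definition coincide. -/
theorem ell_eq {n : ℕ} (hn : 2 ≤ n) (x : D) :
    G.ell n x = (1 / 3 : ℚ) • (G.partialSum n x - G.partialSum n (G.rev x)) := by
  rw [ell_eq_ite hn]
  split_ifs with h
  · rw [Finset.sum_Ico_eq_sub _ h.le, ← smul_neg, neg_sub]
    rfl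
  · rw [hG.rev_rev, Finset.sum_Ico_eq_sub _ (not_lt.1 h), neg_neg]
    rfl

theorem ell_rev (n : ℕ) (x : D) : G.ell n (G.rev x) = -G.ell n x := by
  rcases (show n = 0 ∨ n = 1 ∨ 2 ≤ n by omega) with rfl | rfl | hn
  · rw [ell_zero, ell_zero, neg_zero]
  · rw [ell_one, ell_one, hG.cls_mark_rev, map_neg]
  · rw [hG.ell_eq hn, hG.ell_eq hn, hG.rev_rev, ← smul_neg, neg_sub]

theorem lowSeries_rev (n : ℕ) (x : D) : G.lowSeries n (G.rev x) = -G.lowSeries n x := by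
  ext m
  rw [map_neg, lowSeries, lowSeries, PowerSeries.coeff_mk, PowerSeries.coeff_mk, hG.ell_rev]
  split_ifs <;> simp

theorem logSeries_rev (x : D) : G.logSeries (G.rev x) = -G.logSeries x := by
  ext m
  rw [map_neg, logSeries, logSeries, PowerSeries.coeff_mk, PowerSeries.coeff_mk, hG.ell_rev]

/-- The boundary step leads from `y` to the reverse of the next incoming edge. The minus sign in the
Hausdorff term undoes this reversal, leaving the term of two consecutive incoming edges. -/
theorem partialSum_bdry (n : ℕ) {y : D} (hy : y ≠ G.rev G.tail) :
    G.partialSum n (G.bdry y) = G.partialSum n y + G.corner n y := by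
  rw [partialSum, hG.pos_bdry hy, Finset.sum_range_succ, Function.iterate_succ_apply',
    hG.iterate_pos, bdry, hG.lowSeries_rev, neg_neg]
  rfl

theorem ell_mem (n : ℕ) (x : D) : G.ell n x ∈ deg g n := by
  induction n using Nat.strong_induction_on generalizing x with
  | _ n ih =>
    rcases (show n = 0 ∨ n = 1 ∨ 2 ≤ n by omega) with rfl | rfl | hn
    · rw [ell_zero]; exact zero_mem _
    · rw [ell_one, deg, pow_one]; exact ⟨_, rfl⟩
    · have hlow (y : D) : G.lowSeries n y ∈ That g := fun m => by
        rw [lowSeries, PowerSeries.coeff_mk]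
        split_ifs with h
        · exact ih m h y
        · exact zero_mem _
      have hps (y : D) : G.partialSum n y ∈ deg g n :=
        sum_mem fun j _ => hausdorff_mem (hlow _) ((That g).neg_mem (hlow _)) n
      rw [hG.ell_eq hn]
      exact Submodule.smul_mem _ _ (sub_mem (hps _) (hps _))

theorem next_ne_rev_tail {y : D} (hy : G.next y ≠ y) : y ≠ G.rev G.tail :=
  fun h => hy ((hG.univalent y).2 h)

theorem next_next_ne {y : D} (hy : G.next y ≠ y) : G.next (G.next y) ≠ G.next y :=
  fun h => hy (hG.next_injective h)

/-- The sum of `ℓₙ` over the edges at a trivalent vertex. -/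
theorem sum_ell {n : ℕ} (hn : 2 ≤ n) {e : D} (he : G.next e ≠ e) :
    G.ell n e + G.ell n (G.next e) + G.ell n (G.next (G.next e)) =
      -((1 / 3 : ℚ) • (G.corner n e + G.corner n (G.next e) + G.corner n (G.next (G.next e)))) := by
  -- The reverses of the three incoming edges are the boundary successors of the same three edges,
  -- so all partial sums cancel and only the corners remain.
  have h1 := hG.partialSum_bdry n (hG.next_ne_rev_tail he)
  have h2 := hG.partialSum_bdry n (hG.next_ne_rev_tail (hG.next_next_ne he))
  have h3 := hG.partialSum_bdry n (hG.next_ne_rev_tail (hG.next_next_ne (hG.next_next_ne he)))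
  rw [bdry] at h1 h2 h3
  rw [hG.next_next_next] at h3
  rw [hG.ell_eq hn, hG.ell_eq hn, hG.ell_eq hn, h1, h2, h3]
  module

/-- By induction on the degree, the truncation below degree `n` gives `1 + ε` up to degree `n`.
Rotating the product shows that all three corners equal `ε`, so the sum of the `ℓₙ` is `-ε`; this is
the role of the factor one third. Degree one is the vertex relation in homology. -/
theorem expS_vertex {e : D} (he : G.next e ≠ e) :
    expS (G.logSeries e) * expS (G.logSeries (G.next e)) *
      expS (G.logSeries (G.next (G.next e))) = 1 := by
  ext n
  induction n using Nat.strong_induction_on with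
  | _ n ih =>
    rcases Nat.eq_zero_or_pos n with rfl | hn
    · simp [PowerSeries.coeff_mul, expS]
    have hx (x : D) := (agreeTo_logSeries (G := G) n x).exp_map hn (coeff_zero_lowSeries n x)
    have h := ((hx e).mul hn (hx (G.next e))).mul hn (hx (G.next (G.next e)))
    have hc : PowerSeries.coeff 0 (expS (G.lowSeries n e) * expS (G.lowSeries n (G.next e)))
        = 1 := by
      rw [coeff_mul_eq_of_forall_lt_left fun m hm => absurd hm (by omega), coeff_zero_expS,
        coeff_zero_expS, mul_one]
    rw [hc, coeff_zero_expS, coeff_zero_expS, coeff_zero_expS, mul_one, mul_one, one_mul,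
      one_mul] at h
    rw [h.2, PowerSeries.coeff_one, if_neg (by omega)]
    rcases Nat.lt_or_ge n 2 with h2 | h2
    · obtain rfl : n = 1 := by omega
      have h0 (x : D) : G.lowSeries 1 x = 0 := by
        ext m
        rw [lowSeries, PowerSeries.coeff_mk, map_zero]
        split_ifs with hm
        · rw [Nat.lt_one_iff.1 hm, ell_zero]
        · rfl
      have hv := congrArg cls (hG.vertex e he)
      rw [cls_mul, cls_mul, cls_one] at hv
      have h1 : expS (0 : PowerSeries (T g)) = 1 := by
        ext n
        rw [expS_eq, coeff_substQ, Finset.sum_eq_single 0]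
        · simp
        · intro k _ hk
          rw [zero_pow hk, map_zero, smul_zero]
        · simp
      rw [h0, h0, h0, h1, ell_one, ell_one, ell_one, ← map_add, ← map_add, hv, map_zero, add_zero,
        mul_one, mul_one, PowerSeries.coeff_one, if_neg one_ne_zero]
    · set ε := PowerSeries.coeff n (expS (G.lowSeries n e) * expS (G.lowSeries n (G.next e)) *
        expS (G.lowSeries n (G.next (G.next e)))) with hε
      have hA : AgreeTo n (expS (G.lowSeries n e) * expS (G.lowSeries n (G.next e)) *
          expS (G.lowSeries n (G.next (G.next e)))) 1 ε := by
        refine ⟨fun m hm => ?_, ?_⟩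
        · rw [← h.1 m hm, ih m hm]
        · rw [← hε, PowerSeries.coeff_one, if_neg (by omega), zero_add]
      have hA2 := hA.rotate hn (coeff_zero_lowSeries _ _)
      have hA3 := hA2.rotate hn (coeff_zero_lowSeries _ _)
      rw [hG.sum_ell h2 he, corner_eq hn hA,
        corner_eq hn (by rw [hG.next_next_next]; exact hA2),
        corner_eq hn (by rw [hG.next_next_next]; exact hA3)]
      module

end IsMarkedTrivalent

/-! ### Existence and uniqueness of the fatgraph Magnus expansion -/

/-- The marking identifies the fundamental group with the group generated by the oriented edges,
subject to the orientation and the vertex relations. -/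
def IsPresentation (G : Fatgraph g D) : Prop :=
  ∀ (K : Type) [Group K] (f : D → K), (∀ e, f (G.rev e) * f e = 1) →
    (∀ e, G.next e ≠ e → f e * f (G.next e) * f (G.next (G.next e)) = 1) →
    ∃ Φ : Pi1 g →* K, ∀ e, Φ (G.mark e) = f e

/-- The exponentials satisfy the orientation and vertex relations, so the presentation yields a
homomorphism. The markings generate, which gives uniqueness and reduces the normalization in degrees
zero and one to edges. -/
theorem IsMarkedTrivalent.existsUnique_isFatgraphMagnus (hG : G.IsMarkedTrivalent)
    (hP : G.IsPresentation) : ∃! θ : MagnusExpansion g, G.IsFatgraphMagnus θ := by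
  have hmem (x : D) : G.logSeries x ∈ That g := fun n => by
    rw [logSeries, PowerSeries.coeff_mk]; exact hG.ell_mem n x
  let f (x : D) : (That g)ˣ :=
    { val := ⟨expS (G.logSeries x), expS_mem (hmem x)⟩
      inv := ⟨expS (-G.logSeries x), expS_mem ((That g).neg_mem (hmem x))⟩
      val_inv := Subtype.ext (expS_mul_expS_neg (coeff_zero_logSeries x))
      inv_val := Subtype.ext (expS_neg_mul_expS (coeff_zero_logSeries x)) }
  have hf (x : D) : ((f x : That g) : PowerSeries (T g)) = expS (G.logSeries x) := rfl
  obtain ⟨Φ, hΦ⟩ := hP (That g)ˣ f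
    (fun e => by
      refine Units.ext (Subtype.ext ?_)
      change expS (G.logSeries (G.rev e)) * expS (G.logSeries e) = 1
      rw [hG.logSeries_rev, expS_neg_mul_expS (coeff_zero_logSeries e)])
    (fun e he => Units.ext (Subtype.ext (hG.expS_vertex he)))
  have key (x : Pi1 g) : comp 0 (Φ x : That g) = 1 ∧ comp 1 (Φ x : That g) = inc (cls x) := by
    have hx : x ∈ Subgroup.closure (Set.range G.mark) := hG.full_rank ▸ Subgroup.mem_top x
    induction hx using Subgroup.closure_induction with
    | mem x hx =>
      obtain ⟨e, rfl⟩ := hx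
      rw [hΦ, comp, comp, hf]
      exact ⟨coeff_zero_expS _, by
        rw [coeff_one_expS, logSeries, PowerSeries.coeff_mk, ell_one]⟩
    | one => simp [comp_one_right, cls_one]
    | mul a b _ _ ha hb =>
      rw [map_mul, Units.val_mul, comp_zero_mul, comp_one_mul, ha.1, ha.2, hb.1, hb.2, cls_mul,
        map_add]
      simp [add_comm]
    | inv a _ ha =>
      have h0 : comp 0 ((Φ a : That g) * (Φ a⁻¹ : That g)) = 1 := by
        rw [← Units.val_mul, ← map_mul, mul_inv_cancel]; simp [comp_one_right]
      have h1 : comp 1 ((Φ a : That g) * (Φ a⁻¹ : That g)) = 0 := by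
        rw [← Units.val_mul, ← map_mul, mul_inv_cancel]; simp [comp_one_right]
      rw [comp_zero_mul, ha.1, one_mul] at h0
      rw [comp_one_mul, ha.1, ha.2, h0, one_mul, mul_one] at h1
      exact ⟨h0, by rw [cls_inv, map_neg]; exact eq_neg_of_add_eq_zero_left h1⟩
  refine ⟨⟨(Units.coeHom (That g)).comp Φ, fun x => (key x).1, fun x => (key x).2⟩, fun x => ?_,
    fun θ hθ => MagnusExpansion.ext' fun x => ?_⟩
  · change ((Φ (G.mark x) : That g) : PowerSeries (T g)) = _
    rw [hΦ]
    rfl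
  · refine DFunLike.congr_fun (MonoidHom.eq_of_eqOn_dense hG.full_rank ?_) x
    rintro _ ⟨e, rfl⟩
    refine Subtype.ext ((hθ e).trans ?_)
    change _ = ((Φ (G.mark e) : That g) : PowerSeries (T g))
    rw [hΦ]
    rfl

/-! ### Invariance -/

/-- The recursion uses the marking only in degree one, through homology classes. Hence `ℓ` does not
notice mapping classes that act trivially on `H`. -/
theorem ell_eq_of_equiv {G' : Fatgraph g D'} (f : D ≃ D') (hn : ∀ e, f (G.next e) = G'.next (f e))
    (hr : ∀ e, f (G.rev e) = G'.rev (f e)) (ht : f G.tail = G'.tail)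
    (hm : ∀ e, cls (G.mark e) = cls (G'.mark (f e))) (n : ℕ) (x : D) :
    G'.ell n (f x) = G.ell n x := by
  have hb (j : ℕ) : G'.bdry^[j] G'.tail = f (G.bdry^[j] G.tail) := by
    induction j with
    | zero => exact ht.symm
    | succ j ih =>
      rw [Function.iterate_succ_apply', Function.iterate_succ_apply', ih, bdry, bdry, ← hn, ← hr]
  have hp (x : D) : G'.pos (f x) = G.pos x := by
    simp only [pos, hb, f.injective.eq_iff]
  induction n using Nat.strong_induction_on generalizing x with
  | _ n ih =>
    rcases (show n = 0 ∨ n = 1 ∨ 2 ≤ n by omega) with rfl | rfl | h2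
    · rw [ell_zero, ell_zero]
    · rw [ell_one, ell_one, hm]
    · have hl (y : D) : G'.lowSeries n (f y) = G.lowSeries n y := by
        ext m
        rw [lowSeries, lowSeries, PowerSeries.coeff_mk, PowerSeries.coeff_mk]
        split_ifs with h
        · rw [ih m h]
        · rfl
      rw [ell_eq_ite h2, ell_eq_ite h2]
      simp only [← hr, hp, hb, hl]

end Fatgraph

namespace Fatgraph

variable {D D' : Type} {G : Fatgraph g D}

/-! ### Sliding the tail -/

/-- The neighbourhood of the edge `e` to the right of the tail. -/
structure IsSlide (G : Fatgraph g D) (e x k c d : D) : Prop where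
  next_tail : G.next G.tail = e
  next_e : G.next e = x
  next_x : G.next x = G.tail
  rev_e : G.rev e = k
  rev_k : G.rev k = e
  next_k : G.next k = c
  next_c : G.next c = d
  next_d : G.next d = k
  nodup : [G.rev G.tail, G.tail, e, x, k, c, d].Nodup

namespace IsMarkedTrivalent

variable (hG : G.IsMarkedTrivalent)

include hG

theorem forall_of_bdry {C : D → Prop} (h0 : C G.tail) (hs : ∀ y, C y → C (G.bdry y)) (y : D) :
    C y := by
  obtain ⟨n, rfl⟩ := hG.one_boundary y
  induction n with
  | zero => exact h0
  | succ n ih => rw [Function.iterate_succ_apply']; exact hs _ ih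

theorem next_tail_ne : G.next G.tail ≠ G.tail := fun h =>
  hG.rev_ne G.tail ((hG.univalent _).1 h).symm

/-- If the edge `e` to the right of the tail were a loop with `ē` next to it, the boundary cycle
would close up as `t → ē → t̄ → t` without meeting `e`. -/
theorem canMove : G.CanMove G.rightEdge := by
  have h1 := hG.next_tail_ne
  have h2 : G.rightEdge ≠ G.rev G.tail := fun h => hG.rev_ne G.tail
    (hG.next_injective (hG.next_rev_tail.trans h.symm))
  refine ⟨h1, h2, hG.rev_ne _, fun h => ?_, fun h => ?_⟩
  · have key := hG.forall_of_bdry (C := fun y => y = G.tail ∨ y = G.rev G.rightEdge ∨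
      y = G.rev G.tail) (Or.inl rfl) (fun y hy => by
        rcases hy with rfl | rfl | rfl
        · exact Or.inr (Or.inl rfl)
        · right; right
          rw [h, bdry, rightEdge, hG.next_next_next]
        · left; exact hG.bdry_rev_tail) G.rightEdge
    rcases key with h | h | h
    · exact h1 h
    · exact hG.rev_ne _ h.symm
    · exact h2 h
  · rw [rightEdge, hG.next_next_next] at h
    exact h2 (by rw [← h, hG.rev_rev]; rfl)

theorem isSlide : G.IsSlide G.rightEdge (G.next G.rightEdge) (G.rev G.rightEdge)
    (G.next (G.rev G.rightEdge)) (G.next (G.next (G.rev G.rightEdge))) := by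
  obtain ⟨h1, h2, h3, h4, h5⟩ := hG.canMove
  refine ⟨rfl, rfl, hG.next_next_next _, rfl, hG.rev_rev _, rfl, rfl, hG.next_next_next _, ?_⟩
  have hx : G.next (G.next G.rightEdge) = G.tail := hG.next_next_next _
  have i := @next_injective _ _ _ hG
  have u := hG.univalent
  have n3 := hG.next_next_next
  have hr := hG.rev_rev G.tail
  have hr' := hG.rev_rev G.rightEdge
  have ht : G.next G.tail = G.rightEdge := rfl
  have hu := hG.next_rev_tail
  have nk : G.next (G.rev G.rightEdge) ≠ G.rev G.rightEdge := fun h => by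
    have := (u _).1 h
    exact h1 (hG.rev_injective this)
  simp only [List.nodup_cons, List.mem_cons, List.not_mem_nil, or_false, not_or, not_false_eq_true,
    List.nodup_nil, and_true]
  generalize G.rightEdge = e at *
  refine ⟨⟨?_, ?_, ?_, ?_, ?_, ?_⟩, ⟨?_, ?_, ?_, ?_, ?_⟩, ⟨?_, ?_, ?_, ?_⟩, ⟨?_, ?_, ?_⟩,
    ⟨?_, ?_⟩, ?_⟩ <;> intro h <;> grind

end IsMarkedTrivalent

theorem IsSlide.bdry {e x k c d : D} (h : G.IsSlide e x k c d) :
    G.bdry G.tail = k ∧ G.bdry k = G.rev c ∧ G.bdry d = e ∧ G.bdry e = G.rev x ∧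
    G.bdry c = G.rev d ∧ G.bdry x = G.rev G.tail := by
  simp only [Fatgraph.bdry, h.next_tail, h.next_k, h.next_d, h.next_e, h.next_c, h.next_x, h.rev_e,
    h.rev_k, and_self]

theorem IsSlide.ne {e x k c d : D} (h : G.IsSlide e x k c d) :
    (¬G.rev G.tail = G.tail ∧ ¬G.rev G.tail = e ∧ ¬G.rev G.tail = x ∧ ¬G.rev G.tail = k ∧
      ¬G.rev G.tail = c ∧ ¬G.rev G.tail = d) ∧
    (¬G.tail = e ∧ ¬G.tail = x ∧ ¬G.tail = k ∧ ¬G.tail = c ∧ ¬G.tail = d) ∧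
    (¬e = x ∧ ¬e = k ∧ ¬e = c ∧ ¬e = d) ∧ (¬x = k ∧ ¬x = c ∧ ¬x = d) ∧ (¬k = c ∧ ¬k = d) ∧
    ¬c = d := by
  have hn := h.nodup
  simpa only [List.nodup_cons, List.mem_cons, List.not_mem_nil, or_false, not_or,
    not_false_eq_true, List.nodup_nil, and_true] using hn

/-- The darts away from a slide. -/
def Away (G : Fatgraph g D) (e x k c d y : D) : Prop :=
  y ≠ G.tail ∧ y ≠ e ∧ y ≠ x ∧ y ≠ k ∧ y ≠ c ∧ y ≠ d

theorem away_or (G : Fatgraph g D) (e x k c d y : D) :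
    G.tail = y ∨ e = y ∨ x = y ∨ k = y ∨ c = y ∨ d = y ∨ G.Away e x k c d y := by
  unfold Away; grind

theorem IsSlide.away_next {e x k c d : D} (h : G.IsSlide e x k c d) (hG : G.IsMarkedTrivalent)
    {y : D} (hy : G.Away e x k c d y) : G.Away e x k c d (G.next y) := by
  obtain ⟨s1, s2, s3, s4, s5, s6, s7, s8, -⟩ := h
  obtain ⟨h1, h2, h3, h4, h5, h6⟩ := hy
  have i {a b : D} (hab : a ≠ b) : G.next a ≠ G.next b := hG.next_injective.ne hab
  exact ⟨s3 ▸ i h3, s1 ▸ i h1, s2 ▸ i h2, s8 ▸ i h6, s6 ▸ i h4, s7 ▸ i h5⟩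

/-! ### The effect of the move on the graph and its marking -/

variable [DecidableEq D]

theorem moveRight_rev : G.moveRight.rev = G.rev := rfl

theorem moveRight_tail : G.moveRight.tail = G.tail := rfl

/-- The vertices `(t, e, x)` and `(k, c, d)` are replaced by `(t, c, e)` and `(x, k, d)`. -/
theorem IsSlide.moveRight_next {e x k c d : D} (h : G.IsSlide e x k c d) :
    G.moveRight.next G.tail = c ∧ G.moveRight.next e = G.tail ∧ G.moveRight.next x = k ∧
    G.moveRight.next k = d ∧ G.moveRight.next c = e ∧ G.moveRight.next d = x ∧
    ∀ y, G.Away e x k c d y → G.moveRight.next y = G.next y := by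
  have key (y : D) : G.moveRight.next y = if y = e then G.tail else if y = G.tail then c else
      if y = c then e else if y = k then d else if y = d then x else if y = x then k
      else G.next y := by
    simp only [moveRight, whitehead, rightEdge, h.next_tail, h.next_e, h.next_x, h.rev_e,
      h.next_k, h.next_c]
  have hn := h.ne
  refine ⟨?_, ?_, ?_, ?_, ?_, ?_, fun y hy => ?_⟩
  all_goals rw [key]
  all_goals first | obtain ⟨h1, h2, h3, h4, h5, h6⟩ := hy; simp only [*, if_false] | grind

theorem IsSlide.moveRight_mark {e x k c d : D} (h : G.IsSlide e x k c d) :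
    G.moveRight.mark e = (G.mark G.tail * G.mark c)⁻¹ ∧
    G.moveRight.mark k = G.mark G.tail * G.mark c ∧
    ∀ y, y ≠ e → y ≠ k → G.moveRight.mark y = G.mark y := by
  have key (y : D) : G.moveRight.mark y = if y = e then (G.mark G.tail * G.mark c)⁻¹ else
      if y = k then G.mark G.tail * G.mark c else G.mark y := by
    simp only [moveRight, whitehead, rightEdge, h.next_tail, h.next_e, h.next_x, h.rev_e,
      h.next_k]
  have hn := h.ne
  refine ⟨?_, ?_, fun y h1 h2 => ?_⟩
  · rw [key, if_pos rfl]
  · rw [key, if_neg (by grind), if_pos rfl]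
  · rw [key, if_neg h1, if_neg h2]

theorem IsSlide.moveRight_bdry {e x k c d : D} (h : G.IsSlide e x k c d) :
    G.moveRight.bdry G.tail = G.rev c ∧ G.moveRight.bdry c = k ∧
    G.moveRight.bdry e = G.rev G.tail ∧ G.moveRight.bdry k = G.rev d ∧
    G.moveRight.bdry d = G.rev x ∧ G.moveRight.bdry x = e ∧
    ∀ y, G.Away e x k c d y → G.moveRight.bdry y = G.bdry y := by
  obtain ⟨n1, n2, n3, n4, n5, n6, n7⟩ := h.moveRight_next
  simp only [Fatgraph.bdry, moveRight_rev, n1, n2, n3, n4, n5, n6, h.rev_e, h.rev_k, true_and]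
  exact fun y hy => congrArg G.rev (n7 y hy)

namespace IsSlide

variable {e x k c d : D} (h : G.IsSlide e x k c d) (hG : G.IsMarkedTrivalent)

include h hG

/-- The boundary cycle keeps its order, except that `k` moves from after `t` to after `c`, and `e`
from after `d` to after `x`. -/
theorem moveRight_one_boundary (y : D) : ∃ n : ℕ, G.moveRight.bdry^[n] G.tail = y := by
  obtain ⟨R, hR, ht, hs⟩ : ∃ R : D → Prop, (∀ y, R y → ∃ n, G.moveRight.bdry^[n] G.tail = y) ∧
      R G.tail ∧ ∀ y, R y → R (G.moveRight.bdry y) :=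
    ⟨fun y => ∃ n : ℕ, G.moveRight.bdry^[n] G.tail = y, fun _ => id, ⟨0, rfl⟩, fun y hy => by
      obtain ⟨n, rfl⟩ := hy
      exact ⟨n + 1, Function.iterate_succ_apply' _ _ _⟩⟩
  apply hR
  obtain ⟨b1, b2, b3, b4, b5, b6, b7⟩ := h.moveRight_bdry
  obtain ⟨a1, a2, a3, a4, a5, a6⟩ := h.bdry
  have hn := h.ne
  have r1 : G.rev c ≠ e := h.rev_k ▸ hG.rev_injective.ne (by grind)
  have r2 : G.rev d ≠ e := h.rev_k ▸ hG.rev_injective.ne (by grind)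
  -- Following the old cycle, the passage through `e` only has to remember that its predecessor `d`
  -- is reached, as the new cycle skips `e` there.
  have key := hG.forall_of_bdry (C := fun y => (y = e → R d) ∧ (y ≠ e → y ≠ k → R y))
    ⟨fun h => absurd h hn.2.1.1, fun _ _ => ht⟩ (fun y hy => by
      rcases G.away_or e x k c d y with rfl | rfl | rfl | rfl | rfl | rfl | hA
      · rw [a1]; grind
      · rw [a4, ← b5]
        exact ⟨fun _ => hy.1 rfl, fun _ _ => hs _ (hy.1 rfl)⟩
      · have := hs _ (hs _ (hy.2 (by grind) (by grind)))
        rw [b6, b3] at this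
        rw [a6]; grind
      · have := hs _ ht
        rw [b1] at this
        rw [a2]; grind
      · have := hs _ (hs _ (hy.2 (by grind) (by grind)))
        rw [b2, b4] at this
        rw [a5]; grind
      · rw [a3]
        exact ⟨fun _ => hy.2 (by grind) (by grind), fun h => absurd rfl h⟩
      · have hne : G.bdry y ≠ e ∧ G.bdry y ≠ k := by
          rw [← a3, ← a1]
          exact ⟨hG.bdry_injective.ne hA.2.2.2.2.2, hG.bdry_injective.ne hA.1⟩
        refine ⟨fun h => absurd h hne.1, fun _ _ => ?_⟩
        rw [← b7 y hA]
        exact hs _ (hy.2 hA.2.1 hA.2.2.2.1))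
  by_cases he : y = e
  · rw [he, ← b6]; exact hs _ ((key x).2 (by grind) (by grind))
  by_cases hk : y = k
  · rw [hk, ← b2]; exact hs _ ((key c).2 (by grind) (by grind))
  exact (key y).2 he hk

theorem moveRight_isMarkedTrivalent : G.moveRight.IsMarkedTrivalent := by
  obtain ⟨n1, n2, n3, n4, n5, n6, n7⟩ := h.moveRight_next
  obtain ⟨m1, m2, m3⟩ := h.moveRight_mark
  have hn := h.ne
  obtain ⟨s1, s2, s3, s4, s5, s6, s7, s8, -⟩ := id h
  have mt := m3 G.tail (by grind) (by grind)
  have mx := m3 x (by grind) (by grind)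
  have mc := m3 c (by grind) (by grind)
  have md := m3 d (by grind) (by grind)
  have v1 := hG.vertex e (by grind)
  have v2 := hG.vertex k (by grind)
  have ok := hG.orientation e
  rw [s2, s3] at v1
  rw [s6, s7] at v2
  rw [s4] at ok
  have e1 : G.mark e = (G.mark G.tail)⁻¹ * (G.mark x)⁻¹ := by
    rw [← mul_inv_rev, eq_inv_iff_mul_eq_one, ← mul_assoc, v1]
  have e2 : G.mark k = (G.mark d)⁻¹ * (G.mark c)⁻¹ := by
    rw [← mul_inv_rev, eq_inv_iff_mul_eq_one, ← mul_assoc, v2]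
  -- The relation at the four-valent vertex obtained by collapsing the edge; the new relations at
  -- `(x, k, d)` are conjugate to it.
  have e3 : G.mark d * G.mark x * G.mark G.tail * G.mark c = 1 := by
    rw [e1, e2] at ok
    have : G.mark d * G.mark x * G.mark G.tail * G.mark c =
      (G.mark d) * ((G.mark d)⁻¹ * (G.mark c)⁻¹ * ((G.mark G.tail)⁻¹ * (G.mark x)⁻¹))⁻¹ *
        (G.mark d)⁻¹ := by group
    rw [this, ok]; group
  refine ⟨hG.rev_rev, hG.rev_ne, fun y => ?_, fun y => ?_, h.moveRight_one_boundary hG, hG.genus,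
    fun y => ?_, fun y hy => ?_, ?_, ?_⟩
  · rcases G.away_or e x k c d y with rfl | rfl | rfl | rfl | rfl | rfl | hA
    · rw [n1, n5, n2]
    · rw [n2, n1, n5]
    · rw [n3, n4, n6]
    · rw [n4, n6, n3]
    · rw [n5, n2, n1]
    · rw [n6, n3, n4]
    · have hA' := h.away_next hG hA
      rw [n7 y hA, n7 _ hA', n7 _ (h.away_next hG hA'), hG.next_next_next]
  · rw [moveRight_rev, moveRight_tail]
    rcases G.away_or e x k c d y with rfl | rfl | rfl | rfl | rfl | rfl | hA
    · grind
    · grind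
    · grind
    · grind
    · grind
    · grind
    · rw [n7 y hA, hG.univalent]
  · rw [moveRight_rev]
    by_cases he : y = e
    · rw [he, s4, m1, m2, mul_inv_cancel]
    by_cases hk : y = k
    · rw [hk, s5, m1, m2, inv_mul_cancel]
    rw [m3 y he hk, m3 _ (fun h => hk (hG.rev_injective (h.trans s5.symm)))
      (fun h => he (hG.rev_injective (h.trans s4.symm))), hG.orientation]
  · rcases G.away_or e x k c d y with rfl | rfl | rfl | rfl | rfl | rfl | hA
    · rw [n1, n5, m1, mt, mc]; group
    · rw [n2, n1, m1, mt, mc]; group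
    · rw [n3, n4, m2, md, mx]
      have : G.mark x * (G.mark G.tail * G.mark c) * G.mark d = (G.mark d)⁻¹ *
        (G.mark d * G.mark x * G.mark G.tail * G.mark c) * G.mark d := by group
      rw [this, e3]; group
    · rw [n4, n6, m2, md, mx]
      have : G.mark G.tail * G.mark c * G.mark d * G.mark x = (G.mark d * G.mark x)⁻¹ *
        (G.mark d * G.mark x * G.mark G.tail * G.mark c) * (G.mark d * G.mark x) := by group
      rw [this, e3]; group
    · rw [n5, n2, m1, mt, mc]; group
    · rw [n6, n3, m2, md, mx, ← mul_assoc, e3]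
    · have hA' := h.away_next hG hA
      have hA'' := h.away_next hG hA'
      rw [n7 y hA] at hy
      rw [n7 y hA, n7 _ hA', m3 _ hA.2.1 hA.2.2.2.1, m3 _ hA'.2.1 hA'.2.2.2.1,
        m3 _ hA''.2.1 hA''.2.2.2.1, hG.vertex y hy]
  · rw [eq_top_iff, ← hG.full_rank, Subgroup.closure_le]
    rintro _ ⟨y, rfl⟩
    have hm (y : D) : G.moveRight.mark y ∈ Subgroup.closure (Set.range G.moveRight.mark) :=
      Subgroup.subset_closure ⟨y, rfl⟩
    by_cases he : y = e
    · rw [he, e1, ← mt, ← mx]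
      exact mul_mem (inv_mem (hm _)) (inv_mem (hm _))
    by_cases hk : y = k
    · rw [hk, e2, ← mc, ← md]
      exact mul_mem (inv_mem (hm _)) (inv_mem (hm _))
    rw [← m3 y he hk]
    exact hm y
  · rw [moveRight_rev, moveRight_tail, m3 _ (by grind) (by grind), hG.geometric]

/-- A solution `f` of the new relations becomes one of the old relations by resetting its values at
`e` and `k` from the old vertex `(t, e, x)`. The homomorphism it defines has the right values on the
new edge too, by the vertex `(t, c, e)`. -/
theorem moveRight_isPresentation (hP : G.IsPresentation) : G.moveRight.IsPresentation := by
  intro K _ f hr hv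
  obtain ⟨n1, n2, n3, n4, n5, n6, n7⟩ := h.moveRight_next
  obtain ⟨m1, m2, m3⟩ := h.moveRight_mark
  have hn := h.ne
  obtain ⟨s1, s2, s3, s4, s5, s6, s7, s8, -⟩ := id h
  have w1 := hv e (by grind)
  have w2 := hv k (by grind)
  have hr' := hr e
  rw [n2, n1] at w1
  rw [n4, n6] at w2
  rw [moveRight_rev, s4] at hr'
  have hfe : f e = (f G.tail * f c)⁻¹ := by rw [eq_inv_iff_mul_eq_one, ← mul_assoc, w1]
  have hfk : f k = f G.tail * f c := by
    rw [eq_inv_of_mul_eq_one_left hr', hfe, inv_inv]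
  rw [hfk] at w2
  let f' : D → K := fun y => if y = e then (f x * f G.tail)⁻¹ else if y = k then f x * f G.tail
    else f y
  have q1 : f' e = (f x * f G.tail)⁻¹ := if_pos rfl
  have q2 : f' k = f x * f G.tail := (if_neg (by grind)).trans (if_pos rfl)
  have q3 (y : D) (h1 : y ≠ e) (h2 : y ≠ k) : f' y = f y :=
    (if_neg h1).trans (if_neg h2)
  have qt := q3 G.tail (by grind) (by grind)
  have qx := q3 x (by grind) (by grind)
  have qc := q3 c (by grind) (by grind)
  have qd := q3 d (by grind) (by grind)
  obtain ⟨Φ, hΦ⟩ := hP K f' (fun y => by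
      by_cases he : y = e
      · rw [he, s4, q1, q2, mul_inv_cancel]
      by_cases hk : y = k
      · rw [hk, s5, q1, q2, inv_mul_cancel]
      rw [q3 y he hk, q3 _ (fun h => hk (hG.rev_injective (h.trans s5.symm)))
        (fun h => he (hG.rev_injective (h.trans s4.symm)))]
      exact hr y) (fun y hy => by
      rcases G.away_or e x k c d y with rfl | rfl | rfl | rfl | rfl | rfl | hA
      · rw [s1, s2, q1, qt, qx]; group
      · rw [s2, s3, q1, qt, qx]; group
      · rw [s3, s1, q1, qt, qx]; group
      · rw [s6, s7, q2, qc, qd]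
        have : f x * f G.tail * f c * f d = f x * (f G.tail * f c * f d * f x) * (f x)⁻¹ := by
          group
        rw [this, w2]; group
      · rw [s7, s8, q2, qc, qd]
        have : f c * f d * (f x * f G.tail) = (f G.tail)⁻¹ * (f G.tail * f c * f d * f x) *
          f G.tail := by group
        rw [this, w2]; group
      · rw [s8, s6, q2, qc, qd]
        have : f d * (f x * f G.tail) * f c = (f G.tail * f c)⁻¹ * (f G.tail * f c * f d * f x) *
          (f G.tail * f c) := by group
        rw [this, w2]; group
      · have hA' := h.away_next hG hA
        have hA'' := h.away_next hG hA'
        rw [q3 _ hA.2.1 hA.2.2.2.1, q3 _ hA'.2.1 hA'.2.2.2.1, q3 _ hA''.2.1 hA''.2.2.2.1]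
        have := hv y (by rwa [n7 y hA])
        rwa [n7 y hA, n7 _ hA'] at this)
  refine ⟨Φ, fun y => ?_⟩
  by_cases he : y = e
  · rw [he, m1, map_inv, map_mul, hΦ, hΦ, qt, qc, hfe]
  by_cases hk : y = k
  · rw [hk, m2, map_mul, hΦ, hΦ, qt, qc, hfk]
  rw [m3 y he hk, hΦ, q3 y he hk]

end IsSlide

theorem IsMarkedTrivalent.moveRight (hG : G.IsMarkedTrivalent) :
    G.moveRight.IsMarkedTrivalent := hG.isSlide.moveRight_isMarkedTrivalent hG

theorem IsPresentation.moveRight (hG : G.IsMarkedTrivalent) (hP : G.IsPresentation) :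
    G.moveRight.IsPresentation := hG.isSlide.moveRight_isPresentation hG hP

end Fatgraph

namespace Fatgraph

variable {D D' : Type} {G : Fatgraph g D}

/-! ### Low degrees of the fatgraph Magnus expansion -/

theorem corner_two (y : D) : G.corner 2 y =
    (1 / 2 : ℚ) • ⁅inc (cls (G.mark y)), inc (cls (G.mark (G.next y)))⁆ := by
  rw [corner, coeff_two_hausdorff (coeff_zero_lowSeries _ _) (coeff_zero_lowSeries _ _),
    coeff_lowSeries_of_lt one_lt_two, coeff_lowSeries_of_lt one_lt_two, ell_one, ell_one]

theorem coeff_one_lowSeries {n : ℕ} (hn : 1 < n) (y : D) :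
    PowerSeries.coeff 1 (G.lowSeries n y) = inc (cls (G.mark y)) := by
  rw [coeff_lowSeries_of_lt hn, ell_one]

namespace IsMarkedTrivalent

variable (hG : G.IsMarkedTrivalent)

include hG

theorem ell_two_mem (y : D) : G.ell 2 y ∈ lieTwo g := by
  have hps (y : D) : G.partialSum 2 y ∈ lieTwo g := sum_mem fun j _ => by
    rw [coeff_two_hausdorff (coeff_zero_lowSeries _ _)
      (by rw [map_neg, coeff_zero_lowSeries, neg_zero]), map_neg, coeff_one_lowSeries one_lt_two,
      coeff_one_lowSeries one_lt_two, ← map_neg]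
    exact Submodule.smul_mem _ _ (lie_mem_lieTwo _ _)
  rw [hG.ell_eq le_rfl]
  exact Submodule.smul_mem _ _ (sub_mem (hps _) (hps _))

theorem ell_three_mem (y : D) : G.ell 3 y ∈ lieThree g := by
  have hps (y : D) : G.partialSum 3 y ∈ lieThree g := sum_mem fun j _ => by
    rw [coeff_three_hausdorff (coeff_zero_lowSeries _ _)
      (by rw [map_neg, coeff_zero_lowSeries, neg_zero]), map_neg, map_neg,
      coeff_one_lowSeries (by omega), coeff_one_lowSeries (by omega), ← map_neg inc,
      coeff_lowSeries_of_lt (by omega), coeff_lowSeries_of_lt (by omega)]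
    refine add_mem (Submodule.smul_mem _ _ (sub_mem ?_ ?_))
      (Submodule.smul_mem _ _ (sub_mem ?_ ?_)) <;> refine lie_mem_lieThree _ ?_
    · exact neg_mem (hG.ell_two_mem _)
    · exact hG.ell_two_mem _
    · exact lie_mem_lieTwo _ _
    · exact lie_mem_lieTwo _ _
  rw [hG.ell_eq (by omega)]
  exact Submodule.smul_mem _ _ (sub_mem (hps _) (hps _))

theorem cls_tail : cls (G.mark G.tail) = 0 := by
  have := hG.cls_mark_rev G.tail
  rw [hG.geometric, cls_boundary] at this
  exact (neg_eq_zero.1 this.symm)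

omit hG in
theorem _root_.FatgraphJohnson.Fatgraph.IsFatgraphMagnus.comp_two {θ : MagnusExpansion g}
    (hθ : G.IsFatgraphMagnus θ) (y : D) : comp 2 (θ.toMonoidHom (G.mark y)) =
      G.ell 2 y + (1 / 2 : ℚ) • (G.ell 1 y * G.ell 1 y) := by
  rw [comp, hθ, coeff_two_expS (by rw [PowerSeries.coeff_mk, ell_zero])]
  simp only [PowerSeries.coeff_mk]

omit hG in
theorem _root_.FatgraphJohnson.Fatgraph.IsFatgraphMagnus.comp_three {θ : MagnusExpansion g}
    (hθ : G.IsFatgraphMagnus θ) (y : D) : comp 3 (θ.toMonoidHom (G.mark y)) =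
      G.ell 3 y + (1 / 2 : ℚ) • (G.ell 1 y * G.ell 2 y + G.ell 2 y * G.ell 1 y) +
        (1 / 6 : ℚ) • (G.ell 1 y * G.ell 1 y * G.ell 1 y) := by
  rw [comp, hθ, coeff_three_expS (by rw [PowerSeries.coeff_mk, ell_zero])]
  simp only [PowerSeries.coeff_mk]

end IsMarkedTrivalent

/-! ### The Johnson components of a slide -/

namespace IsSlide

variable [DecidableEq D] {e x k c d : D} (h : G.IsSlide e x k c d) (hG : G.IsMarkedTrivalent)

include h hG

omit [DecidableEq D] in
theorem cls_relations : cls (G.mark e) = cls (G.mark c) + cls (G.mark d) ∧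
    cls (G.mark k) = -(cls (G.mark c) + cls (G.mark d)) ∧
    cls (G.mark x) = -(cls (G.mark c) + cls (G.mark d)) := by
  have hn := h.ne
  obtain ⟨s1, s2, s3, s4, s5, s6, s7, s8, -⟩ := id h
  have v1 := congrArg cls (hG.vertex e (by grind))
  have v2 := congrArg cls (hG.vertex k (by grind))
  have hr := hG.cls_mark_rev e
  rw [s2, s3, cls_mul, cls_mul, cls_one, hG.cls_tail, add_zero] at v1
  rw [s6, s7, cls_mul, cls_mul, cls_one, add_assoc] at v2
  rw [s4] at hr
  have e1 := eq_neg_of_add_eq_zero_left v2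
  have e2 : cls (G.mark e) = cls (G.mark c) + cls (G.mark d) := by
    rw [← neg_neg (cls (G.mark e)), ← hr, e1, neg_neg]
  refine ⟨e2, e1, ?_⟩
  rw [← e2]
  exact eq_neg_of_add_eq_zero_right v1

theorem moveRight_cls : cls (G.moveRight.mark e) = -cls (G.mark c) ∧
    cls (G.moveRight.mark k) = cls (G.mark c) := by
  obtain ⟨m1, m2, -⟩ := h.moveRight_mark
  rw [m1, m2, cls_inv, cls_mul, hG.cls_tail, zero_add]
  exact ⟨rfl, rfl⟩

/-- On the first stretch, from the tail to `c̄`, the old corner at `k` contributes `½[c, d]` and the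
new cycle nothing, since `[t] = 0`. On the stretches `c → d̄` and `d → x̄` old and new corners have
equal sums, so the initial discrepancy persists as a constant. -/
theorem partialSum_two {y : D} (he : y ≠ e) (hk : y ≠ k) (ht : y ≠ G.tail)
    (ht' : y ≠ G.rev G.tail) : G.partialSum 2 y =
      G.moveRight.partialSum 2 y + (1 / 2 : ℚ) • ⁅inc (cls (G.mark c)), inc (cls (G.mark d))⁆ := by
  have hG' := h.moveRight_isMarkedTrivalent hG
  obtain ⟨n1, n2, n3, n4, n5, n6, n7⟩ := h.moveRight_next
  obtain ⟨b1, b2, b3, b4, b5, b6, b7⟩ := h.moveRight_bdry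
  obtain ⟨a1, a2, a3, a4, a5, a6⟩ := h.bdry
  obtain ⟨-, -, m3⟩ := h.moveRight_mark
  obtain ⟨me, mk⟩ := h.moveRight_cls hG
  obtain ⟨ce, ck, cx⟩ := h.cls_relations hG
  have hn := h.ne
  obtain ⟨s1, s2, s3, s4, s5, s6, s7, s8, -⟩ := id h
  have mt := m3 G.tail (by grind) (by grind)
  have mx := m3 x (by grind) (by grind)
  have mc := m3 c (by grind) (by grind)
  have md := m3 d (by grind) (by grind)
  set η := (1 / 2 : ℚ) • ⁅inc (cls (G.mark c)), inc (cls (G.mark d))⁆ with hη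
  have p (y : D) (hy : y ≠ G.rev G.tail) := hG.partialSum_bdry 2 hy
  have p' (y : D) (hy : y ≠ G.rev G.tail) := hG'.partialSum_bdry 2 (y := y) hy
  -- At `e` the comparison made at `d` is kept, so that the old path `d → e → x̄` can be matched
  -- with the new step `d → x̄`.
  have key := hG.forall_of_bdry (C := fun y =>
      (y = e → G.partialSum 2 d = G.moveRight.partialSum 2 d + η) ∧
      (y ≠ e → y ≠ k → y ≠ G.tail → y ≠ G.rev G.tail →
        G.partialSum 2 y = G.moveRight.partialSum 2 y + η))
    ⟨fun h => absurd h hn.2.1.1, fun _ _ h => absurd rfl h⟩ (fun y hy => by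
      rcases G.away_or e x k c d y with rfl | rfl | rfl | rfl | rfl | rfl | hA
      · rw [a1]; grind
      · rw [a4]
        refine ⟨fun _ => hy.1 rfl, fun _ _ _ _ => ?_⟩
        have q1 := p d (by grind)
        have q2 := p e (by grind)
        have q3 := p' d (by grind)
        rw [a3] at q1
        rw [a4] at q2
        rw [b5] at q3
        rw [q2, q1, q3, hy.1 rfl, corner_two, corner_two, corner_two, s8, s2, n6, mx, md, ce, ck, cx,
          hη]
        simp only [Ring.lie_def, map_add, map_neg, mul_add, add_mul, mul_neg, neg_mul]
        module
      · rw [a6]; grind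
      · rw [a2]
        have r1 : G.rev c ≠ e := h.rev_k ▸ hG.rev_injective.ne (by grind)
        refine ⟨fun h => absurd h r1, fun _ _ _ _ => ?_⟩
        have q1 := p G.tail (by grind)
        have q2 := p k (by grind)
        have q3 := p' G.tail (by grind)
        have pt : G.moveRight.partialSum 2 G.tail = 0 := partialSum_tail (G := G.moveRight) 2
        rw [a1, partialSum_tail, zero_add] at q1
        rw [a2] at q2
        rw [b1, pt, zero_add] at q3
        rw [q2, q1, q3, corner_two, corner_two, corner_two, s1, s6, n1, mt, mc, hG.cls_tail, ck, hη]
        simp only [Ring.lie_def, map_add, map_neg, mul_add, add_mul, mul_neg, neg_mul, map_zero,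
          zero_mul, mul_zero]
        module
      · rw [a5]
        have r1 : G.rev d ≠ e := h.rev_k ▸ hG.rev_injective.ne (by grind)
        refine ⟨fun h => absurd h r1, fun _ _ _ _ => ?_⟩
        have q1 := p c (by grind)
        have q2 := p' c (by grind)
        have q3 := p' k (by grind)
        rw [a5] at q1
        rw [b2] at q2
        rw [b4] at q3
        rw [q1, q3, q2, hy.2 (by grind) (by grind) (by grind) (by grind), corner_two, corner_two,
          corner_two, s7, n5, n4, mc, md, me, mk, hη]
        simp only [Ring.lie_def, map_neg, mul_neg, neg_mul]
        module
      · rw [a3]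
        exact ⟨fun _ => hy.2 (by grind) (by grind) (by grind) (by grind), fun h => absurd rfl h⟩
      · have hne : G.bdry y ≠ e ∧ G.bdry y ≠ k := by
          rw [← a3, ← a1]
          exact ⟨hG.bdry_injective.ne hA.2.2.2.2.2, hG.bdry_injective.ne hA.1⟩
        refine ⟨fun h => absurd h hne.1, fun _ _ h1 h2 => ?_⟩
        have hyt : y ≠ G.rev G.tail := fun h => h1 (by rw [h, hG.bdry_rev_tail])
        have hA' := h.away_next hG hA
        have q1 := p y hyt
        have q2 := p' y hyt
        rw [b7 y hA] at q2
        rw [q1, q2, hy.2 hA.2.1 hA.2.2.2.1 hA.1 hyt, corner_two, corner_two, n7 y hA,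
          m3 _ hA.2.1 hA.2.2.2.1, m3 _ hA'.2.1 hA'.2.2.2.1]
        abel)
  exact (key y).2 he hk ht ht'

/-- `ℓ₂` is a third of a difference of partial sums, in which the constant shift cancels. -/
theorem ell_two_moveRight {y : D} (he : y ≠ e) (hk : y ≠ k) (ht : y ≠ G.tail)
    (ht' : y ≠ G.rev G.tail) : G.moveRight.ell 2 y = G.ell 2 y := by
  rw [hG.ell_eq le_rfl, (h.moveRight_isMarkedTrivalent hG).ell_eq le_rfl, moveRight_rev,
    h.partialSum_two hG he hk ht ht', h.partialSum_two hG (y := G.rev y)]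
  · module
  · exact h.rev_k ▸ hG.rev_injective.ne hk
  · exact h.rev_e ▸ hG.rev_injective.ne he
  · exact fun h => ht' (by rw [← h, hG.rev_rev])
  · exact hG.rev_injective.ne ht

/-- The omitted edges carry no new classes: `[e] = -[x]`, `[k] = [x]`, and the tail is
null-homologous. -/
theorem mem_of_forall {S : Submodule ℚ (H g)} (hS : ∀ y, y ≠ e → y ≠ k → y ≠ G.tail →
    y ≠ G.rev G.tail → cls (G.mark y) ∈ S) (z : H g) : z ∈ S := by
  have hn := h.ne
  obtain ⟨ce, ck, cx⟩ := h.cls_relations hG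
  have hx := hS x (by grind) (by grind) (by grind) (by grind)
  refine mem_of_cls_mem hG.full_rank (fun y => ?_) z
  by_cases he : y = e
  · rw [he, ce, ← neg_neg (_ + _), ← cx]; exact neg_mem hx
  by_cases hk : y = k
  · rw [hk, ck, ← cx]; exact hx
  by_cases ht : y = G.tail
  · rw [ht, hG.cls_tail]; exact zero_mem _
  by_cases ht' : y = G.rev G.tail
  · rw [ht', hG.geometric, cls_boundary]; exact zero_mem _
  exact hS y he hk ht ht'

variable {θ θ' : MagnusExpansion g} (hθ : G.IsFatgraphMagnus θ)
  (hθ' : G.moveRight.IsFatgraphMagnus θ') {U : IA g} (hU : IsFatgraphJohnson θ θ' U)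

include hθ hθ' hU

theorem hom_one_eq_zero : U.hom 1 = 0 := by
  refine LinearMap.ext fun z => h.mem_of_forall hG (S := LinearMap.ker (U.hom 1))
    (fun y he hk ht ht' => ?_) z
  have hm := h.moveRight_mark.2.2 y he hk
  have h2 := hθ'.comp_two y
  rw [hm, h.ell_two_moveRight hG he hk ht ht', ell_one, hm, ← ell_one, ← hθ.comp_two] at h2
  rw [LinearMap.mem_ker, hU.hom_one, h2, sub_self]

/-- On edges whose `ℓ₁` and `ℓ₂` are unchanged, the products in the degree three part of `exp`
cancel. The difference of the two `ℓ₃` remains, and each of them is a Lie element. -/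
theorem hom_two_mem (z : H g) : U.hom 2 z ∈ lieThree g := by
  refine h.mem_of_forall hG (S := (lieThree g).comap (U.hom 2)) (fun y he hk ht ht' => ?_) z
  have hm := h.moveRight_mark.2.2 y he hk
  have h3 := hθ'.comp_three y
  rw [hm, h.ell_two_moveRight hG he hk ht ht', ell_one, hm, ← ell_one] at h3
  rw [Submodule.mem_comap, hU.hom_two (h.hom_one_eq_zero hG hθ hθ' hU), h3, hθ.comp_three,
    add_sub_add_right_eq_sub, add_sub_add_right_eq_sub]
  exact sub_mem (hG.ell_three_mem y) ((h.moveRight_isMarkedTrivalent hG).ell_three_mem y)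

end IsSlide

end Fatgraph

/-! ### The symplectic fatgraph -/

theorem sympNext_trunk (j : Fin g) : sympNext (trunk j, false) =
    if h : j.val + 1 < g then (.s ⟨j.val + 1, h⟩, false) else (trunk j, false) := by
  unfold trunk
  split_ifs with h0 h1 h1
  · simp only [sympNext, h0, dif_pos]
    rw [dif_pos (by omega)]
  · simp only [sympNext, h0, dif_pos]
    rw [dif_neg (by omega)]
  · simp only [sympNext]
    rw [dif_pos (by omega)]
    simp only [Prod.mk.injEq, SympEdge.s.injEq, Fin.mk.injEq, and_true]
    omega
  · simp only [sympNext]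
    rw [dif_neg (by omega)]

theorem sympNext_s {j : ℕ} (h : j + 1 < g) : sympNext (.s ⟨j + 1, h⟩, false) =
    (.r ⟨j, by omega⟩, true) := by
  simp [sympNext]

theorem trunk_succ {j : ℕ} (h : j + 1 < g) : trunk ⟨j + 1, h⟩ = .r ⟨j, by omega⟩ := by
  simp [trunk]

theorem trunk_zero (h : 0 < g) : trunk ⟨0, h⟩ = .s ⟨0, h⟩ := by
  simp [trunk]

/-- Case analysis on the oriented edges of the symplectic fatgraph. -/
theorem sympDart_cases {C : SympDart g → Prop} (hu : ∀ i b, C (.u i, b)) (hv : ∀ i b, C (.v i, b))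
    (hp : ∀ i b, C (.p i, b)) (hq : ∀ i b, C (.q i, b)) (hs : ∀ i, C (.s i, true))
    (hs' : ∀ j (h : j + 1 < g), C (.s ⟨j + 1, h⟩, false))
    (hr : ∀ j (h : j + 1 < g), C (.r ⟨j, by omega⟩, true)) (ht : ∀ j, C (trunk j, false))
    (y : SympDart g) : C y := by
  rcases y with ⟨i | i | i | i | i | j, b⟩
  · exact hu i b
  · exact hv i b
  · exact hp i b
  · exact hq i b
  · rcases b with _ | _
    · rcases i with ⟨_ | i, hi⟩
      · rw [← trunk_zero]; exact ht _
      · exact hs' i hi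
    · exact hs i
  · rcases j with ⟨j, hj⟩
    have h : j + 1 < g := by omega
    rcases b with _ | _
    · rw [← trunk_succ h]; exact ht _
    · exact hr j h

theorem sympNext_sympNext_sympNext (y : SympDart g) : sympNext (sympNext (sympNext y)) = y := by
  revert y
  refine sympDart_cases ?_ ?_ ?_ ?_ ?_ ?_ ?_ ?_
  · rintro i (_ | _) <;> rfl
  · rintro i (_ | _) <;> rfl
  · rintro i (_ | _) <;> rfl
  · rintro i (_ | _) <;> rfl
  · intro i; rfl
  · intro j h
    rw [sympNext_s h]
    change sympNext (trunk ⟨j, _⟩, false) = _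
    rw [sympNext_trunk, dif_pos h]
  · intro j h
    change sympNext (sympNext (trunk ⟨j, _⟩, false)) = _
    rw [sympNext_trunk, dif_pos h, sympNext_s h]
  · intro j
    rw [sympNext_trunk]
    split_ifs with h
    · rw [sympNext_s h]
      rfl
    · rw [sympNext_trunk, dif_neg h, sympNext_trunk, dif_neg h]

theorem trunk_ne (j : Fin g) : (∀ i, trunk j ≠ .u i) ∧ (∀ i, trunk j ≠ .v i) ∧
    (∀ i, trunk j ≠ .p i) ∧ (∀ i, trunk j ≠ .q i) := by
  unfold trunk
  split_ifs <;> simp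

theorem trunk_injective : Function.Injective (trunk : Fin g → SympEdge g) := by
  rintro ⟨i, hi⟩ ⟨j, hj⟩ h
  rcases i with _ | i <;> rcases j with _ | j <;> simp_all [trunk]

theorem sympNext_eq_self_iff (hg : 0 < g) (y : SympDart g) :
    sympNext y = y ↔ y = (trunk ⟨g - 1, by omega⟩, false) := by
  have ht := trunk_ne (⟨g - 1, by omega⟩ : Fin g)
  revert y
  refine sympDart_cases ?_ ?_ ?_ ?_ ?_ ?_ ?_ ?_
  · rintro i (_ | _) <;> simp [sympNext, (ht.1 i).symm]
  · rintro i (_ | _) <;> simp [sympNext, (ht.2.1 i).symm]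
  · rintro i (_ | _) <;> simp [sympNext, (ht.2.2.1 i).symm]
  · rintro i (_ | _) <;> simp [sympNext, (ht.2.2.2 i).symm]
  · intro i; simp [sympNext]
  · intro j h
    rw [sympNext_s h]
    simp only [Prod.mk.injEq, reduceCtorEq, and_false, false_iff, and_true]
    have : g - 1 ≠ 0 := by omega
    simp [trunk, this]
  · intro j h
    simp [sympNext]
  · intro j
    rw [sympNext_trunk]
    split_ifs with h
    · have h1 : (⟨j.val, by omega⟩ : Fin g) ≠ ⟨g - 1, by omega⟩ := by
        simp only [ne_eq, Fin.mk.injEq]; omega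
      have h2 : trunk j ≠ .s ⟨j.val + 1, h⟩ := by
        unfold trunk
        split_ifs with h0
        · simp only [ne_eq, SympEdge.s.injEq, Fin.ext_iff]; omega
        · simp
      simp only [Prod.mk.injEq, and_true]
      exact ⟨fun h => absurd h.symm h2, fun h => absurd (trunk_injective h) h1⟩
    · have h1 : j = ⟨g - 1, by omega⟩ := Fin.ext (by simp; omega)
      simp [← h1]

theorem sympFatgraph_card (hg : 0 < g) : Nat.card (SympDart g) + 2 = 12 * g := by
  let f : SympEdge g ≃ ((Fin g ⊕ Fin g) ⊕ (Fin g ⊕ Fin g)) ⊕ (Fin g ⊕ Fin (g - 1)) :=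
    { toFun := fun y => match y with
        | .u i => .inl (.inl (.inl i))
        | .v i => .inl (.inl (.inr i))
        | .p i => .inl (.inr (.inl i))
        | .q i => .inl (.inr (.inr i))
        | .s i => .inr (.inl i)
        | .r j => .inr (.inr j)
      invFun := fun y => match y with
        | .inl (.inl (.inl i)) => .u i
        | .inl (.inl (.inr i)) => .v i
        | .inl (.inr (.inl i)) => .p i
        | .inl (.inr (.inr i)) => .q i
        | .inr (.inl i) => .s i
        | .inr (.inr j) => .r j
      left_inv := by rintro (_ | _ | _ | _ | _ | _) <;> rfl
      right_inv := by rintro (((_ | _) | (_ | _)) | (_ | _)) <;> rfl }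
  rw [Nat.card_prod, Nat.card_congr f]
  simp only [Nat.card_eq_fintype_card, Fintype.card_sum, Fintype.card_fin, Fintype.card_bool]
  omega

theorem partialBoundary_succ {j : ℕ} (h : j < g) : partialBoundary g (j + 1) =
    partialBoundary g j * comm (uGen ⟨j, h⟩) (vGen ⟨j, h⟩) := by
  rw [partialBoundary, List.prod_take_succ _ _ (by simpa using h), List.getElem_ofFn]
  rfl

theorem partialBoundary_zero : partialBoundary g 0 = 1 := by simp [partialBoundary]

theorem sympMark_trunk (j : Fin g) : sympMark (trunk j) = (partialBoundary g (j + 1))⁻¹ := by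
  rcases j with ⟨_ | j, hj⟩
  · rw [trunk_zero, sympMark, partialBoundary_succ hj, partialBoundary_zero, one_mul]
  · rw [trunk_succ hj, sympMark]

/-- The cycle descends the trunk from the tail to handle `0` and then climbs back, going round every
handle on the way in the order `s, p, ū, v, p̄, q̄, u, v̄, q, s̄`. -/
theorem sympFatgraph_one_boundary (hg : 0 < g) (y : SympDart g) :
    ∃ n : ℕ, (sympFatgraph g hg).bdry^[n] (sympFatgraph g hg).tail = y := by
  obtain ⟨R, hR, ht, hs⟩ : ∃ R : SympDart g → Prop,
      (∀ y, R y → ∃ n, (sympFatgraph g hg).bdry^[n] (sympFatgraph g hg).tail = y) ∧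
      R (sympFatgraph g hg).tail ∧ ∀ y, R y → R ((sympNext y).1, !(sympNext y).2) :=
    ⟨fun y => ∃ n : ℕ, (sympFatgraph g hg).bdry^[n] (sympFatgraph g hg).tail = y,
      fun _ => id, ⟨0, rfl⟩, fun y hy => by
        obtain ⟨n, rfl⟩ := hy
        exact ⟨n + 1, Function.iterate_succ_apply' _ _ _⟩⟩
  have down (m : ℕ) (hm : m < g) : R (trunk ⟨g - 1 - m, by omega⟩, true) := by
    induction m with
    | zero => exact ht
    | succ m ih =>
      have := hs _ (ih (by omega))
      have e : (⟨g - 1 - m, by omega⟩ : Fin g) = ⟨(g - 1 - (m + 1)) + 1, by omega⟩ :=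
        Fin.ext (by simp; omega)
      rw [e, trunk_succ (by omega)] at this
      exact this
  have handle (i : Fin g) (hi : R (.s i, true)) : (∀ b, R (.u i, b)) ∧ (∀ b, R (.v i, b)) ∧
      (∀ b, R (.p i, b)) ∧ (∀ b, R (.q i, b)) ∧ R (.s i, false) := by
    have h1 : R (.p i, true) := hs _ hi
    have h2 : R (.u i, false) := hs _ h1
    have h3 : R (.v i, true) := hs _ h2
    have h4 : R (.p i, false) := hs _ h3
    have h5 : R (.q i, false) := hs _ h4
    have h6 : R (.u i, true) := hs _ h5
    have h7 : R (.v i, false) := hs _ h6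
    have h8 : R (.q i, true) := hs _ h7
    have h9 : R (.s i, false) := hs _ h8
    exact ⟨Bool.rec h2 h6, Bool.rec h7 h3, Bool.rec h4 h1, Bool.rec h5 h8, h9⟩
  have up (j : ℕ) (hj : j < g) : R (.s ⟨j, hj⟩, true) ∧ R (trunk ⟨j, hj⟩, false) := by
    induction j with
    | zero =>
      have h0 := down (g - 1) (by omega)
      have e : (⟨g - 1 - (g - 1), by omega⟩ : Fin g) = ⟨0, hj⟩ := Fin.ext (by simp)
      rw [e, trunk_zero] at h0
      rw [trunk_zero]
      exact ⟨h0, (handle _ h0).2.2.2.2⟩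
    | succ j ih =>
      have h1 := hs _ (ih (by omega)).2
      rw [sympNext_trunk, dif_pos hj] at h1
      have h2 := hs _ (handle _ h1).2.2.2.2
      rw [sympNext_s hj] at h2
      rw [trunk_succ hj]
      exact ⟨h1, h2⟩
  apply hR
  revert y
  refine sympDart_cases ?_ ?_ ?_ ?_ ?_ ?_ ?_ ?_
  · exact fun i b => (handle i (up i i.2).1).1 b
  · exact fun i b => (handle i (up i i.2).1).2.1 b
  · exact fun i b => (handle i (up i i.2).1).2.2.1 b
  · exact fun i b => (handle i (up i i.2).1).2.2.2.1 b
  · exact fun i => (up i i.2).1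
  · exact fun j h => (handle _ (up (j + 1) h).1).2.2.2.2
  · intro j h
    rw [← trunk_succ h]
    have e : (⟨g - 1 - (g - 1 - (j + 1)), by omega⟩ : Fin g) = ⟨j + 1, h⟩ :=
      Fin.ext (by simp; omega)
    rw [← e]
    exact down _ (by omega)
  · exact fun j => (up j j.2).2

theorem sympFatgraph_vertex (hg : 0 < g) (y : SympDart g) (hy : sympNext y ≠ y) :
    (sympFatgraph g hg).mark y * (sympFatgraph g hg).mark (sympNext y) *
      (sympFatgraph g hg).mark (sympNext (sympNext y)) = 1 := by
  have hm (e : SympEdge g) : (sympFatgraph g hg).mark (e, true) = sympMark e := rfl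
  have hm' (e : SympEdge g) : (sympFatgraph g hg).mark (e, false) = (sympMark e)⁻¹ := rfl
  have ht (j : ℕ) (h : j < g) : (sympFatgraph g hg).mark (trunk ⟨j, h⟩, false) =
      partialBoundary g (j + 1) := by rw [hm', sympMark_trunk, inv_inv]
  have hr (j : ℕ) (h : j + 1 < g) : (sympFatgraph g hg).mark (.r ⟨j, by omega⟩, true) =
      (comm (uGen ⟨j + 1, h⟩) (vGen ⟨j + 1, h⟩))⁻¹ * (partialBoundary g (j + 1))⁻¹ := by
    rw [hm, sympMark, ← mul_inv_rev, ← partialBoundary_succ h]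
  revert y
  refine sympDart_cases ?_ ?_ ?_ ?_ ?_ ?_ ?_ ?_
  · rintro i (_ | _) - <;> simp only [sympNext, hm, hm', sympMark] <;> group
  · rintro i (_ | _) - <;> simp only [sympNext, hm, hm', sympMark] <;> group
  · rintro i (_ | _) - <;> simp only [sympNext, hm, hm', sympMark, comm] <;> group
  · rintro i (_ | _) - <;> simp only [sympNext, hm, hm', sympMark, comm] <;> group
  · rintro i -
    simp only [sympNext, hm, hm', sympMark, comm]; group
  · rintro j h -
    have e : sympNext (.r ⟨j, by omega⟩, true) = ((trunk ⟨j, by omega⟩ : SympEdge g), false) := rfl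
    rw [sympNext_s h, e, ht, hr j h, hm', sympMark]
    group
  · rintro j h -
    have e : sympNext (.r ⟨j, by omega⟩, true) = ((trunk ⟨j, by omega⟩ : SympEdge g), false) := rfl
    rw [e, sympNext_trunk, dif_pos h, ht, hr j h, hm', sympMark]
    group
  · rintro ⟨j, hj⟩ hy
    rw [sympNext_trunk] at hy ⊢
    split_ifs at hy ⊢ with h
    · rw [sympNext_s h, ht, hr j h, hm', sympMark]
      group
    · exact absurd rfl hy

theorem sympFatgraph_isMarkedTrivalent (hg : 0 < g) :
    (sympFatgraph g hg).IsMarkedTrivalent where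
  rev_rev e := by simp [sympFatgraph]
  rev_ne e := by rcases e with ⟨e, _ | _⟩ <;> simp [sympFatgraph]
  next_next_next := sympNext_sympNext_sympNext
  univalent := sympNext_eq_self_iff hg
  one_boundary := sympFatgraph_one_boundary hg
  genus := sympFatgraph_card hg
  orientation e := by rcases e with ⟨e, _ | _⟩ <;> simp [sympFatgraph]
  vertex := sympFatgraph_vertex hg
  full_rank := by
    rw [eq_top_iff, ← FreeGroup.closure_range_of, Subgroup.closure_le]
    rintro _ ⟨i | i, rfl⟩
    · exact Subgroup.subset_closure ⟨(.u i, true), rfl⟩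
    · exact Subgroup.subset_closure ⟨(.v i, true), rfl⟩
  geometric := by
    change (sympMark (trunk ⟨g - 1, by omega⟩))⁻¹ = _
    rw [sympMark_trunk, inv_inv, boundary]
    simp only
    rw [Nat.sub_add_cancel hg]

/-- The values on the `u_i` and `v_i` are free. The vertex relations then determine those on the
`p_i`, `q_i`, `s_i` and, inductively, on the trunk. -/
theorem sympFatgraph_isPresentation (hg : 0 < g) : (sympFatgraph g hg).IsPresentation := by
  intro K _ f hr hv
  let Φ : Pi1 g →* K :=
    FreeGroup.lift (Sum.elim (fun i => f (.u i, true)) fun i => f (.v i, true))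
  have hu (i : Fin g) : Φ (uGen i) = f (.u i, true) := by simp [Φ, uGen]
  have hv' (i : Fin g) : Φ (vGen i) = f (.v i, true) := by simp [Φ, vGen]
  have hrev (e : SympEdge g) : f (e, false) = (f (e, true))⁻¹ :=
    eq_inv_of_mul_eq_one_left (hr (e, true))
  have hp (i : Fin g) : f (.p i, true) = (f (.u i, true) * f (.v i, true))⁻¹ :=
    eq_inv_of_mul_eq_one_right (hv (.u i, true) (by simp [sympFatgraph, sympNext]))
  have hq (i : Fin g) : f (.q i, true) = (f (.v i, true) * f (.u i, true))⁻¹ := by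
    have h : f (.q i, false) = (f (.u i, false) * f (.v i, false))⁻¹ :=
      eq_inv_of_mul_eq_one_right (hv (.u i, false) (by simp [sympFatgraph, sympNext]))
    rw [hrev, hrev, hrev, inv_inj] at h
    rw [h, mul_inv_rev]
  have hs (i : Fin g) : f (.s i, true) = (Φ (comm (uGen i) (vGen i)))⁻¹ := by
    have h : f (.p i, false) * f (.q i, true) * f (.s i, true) = 1 :=
      hv (.p i, false) (by simp [sympFatgraph, sympNext])
    rw [eq_inv_of_mul_eq_one_right h, hrev, hp, hq, comm, inv_inj]
    simp only [map_mul, map_inv, hu, hv']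
    group
  have ht (j : ℕ) (hj : j < g) :
      f (trunk ⟨j, hj⟩, true) = (Φ (partialBoundary g (j + 1)))⁻¹ := by
    induction j with
    | zero =>
      rw [trunk_zero, hs, partialBoundary_succ hj, partialBoundary_zero, one_mul]
    | succ j ih =>
      have h := hv (.r ⟨j, by omega⟩, true) (by simp [sympFatgraph, sympNext])
      have e : (sympFatgraph g hg).next (.r ⟨j, by omega⟩, true) =
        ((trunk ⟨j, by omega⟩ : SympEdge g), false) := rfl
      have e' : (sympFatgraph g hg).next (trunk ⟨j, by omega⟩, false) =
          ((SympEdge.s ⟨j + 1, hj⟩ : SympEdge g), false) := by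
        change sympNext _ = _
        rw [sympNext_trunk, dif_pos hj]
      rw [e, e', hrev, hrev, ih (by omega), hs, inv_inv, inv_inv, mul_assoc, ← map_mul,
        ← partialBoundary_succ hj] at h
      rw [trunk_succ hj]
      exact eq_inv_of_mul_eq_one_left h
  have key (e : SympEdge g) : Φ (sympMark e) = f (e, true) := by
    rcases e with i | i | i | i | i | ⟨j, hj⟩
    · exact hu i
    · exact hv' i
    · rw [hp, sympMark, map_inv, map_mul, hu, hv']
    · rw [hq, sympMark, map_inv, map_mul, hu, hv']
    · rw [hs, sympMark, map_inv]
    · have h : j + 1 < g := by omega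
      rw [← trunk_succ h, ht, trunk_succ h, sympMark, map_inv]
  refine ⟨Φ, ?_⟩
  rintro ⟨e, _ | _⟩
  · change Φ (sympMark e)⁻¹ = _
    rw [map_inv, key, hrev]
  · exact key e

namespace Fatgraph

variable {D D' D'' : Type}

/-! ### Isomorphisms -/

theorem Iso.trans {G : Fatgraph g D} {G' : Fatgraph g D'} {G'' : Fatgraph g D''} (h : G.Iso G')
    (h' : G'.Iso G'') : G.Iso G'' := by
  obtain ⟨f, h1, h2, h3, h4⟩ := h
  obtain ⟨f', h1', h2', h3', h4'⟩ := h'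
  refine ⟨f.trans f', fun e => ?_, fun e => ?_, ?_, fun e => ?_⟩
  · rw [Equiv.trans_apply, h1, h1', Equiv.trans_apply]
  · rw [Equiv.trans_apply, h2, h2', Equiv.trans_apply]
  · rw [Equiv.trans_apply, h3, h3']
  · rw [h4, h4', Equiv.trans_apply]

theorem Iso.refl (G : Fatgraph g D) : G.Iso G :=
  ⟨Equiv.refl D, fun _ => rfl, fun _ => rfl, rfl, fun _ => rfl⟩

theorem Iso.moveRight [DecidableEq D] [DecidableEq D'] {G : Fatgraph g D} {G' : Fatgraph g D'}
    (h : G.Iso G') : G.moveRight.Iso G'.moveRight := by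
  obtain ⟨f, h1, h2, h3, h4⟩ := h
  refine ⟨f, fun y => ?_, h2, h3, fun y => ?_⟩
  · simp only [Fatgraph.moveRight, whitehead, rightEdge, ← h3, ← h1, ← h2, f.injective.eq_iff]
    grind
  · simp only [Fatgraph.moveRight, whitehead, rightEdge, ← h3, ← h1, ← h2, f.injective.eq_iff,
      ← h4]
    grind

/-! ### Closed fatgraphs with a tail attached -/

/-- The oriented edges of the closed fatgraph, in the set of oriented edges of a bordered fatgraph
with tail `t` attached at the edges `x` and `e`, which in the closed fatgraph are one edge `e`. -/
def Inner (σ : D → D) (t x y : D) : Prop := y ≠ t ∧ y ≠ σ t ∧ y ≠ x ∧ y ≠ σ x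

/-- A closed trivalent fatgraph on the inner edges, given by the reversal `σ` and the cyclic
order `ν`. -/
structure IsClosed (σ ν : D → D) (t x : D) : Prop where
  rev_rev : ∀ y, σ (σ y) = y
  rev_ne : ∀ y, σ y ≠ y
  next_next_next : ∀ y, ν (ν (ν y)) = y
  next_tail : ν t = t
  next_rev_tail : ν (σ t) = σ t
  next_x : ν x = x
  next_rev_x : ν (σ x) = σ x
  x_ne : x ≠ t
  x_ne_rev : x ≠ σ t
  next_ne : ∀ y, Inner σ t x y → ν y ≠ y
  next_rev_ne : ∀ y, Inner σ t x y → ν (σ y) ≠ y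

namespace IsClosed

variable {σ ν : D → D} {t x : D} (hC : IsClosed σ ν t x)

include hC

theorem inner_rev {y : D} (hy : Inner σ t x y) : Inner σ t x (σ y) := by
  have h := hC.rev_rev
  obtain ⟨h1, h2, h3, h4⟩ := hy
  refine ⟨?_, ?_, ?_, ?_⟩ <;> grind

theorem inner_next {y : D} (hy : Inner σ t x y) : Inner σ t x (ν y) := by
  have h := hC.next_next_next y
  obtain ⟨h1, h2, h3, h4⟩ := hy
  have a1 := hC.next_tail
  have a2 := hC.next_rev_tail
  have a3 := hC.next_x
  have a4 := hC.next_rev_x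
  refine ⟨?_, ?_, ?_, ?_⟩ <;> grind

theorem ne : t ≠ σ t ∧ t ≠ x ∧ t ≠ σ x ∧ x ≠ σ t ∧ x ≠ σ x ∧ σ t ≠ σ x := by
  have h := hC.rev_rev
  have h1 := hC.rev_ne t
  have h2 := hC.rev_ne x
  have h3 := hC.x_ne
  have h4 := hC.x_ne_rev
  refine ⟨?_, ?_, ?_, ?_, ?_, ?_⟩ <;> grind

end IsClosed

variable [DecidableEq D]

/-- The bordered fatgraph obtained from a closed fatgraph by attaching the tail at the edge `e`. -/
def attach (σ ν : D → D) (t x e : D) (m : D → Pi1 g) : Fatgraph g D where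
  next y := if y = t then e else if y = e then x else if y = x then t else if y = σ t then σ t
    else if y = σ x then ν e else if ν y = e then σ x else ν y
  rev := σ
  tail := t
  mark y := if y = t then (boundary g)⁻¹ else if y = σ t then boundary g
    else if y = x then (m e)⁻¹ * boundary g else if y = σ x then (boundary g)⁻¹ * m e else m y

/-- The change of the marking of the closed fatgraph when the tail passes the edge `e`. -/
def passMark (σ : D → D) (e : D) (m : D → Pi1 g) (y : D) : Pi1 g :=
  if y = e then (boundary g)⁻¹ * m e else if y = σ e then m (σ e) * boundary g else m y

namespace IsClosed

variable {σ ν : D → D} {t x : D} (hC : IsClosed σ ν t x)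

include hC

theorem attach_next {e : D} (he : Inner σ t x e) (m : D → Pi1 g) :
    (attach σ ν t x e m).next t = e ∧ (attach σ ν t x e m).next e = x ∧
    (attach σ ν t x e m).next x = t ∧ (attach σ ν t x e m).next (σ t) = σ t ∧
    (attach σ ν t x e m).next (σ x) = ν e ∧ (attach σ ν t x e m).next (ν (ν e)) = σ x ∧
    ∀ y, Inner σ t x y → y ≠ e → y ≠ ν (ν e) → (attach σ ν t x e m).next y = ν y := by
  have hn := hC.ne
  have h3 := hC.next_next_next
  have h4 := hC.inner_next (hC.inner_next he)
  have h5 := hC.next_ne (ν (ν e)) h4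
  obtain ⟨e1, e2, e3, e4⟩ := he
  obtain ⟨f1, f2, f3, f4⟩ := h4
  simp only [attach]
  refine ⟨?_, ?_, ?_, ?_, ?_, ?_, ?_⟩
  · simp
  · simp [e1]
  · grind
  · grind
  · grind
  · grind
  · rintro y ⟨h1, h2, h3, h4⟩ h5 h6
    grind

theorem attach_mark (e : D) (m : D → Pi1 g) :
    (attach σ ν t x e m).mark t = (boundary g)⁻¹ ∧
    (attach σ ν t x e m).mark (σ t) = boundary g ∧
    (attach σ ν t x e m).mark x = (m e)⁻¹ * boundary g ∧
    (attach σ ν t x e m).mark (σ x) = (boundary g)⁻¹ * m e ∧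
    ∀ y, Inner σ t x y → (attach σ ν t x e m).mark y = m y := by
  have hn := hC.ne
  simp only [attach]
  refine ⟨?_, ?_, ?_, ?_, ?_⟩
  · simp
  · grind
  · grind
  · grind
  · rintro y ⟨h1, h2, h3, h4⟩
    rw [if_neg h1, if_neg h2, if_neg h3, if_neg h4]

theorem attach_isSlide {e : D} (he : Inner σ t x e) (m : D → Pi1 g) :
    (attach σ ν t x e m).IsSlide e x (σ e) (ν (σ e)) (ν (ν (σ e))) := by
  have hn := hC.ne
  have hk := hC.inner_rev he
  have hc := hC.inner_next hk
  have hd := hC.inner_next hc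
  have r1 := hC.next_rev_ne e he
  have r2 := hC.next_rev_ne _ hk
  have r3 := hC.rev_rev e
  have r4 := hC.rev_ne e
  have q1 := hC.next_ne _ hk
  have q2 := hC.next_ne _ hc
  have q3 := hC.next_ne _ hd
  have q0 := hC.next_ne _ he
  have n1 := hC.next_next_next e
  have n2 := hC.next_next_next (σ e)
  obtain ⟨a1, a2, a3, a4, a5, a6, a7⟩ := hC.attach_next he m
  have d1 : ν (ν (σ e)) ≠ e := fun h => r2 (by rw [r3, ← n2, h])
  have d2 : ν (ν e) ≠ σ e := fun h => r1 (by rw [← h, n1])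
  refine ⟨a1, a2, a3, rfl, r3, a7 _ hk r4 ?_, a7 _ hc r1 ?_, (a7 _ hd d1 ?_).trans n2, ?_⟩
  · exact fun h => d2 h.symm
  · grind
  · grind
  · change [σ t, t, e, x, σ e, ν (σ e), ν (ν (σ e))].Nodup
    simp only [List.nodup_cons, List.mem_cons, List.not_mem_nil, or_false, not_or,
      not_false_eq_true, List.nodup_nil, and_true]
    obtain ⟨e1, e2, e3, e4⟩ := he
    obtain ⟨k1, k2, k3, k4⟩ := hk
    obtain ⟨c1, c2, c3, c4⟩ := hc
    obtain ⟨d1, d2, d3, d4⟩ := hd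
    grind

end IsClosed

/-- The renaming of edges when the tail passes the edge `e`. -/
def passPerm (σ : D → D) (x e : D) : Equiv.Perm D :=
  Equiv.swap e x * Equiv.swap x (σ e) * Equiv.swap (σ e) (σ x)

namespace IsClosed

variable {σ ν : D → D} {t x : D} (hC : IsClosed σ ν t x)

include hC

theorem passPerm_apply {e : D} (he : Inner σ t x e) :
    passPerm σ x e e = x ∧ passPerm σ x e x = σ e ∧ passPerm σ x e (σ e) = σ x ∧
    passPerm σ x e (σ x) = e ∧
    ∀ y, y ≠ e → y ≠ x → y ≠ σ e → y ≠ σ x → passPerm σ x e y = y := by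
  have hn := hC.ne
  have hk := hC.inner_rev he
  have r4 := hC.rev_ne e
  obtain ⟨e1, e2, e3, e4⟩ := he
  obtain ⟨k1, k2, k3, k4⟩ := hk
  simp only [passPerm, Equiv.Perm.mul_apply, Equiv.swap_apply_def]
  refine ⟨?_, ?_, ?_, ?_, ?_⟩ <;> grind

/-- After the slide the tail sits at `ν(σ e)`, and the two halves of the edge `e` exchange roles.
The four-cycle `e → x → σ e → σ x → e` restores the naming convention that `x` is the far half of
the edge carrying the tail. -/
theorem moveRight_attach {e : D} (he : Inner σ t x e) (m : D → Pi1 g)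
    (hm : m (σ e) = (m e)⁻¹) :
    (attach σ ν t x e m).moveRight.Iso (attach σ ν t x (ν (σ e)) (passMark σ e m)) := by
  have hs := hC.attach_isSlide he m
  have hn := hC.ne
  have hk := hC.inner_rev he
  have hc := hC.inner_next hk
  have hd := hC.inner_next hc
  have r3 := hC.rev_rev
  have r4 := hC.rev_ne e
  have hx := hC.next_next_next
  obtain ⟨f1, f2, f3, f4, f5⟩ := hC.passPerm_apply he
  obtain ⟨n1, n2, n3, n4, n5, n6, n7⟩ := hs.moveRight_next
  obtain ⟨m1, m2, m3⟩ := hs.moveRight_mark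
  obtain ⟨a1, a2, a3, a4, a5, a6, a7⟩ := hC.attach_next he m
  obtain ⟨b1, b2, b3, b4, b5, b6, b7⟩ := hC.attach_next hc (passMark σ e m)
  obtain ⟨p1, p2, p3, p4, p5⟩ := hC.attach_mark e m
  obtain ⟨q1, q2, q3, q4, q5⟩ := hC.attach_mark (ν (σ e)) (passMark σ e m)
  have hne := hs.ne
  have hN := hC.inner_next he
  have hNN := hC.inner_next hN
  have i0 : Function.Injective ν := fun y z h => by rw [← hx y, h, hx]
  have w1 := hC.next_ne _ he
  have w2 := hC.next_ne _ hN
  have w3 := hC.next_ne _ hNN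
  have w4 := hC.next_ne _ hk
  have ft : passPerm σ x e t = t := f5 t he.1.symm hn.2.1 hk.1.symm hn.2.2.1
  have fst : passPerm σ x e (σ t) = σ t :=
    f5 _ he.2.1.symm hn.2.2.2.1.symm hk.2.1.symm hn.2.2.2.2.2
  change (_ ∧ _ ∧ _ ∧ _ ∧ _ ∧ _) ∧ (_ ∧ _ ∧ _ ∧ _ ∧ _) ∧ (_ ∧ _ ∧ _ ∧ _) ∧ (_ ∧ _ ∧ _) ∧
    (_ ∧ _) ∧ _ at hne
  obtain ⟨⟨u1, u2, u3, u4, u5, u6⟩, ⟨u7, u8, u9, u10, u11⟩, ⟨u12, u13, u14, u15⟩,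
    ⟨u16, u17, u18⟩, ⟨u19, u20⟩, u21⟩ := hne
  have fc := f5 _ (Ne.symm u14) (Ne.symm u17) (Ne.symm u19) hc.2.2.2
  have fd := f5 _ (Ne.symm u15) (Ne.symm u18) (Ne.symm u20) hd.2.2.2
  have w5 : ν e ≠ σ e := fun h => hC.next_rev_ne _ hk (by rw [r3, h])
  have hw := hC.next_ne _ hc
  refine ⟨passPerm σ x e, fun y => ?_, fun y => ?_, ft, fun y => ?_⟩
  · by_cases hy : Away (attach σ ν t x e m) e x (σ e) (ν (σ e)) (ν (ν (σ e))) y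
    · rw [n7 y hy]
      obtain ⟨y1, y2, y3, y4, y5, y6⟩ := hy
      change y ≠ t at y1
      by_cases z1 : y = σ t
      · rw [z1, a4, fst, b4]
      by_cases z2 : y = σ x
      · rw [z2, a5, f4, b7 e he u14 (by rw [hx]; exact u13), f5 _ w1 hN.2.2.1 w5 hN.2.2.2]
      have hy : Inner σ t x y := ⟨y1, z1, y3, z2⟩
      have hB := b7 y hy y5 (by rwa [hx])
      rw [f5 y y2 y3 y4 z2, hB]
      by_cases z3 : y = ν (ν e)
      · rw [z3, a6, f4, hx]
      · have hv := hC.inner_next hy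
        rw [a7 y hy y2 z3, f5 _ (fun h => z3 (by rw [← hx y, h])) hv.2.2.1
          (fun h => y6 (by rw [← hx y, h])) hv.2.2.2]
    · have hy' : y = t ∨ y = e ∨ y = x ∨ y = σ e ∨ y = ν (σ e) ∨ y = ν (ν (σ e)) := by
        by_contra h
        simp only [not_or] at h
        exact hy h
      rcases hy' with rfl | rfl | rfl | rfl | rfl | rfl
      · exact (congrArg _ n1).trans (by rw [fc, ft, b1])
      · exact (congrArg _ n2).trans (by rw [f1, b3]; exact ft)
      · rw [n3, f3, f2]
        rw [hx] at b6
        exact b6.symm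
      · rw [n4, fd, f3, b5]
      · rw [n5, f1, fc, b2]
      · rw [n6, f2, fd, b7 _ hd hw (by rw [hx]; exact Ne.symm u20), hx]
  · change passPerm σ x e (σ y) = σ (passPerm σ x e y)
    by_cases z1 : y = e
    · rw [z1, f3, f1]
    by_cases z2 : y = x
    · rw [z2, f4, f2, r3]
    by_cases z3 : y = σ e
    · rw [z3, r3, f1, f3, r3]
    by_cases z4 : y = σ x
    · rw [z4, r3, f2, f4]
    have i1 : Function.Injective σ := fun y z h => by rw [← r3 y, h, r3]
    rw [f5 y z1 z2 z3 z4, f5 _ (fun h => z3 (by rw [← r3 y, h])) (fun h => z4 (by rw [← r3 y, h]))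
      (i1.ne z1) (i1.ne z2)]
  · have pe : passMark σ e m e = (boundary g)⁻¹ * m e := if_pos rfl
    have pk : passMark σ e m (σ e) = m (σ e) * boundary g := (if_neg r4).trans (if_pos rfl)
    have po (y : D) (h1 : y ≠ e) (h2 : y ≠ σ e) : passMark σ e m y = m y :=
      (if_neg h1).trans (if_neg h2)
    have pc := po _ (Ne.symm u14) (Ne.symm u19)
    change (attach σ ν t x e m).moveRight.mark y = _
    by_cases z1 : y = e
    · rw [z1, m1, f1, q3, pc, p5 _ hc]
      change ((attach σ ν t x e m).mark t * _)⁻¹ = _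
      rw [p1]; group
    by_cases z3 : y = σ e
    · rw [z3, m2, f3, q4, pc, p5 _ hc]
      change (attach σ ν t x e m).mark t * _ = _
      rw [p1]
    rw [m3 y z1 z3]
    by_cases z2 : y = x
    · rw [z2, p3, f2, q5 _ hk, pk, hm]
    by_cases z4 : y = σ x
    · rw [z4, p4, f4, q5 _ he, pe]
    rw [f5 y z1 z2 z3 z4]
    by_cases y1 : y = t
    · rw [y1, p1, q1]
    by_cases y2 : y = σ t
    · rw [y2, p2, q2]
    rw [p5 y ⟨y1, y2, z2, z4⟩, q5 y ⟨y1, y2, z2, z4⟩, po y z1 z3]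

end IsClosed

end Fatgraph

namespace Fatgraph

variable {D : Type}

/-! ### Moving the tail once around the fatgraph -/

/-- The step along the edges of the closed fatgraph which the tail passes. -/
def passStep (σ ν : D → D) (y : D) : D := ν (σ y)

namespace IsClosed

variable {σ ν : D → D} {t x : D} (hC : IsClosed σ ν t x)

include hC

theorem passStep_injective : Function.Injective (passStep σ ν) := fun y z h => by
  rw [← hC.rev_rev y, ← hC.next_next_next (σ y)]
  change σ (ν (ν (passStep σ ν y))) = z
  rw [h, passStep, hC.next_next_next, hC.rev_rev]

theorem inner_iterate {e : D} (he : Inner σ t x e) (n : ℕ) :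
    Inner σ t x ((passStep σ ν)^[n] e) := by
  induction n with
  | zero => exact he
  | succ n ih =>
    rw [Function.iterate_succ_apply']
    exact hC.inner_next (hC.inner_rev ih)

end IsClosed

variable [DecidableEq D]

/-- The marking of the closed fatgraph when the tail has passed `n` edges, starting from `e`. -/
def tourMark (σ ν : D → D) (e : D) (m : D → Pi1 g) : ℕ → D → Pi1 g
  | 0 => m
  | n + 1 => passMark σ ((passStep σ ν)^[n] e) (tourMark σ ν e m n)

/-- The number of times that the tail passes `y` in the first `n` steps. -/
def passCount (σ ν : D → D) (e : D) (n : ℕ) (y : D) : ℕ :=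
  ((Finset.range n).filter fun j => (passStep σ ν)^[j] e = y).card

theorem passCount_succ (σ ν : D → D) (e : D) (n : ℕ) (y : D) : passCount σ ν e (n + 1) y =
    passCount σ ν e n y + if (passStep σ ν)^[n] e = y then 1 else 0 := by
  rw [passCount, Finset.range_add_one, Finset.filter_insert]
  split_ifs
  · rw [Finset.card_insert_of_notMem (by simp), passCount]
  · rfl

namespace IsClosed

variable {σ ν : D → D} {t x : D} (hC : IsClosed σ ν t x)

include hC

/-- Each passage of `y` puts `∂⁻¹` on the left, and each passage of its reverse puts `∂` on the
right. The two sides do not interact, so only the counts matter. -/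
theorem tourMark_eq (e : D) (m : D → Pi1 g) (n : ℕ) (y : D) : tourMark σ ν e m n y =
    (boundary g)⁻¹ ^ passCount σ ν e n y * m y * boundary g ^ passCount σ ν e n (σ y) := by
  induction n generalizing y with
  | zero => simp [tourMark, passCount]
  | succ n ih =>
    rw [passCount_succ, passCount_succ, tourMark, passMark]
    by_cases h1 : y = (passStep σ ν)^[n] e
    · rw [if_pos h1, if_pos h1.symm, if_neg (fun h => hC.rev_ne y (h.symm.trans h1.symm)), ← h1, ih, add_zero,
        pow_succ']
      simp only [mul_assoc]
    have h3 : (passStep σ ν)^[n] e = σ y ↔ y = σ ((passStep σ ν)^[n] e) :=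
      ⟨fun h => by rw [h, hC.rev_rev], fun h => by rw [h, hC.rev_rev]⟩
    rw [if_neg h1, if_neg (Ne.symm h1), if_congr h3 rfl rfl]
    by_cases h2 : y = σ ((passStep σ ν)^[n] e)
    · rw [if_pos h2, if_pos h2, ← h2, ih, add_zero, pow_succ]
      simp only [mul_assoc]
    · rw [if_neg h2, if_neg h2, ih, add_zero, add_zero]

theorem tourMark_rev (e : D) {m : D → Pi1 g} (hm : ∀ y, m (σ y) = (m y)⁻¹) (n : ℕ) (y : D) :
    tourMark σ ν e m n (σ y) = (tourMark σ ν e m n y)⁻¹ := by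
  rw [hC.tourMark_eq, hC.tourMark_eq, hC.rev_rev, hm, mul_inv_rev, mul_inv_rev, inv_pow, inv_pow,
    inv_inv, mul_assoc]

theorem moveRight_iterate_attach {e : D} (he : Inner σ t x e) {m : D → Pi1 g}
    (hm : ∀ y, m (σ y) = (m y)⁻¹) (n : ℕ) :
    (Fatgraph.moveRight^[n] (attach σ ν t x e m)).Iso
      (attach σ ν t x ((passStep σ ν)^[n] e) (tourMark σ ν e m n)) := by
  induction n with
  | zero => exact Iso.refl _
  | succ n ih =>
    rw [Function.iterate_succ_apply', Function.iterate_succ_apply']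
    exact ih.moveRight.trans (hC.moveRight_attach (hC.inner_iterate he n) _
      (hC.tourMark_rev e hm n _))

variable [Finite D] {e : D} (hR : ∀ y, Inner σ t x y → ∃ n, (passStep σ ν)^[n] e = y)

include hR

/-- The orbit of `e` is the set of all inner oriented edges, that is, all but the two orientations
of the tail and of `x`. -/
theorem minimalPeriod_add_four (he : Inner σ t x e) :
    Function.minimalPeriod (passStep σ ν) e + 4 = Nat.card D := by
  have : Fintype D := Fintype.ofFinite D
  have hp : e ∈ Function.periodicPts (passStep σ ν) := hC.passStep_injective.mem_periodicPts e
  have hpos := Function.minimalPeriod_pos_of_mem_periodicPts hp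
  have h1 : ((Finset.range (Function.minimalPeriod (passStep σ ν) e)).image
      fun j => (passStep σ ν)^[j] e) = ({t, σ t, x, σ x} : Finset D)ᶜ := by
    ext y
    have hy : y ∈ ({t, σ t, x, σ x} : Finset D)ᶜ ↔ Inner σ t x y := by simp [Inner]
    rw [hy, Finset.mem_image]
    constructor
    · rintro ⟨j, -, rfl⟩
      exact hC.inner_iterate he j
    · intro h
      obtain ⟨n, rfl⟩ := hR y h
      exact ⟨_, Finset.mem_range.2 (Nat.mod_lt n hpos), Function.iterate_mod_minimalPeriod_eq⟩
  have h2 := congrArg Finset.card h1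
  have h4 : ({t, σ t, x, σ x} : Finset D).card = 4 := by
    obtain ⟨a1, a2, a3, a4, a5, a6⟩ := hC.ne
    rw [Finset.card_insert_of_notMem (by simp [a1, a2, a3]),
      Finset.card_insert_of_notMem (by simp [a4.symm, a6]),
      Finset.card_insert_of_notMem (by simp [a5]), Finset.card_singleton]
  have h5 := Finset.card_le_univ ({t, σ t, x, σ x} : Finset D)
  rw [Finset.card_image_of_injOn (by
    rw [Finset.coe_range]; exact Function.iterate_injOn_Iio_minimalPeriod), Finset.card_range,
    Finset.card_compl, h4] at h2
  rw [Nat.card_eq_fintype_card]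
  omega

theorem passCount_minimalPeriod {y : D} (hy : Inner σ t x y) :
    passCount σ ν e (Function.minimalPeriod (passStep σ ν) e) y = 1 := by
  have hp : e ∈ Function.periodicPts (passStep σ ν) := hC.passStep_injective.mem_periodicPts e
  have hpos := Function.minimalPeriod_pos_of_mem_periodicPts hp
  obtain ⟨n, rfl⟩ := hR y hy
  refine Finset.card_eq_one.2 ⟨n % Function.minimalPeriod (passStep σ ν) e, ?_⟩
  ext j
  rw [Finset.mem_filter, Finset.mem_range, Finset.mem_singleton]
  constructor
  · rintro ⟨h1, h2⟩
    exact Function.iterate_injOn_Iio_minimalPeriod h1 (Nat.mod_lt n hpos)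
      (h2.trans Function.iterate_mod_minimalPeriod_eq.symm)
  · rintro rfl
    exact ⟨Nat.mod_lt n hpos, Function.iterate_mod_minimalPeriod_eq⟩

/-- One period passes every inner oriented edge once and returns the tail to `e`, so each inner
marking is conjugated by `∂`. The markings involving the tail follow, because `∂` commutes with
itself. -/
theorem moveRight_iterate_iso_act (he : Inner σ t x e) {m : D → Pi1 g} (hm : ∀ y, m (σ y) = (m y)⁻¹) :
    (Fatgraph.moveRight^[Nat.card D - 4] (attach σ ν t x e m)).Iso
      ((attach σ ν t x e m).act (boundaryTwist g)) := by
  have hN : Nat.card D - 4 = Function.minimalPeriod (passStep σ ν) e := by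
    rw [← hC.minimalPeriod_add_four hR he, Nat.add_sub_cancel]
  have h := hC.moveRight_iterate_attach he hm (Nat.card D - 4)
  have hT (y : D) (hy : Inner σ t x y) : tourMark σ ν e m (Nat.card D - 4) y =
      (boundary g)⁻¹ * m y * boundary g := by
    rw [hN, hC.tourMark_eq, hC.passCount_minimalPeriod hR hy,
      hC.passCount_minimalPeriod hR (hC.inner_rev hy), pow_one, pow_one]
  have key : attach σ ν t x e (tourMark σ ν e m (Nat.card D - 4)) =
      (attach σ ν t x e m).act (boundaryTwist g) := by
    refine Fatgraph.ext rfl rfl rfl (funext fun y => ?_)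
    simp only [act, attach, boundaryTwist_apply, hT e he]
    split_ifs with h1 h2 h3 h4
    · group
    · group
    · group
    · group
    · exact hT y ⟨h1, h2, h3, h4⟩
  rw [← key]
  have hper : (passStep σ ν)^[Nat.card D - 4] e = e := by
    rw [hN]; exact Function.iterate_minimalPeriod
  rwa [hper] at h

end IsClosed

/-! ### Closing a bordered fatgraph -/

/-- The cyclic order of the closed fatgraph obtained by erasing the tail. -/
def closedNext (G : Fatgraph g D) (y : D) : D :=
  if y = G.tail ∨ y = G.rev G.tail ∨ y = G.next G.rightEdge ∨ y = G.rev (G.next G.rightEdge) then y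
  else if y = G.rightEdge then G.next (G.rev (G.next G.rightEdge))
  else if G.next y = G.rev (G.next G.rightEdge) then G.rightEdge else G.next y

namespace IsMarkedTrivalent

variable {G : Fatgraph g D} (hG : G.IsMarkedTrivalent)

include hG

omit [DecidableEq D] in
theorem inner_rightEdge : Inner G.rev G.tail (G.next G.rightEdge) G.rightEdge := by
  have hn := hG.isSlide.ne
  refine ⟨Ne.symm hn.2.1.1, Ne.symm hn.1.2.1, hn.2.2.1.1, fun h => hn.2.2.2.1.1 ?_⟩
  exact (hG.rev_rev _).symm.trans (congrArg G.rev h.symm)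

/-- Erasing the tail merges `e` and `x`: the vertex `(x̄, a, b)` becomes `(e, a, b)`, and the other
inner vertices are untouched. -/
theorem closedNext_eq {t e x a b : D} (ht : G.tail = t) (he : G.rightEdge = e) (hx : G.next e = x)
    (ha : G.next (G.rev x) = a) (hb : G.next a = b) :
    G.closedNext e = a ∧ G.closedNext a = b ∧ G.closedNext b = e ∧
    (∀ y, Inner G.rev t x y → y ≠ e → y ≠ a → y ≠ b → G.closedNext y = G.next y ∧
      Inner G.rev t x (G.next y) ∧ G.next y ≠ e ∧ G.next y ≠ a ∧ G.next y ≠ b) ∧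
    (∀ y, ¬ Inner G.rev t x y → G.closedNext y = y) ∧
    Inner G.rev t x a ∧ Inner G.rev t x b ∧ a ≠ e ∧ b ≠ e ∧ b ≠ a ∧ G.next b = G.rev x := by
  have hi := hG.inner_rightEdge
  have hs : G.next (G.next G.rightEdge) = G.tail := hG.isSlide.next_x
  have hte : G.next G.tail = G.rightEdge := rfl
  have hne := hG.isSlide.ne.2.2.1.1
  have i := @next_injective _ _ _ hG
  have r := hG.rev_rev
  have u := hG.univalent
  have hu := hG.next_rev_tail
  have n3 := hG.next_next_next (G.rev x)
  have rt := hG.rev_ne t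
  have rx := hG.rev_ne x
  have hcl (y : D) : G.closedNext y = if y = t ∨ y = G.rev t ∨ y = x ∨ y = G.rev x then y
      else if y = e then a else if G.next y = G.rev x then e else G.next y := by
    rw [closedNext, ht, he, hx, ha]
  rw [ht, he, hx] at hi
  obtain ⟨hi1, hi2, hi3, hi4⟩ := id hi
  rw [he, hx, ht] at hs
  rw [ht, he] at hte
  rw [he, hx] at hne
  rw [ht] at hu u
  rw [ha, hb] at n3
  have hxt : x ≠ t := by grind
  have hxt' : x ≠ G.rev t := by grind
  have ia : Inner G.rev t x a := by refine ⟨?_, ?_, ?_, ?_⟩ <;> grind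
  have ib : Inner G.rev t x b := by
    obtain ⟨a1, a2, a3, a4⟩ := ia
    refine ⟨?_, ?_, ?_, ?_⟩ <;> grind
  have hae : a ≠ e := by grind
  have hbe : b ≠ e := by grind
  have hba : b ≠ a := by
    obtain ⟨a1, a2, a3, a4⟩ := ia
    intro h; grind
  refine ⟨?_, ?_, ?_, fun y hy h1 h2 h3 => ?_, fun y hy => ?_, ia, ib, hae, hbe, hba, n3⟩
  · rw [hcl, if_neg (by simpa [Inner] using hi), if_pos rfl]
  · rw [hcl, if_neg (by simpa [Inner] using ia), if_neg hae, if_neg (by rw [hb]; exact ib.2.2.2), hb]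
  · rw [hcl, if_neg (by simpa [Inner] using ib), if_neg hbe, if_pos n3]
  · have h4 : G.next y ≠ G.rev x := n3 ▸ i.ne h3
    refine ⟨?_, ⟨hs ▸ i.ne hy.2.2.1, hu ▸ i.ne hy.2.1, hx ▸ i.ne h1, h4⟩, hte ▸ i.ne hy.1,
      ha ▸ i.ne hy.2.2.2, hb ▸ i.ne h2⟩
    rw [hcl, if_neg (by simpa [Inner] using hy), if_neg h1, if_neg h4]
  · rw [hcl, if_pos]
    by_contra h
    simp only [not_or] at h
    exact hy h

end IsMarkedTrivalent

end Fatgraph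

namespace Fatgraph

variable {D : Type} [DecidableEq D]

namespace IsMarkedTrivalent

variable {G : Fatgraph g D} (hG : G.IsMarkedTrivalent)

include hG

theorem closedNext_closedNext_closedNext (y : D) :
    G.closedNext (G.closedNext (G.closedNext y)) = y := by
  obtain ⟨c1, c2, c3, c4, c5, -⟩ := hG.closedNext_eq rfl rfl rfl rfl rfl
  by_cases hy : Inner G.rev G.tail (G.next G.rightEdge) y
  · by_cases h1 : y = G.rightEdge
    · rw [h1, c1, c2, c3]
    by_cases h2 : y = G.next (G.rev (G.next G.rightEdge))
    · rw [h2, c2, c3, c1]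
    by_cases h3 : y = G.next (G.next (G.rev (G.next G.rightEdge)))
    · rw [h3, c3, c1, c2]
    obtain ⟨d1, d2, d3, d4, d5⟩ := c4 y hy h1 h2 h3
    obtain ⟨e1, e2, e3, e4, e5⟩ := c4 _ d2 d3 d4 d5
    rw [d1, e1, (c4 _ e2 e3 e4 e5).1, hG.next_next_next]
  · rw [c5 y hy, c5 y hy, c5 y hy]

/-- Up to reversal, the tour of the tail is the boundary cycle with the tail erased, so its
transitivity follows from the single boundary cycle. -/
theorem passStep_orbit {y : D} (hy : Inner G.rev G.tail (G.next G.rightEdge) y) :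
    ∃ n, (passStep G.rev G.closedNext)^[n] G.rightEdge = y := by
  obtain ⟨R, hR, h0, hs⟩ : ∃ R : D → Prop,
      (∀ y, R y → ∃ n, (passStep G.rev G.closedNext)^[n] G.rightEdge = y) ∧
      R G.rightEdge ∧ ∀ y, R (G.rev y) → R (G.closedNext y) :=
    ⟨fun y => ∃ n : ℕ, (passStep G.rev G.closedNext)^[n] G.rightEdge = y, fun _ => id, ⟨0, rfl⟩,
      fun y hy => by
        obtain ⟨n, hn⟩ := hy
        refine ⟨n + 1, ?_⟩
        rw [Function.iterate_succ_apply', hn, passStep, hG.rev_rev]⟩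
  apply hR
  obtain ⟨c1, c2, c3, c4, c5, c6, c7, c8, c9, c10, c11⟩ := hG.closedNext_eq rfl rfl rfl rfl rfl
  have hi := hG.inner_rightEdge
  have hte : G.next G.tail = G.rightEdge := rfl
  have r := hG.rev_rev
  have i := @next_injective _ _ _ hG
  have j := @rev_injective _ _ _ hG
  have hxt : G.next (G.next G.rightEdge) = G.tail := hG.isSlide.next_x
  have inner_rev {y : D} (hy : Inner G.rev G.tail (G.next G.rightEdge) y) :
      Inner G.rev G.tail (G.next G.rightEdge) (G.rev y) :=
    ⟨fun h => hy.2.1 (by rw [← h, r]), j.ne hy.1, fun h => hy.2.2.2 (by rw [← h, r]),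
      j.ne hy.2.2.1⟩
  have inner_rev' {y : D} (hy : Inner G.rev G.tail (G.next G.rightEdge) (G.rev y)) :
      Inner G.rev G.tail (G.next G.rightEdge) y := r y ▸ inner_rev hy
  have not_inner_t : ¬ Inner G.rev G.tail (G.next G.rightEdge) G.tail := fun h => h.1 rfl
  have ht := hG.isSlide.ne
  have rx := hG.rev_ne (G.next G.rightEdge)
  have txr : G.rev G.tail ≠ G.rev (G.next G.rightEdge) := j.ne ht.2.1.2.1
  have trx : G.tail ≠ G.rev (G.next G.rightEdge) := fun h => ht.1.2.2.1 (by rw [h, r])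
  -- The boundary cycle runs along the merged edge in two pieces; at `x̄`, which is not inner, the
  -- fact recorded is that `ē` was reached.
  have key := hG.forall_of_bdry (C := fun y =>
    (Inner G.rev G.tail (G.next G.rightEdge) y → R (G.rev y)) ∧
    (y = G.rev (G.next G.rightEdge) → R (G.rev G.rightEdge)))
    ⟨fun h => absurd h not_inner_t, fun h => absurd h trx⟩ (fun y hy => by
      by_cases h1 : y = G.tail
      · rw [h1, bdry, hte]
        exact ⟨fun _ => by rwa [r], fun h => absurd (j h) ht.2.2.1.1⟩
      by_cases h2 : y = G.rev G.tail
      · rw [h2, bdry, hG.next_rev_tail, r]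
        exact ⟨fun h => absurd h not_inner_t, fun h => absurd h trx⟩
      by_cases h3 : y = G.next G.rightEdge
      · rw [h3, bdry, hxt]
        exact ⟨fun h => absurd h (fun h => h.2.1 rfl), fun h => absurd h txr⟩
      by_cases h4 : y = G.rev (G.next G.rightEdge)
      · rw [h4, bdry, r, ← c1]
        refine ⟨fun _ => hs _ (hy.2 h4), fun h => absurd (j h) ?_⟩
        rw [c1]
        exact c6.2.2.1
      have hyi : Inner G.rev G.tail (G.next G.rightEdge) y := ⟨h1, h2, h3, h4⟩
      by_cases h5 : y = G.rightEdge
      · rw [h5, bdry]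
        exact ⟨fun h => absurd rfl h.2.2.2, fun _ => h5 ▸ hy.1 hyi⟩
      by_cases h6 : y = G.next (G.next (G.rev (G.next G.rightEdge)))
      · rw [h6, bdry, c11, r]
        exact ⟨fun h => absurd rfl h.2.2.1, fun h => absurd h.symm rx⟩
      have h7 : G.closedNext y = G.next y := by
        by_cases h : y = G.next (G.rev (G.next G.rightEdge))
        · rw [h, c2]
        · exact (c4 y hyi h5 h h6).1
      rw [bdry, r, ← h7]
      refine ⟨fun _ => hs _ (hy.1 hyi), fun h => absurd (i (h7 ▸ j h)) h5⟩)
  have := (key (G.rev y)).1 (inner_rev hy)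
  rwa [r] at this

theorem isClosed_closedNext :
    IsClosed G.rev G.closedNext G.tail (G.next G.rightEdge) := by
  obtain ⟨c1, c2, c3, c4, c5, c6, c7, c8, c9, c10, c11⟩ := hG.closedNext_eq rfl rfl rfl rfl rfl
  have ht := hG.isSlide.ne
  have n3 := hG.closedNext_closedNext_closedNext
  refine ⟨hG.rev_rev, hG.rev_ne, n3, c5 _ fun h => h.1 rfl, c5 _ fun h => h.2.1 rfl,
    c5 _ fun h => h.2.2.1 rfl, c5 _ fun h => h.2.2.2 rfl, Ne.symm ht.2.1.2.1,
    Ne.symm ht.1.2.2.1, fun y hy => ?_, fun y hy hf => ?_⟩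
  · by_cases h1 : y = G.rightEdge
    · rw [h1, c1]; exact c8
    by_cases h2 : y = G.next (G.rev (G.next G.rightEdge))
    · rw [h2, c2]; exact c10
    by_cases h3 : y = G.next (G.next (G.rev (G.next G.rightEdge)))
    · rw [h3, c3]; exact Ne.symm c9
    rw [(c4 y hy h1 h2 h3).1]
    exact fun h => hy.2.1 ((hG.univalent y).1 h)
  · have inj : Function.Injective (passStep G.rev G.closedNext) := fun y z h => by
      rw [← hG.rev_rev y, ← n3 (G.rev y)]
      change G.rev (G.closedNext (G.closedNext (passStep G.rev G.closedNext y))) = z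
      rw [h, passStep, n3, hG.rev_rev]
    obtain ⟨n, rfl⟩ := hG.passStep_orbit hy
    -- By injectivity a fixed point in the orbit of the right edge would fix the right edge itself,
    -- and its reverse could not be reached.
    have h1 : passStep G.rev G.closedNext G.rightEdge = G.rightEdge := by
      refine inj.iterate n ?_
      rw [← Function.iterate_succ_apply, Function.iterate_succ_apply']
      exact hf
    have hk : Inner G.rev G.tail (G.next G.rightEdge) (G.rev G.rightEdge) := by
      obtain ⟨h1, h2, h3, h4⟩ := hG.inner_rightEdge
      refine ⟨fun h => h2 (by rw [← h, hG.rev_rev]), hG.rev_injective.ne h1,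
        fun h => h4 (by rw [← h, hG.rev_rev]), hG.rev_injective.ne h3⟩
    obtain ⟨m, hm⟩ := hG.passStep_orbit hk
    rw [Function.iterate_fixed h1] at hm
    exact hG.rev_ne _ hm.symm

omit [DecidableEq D] in
theorem mark_rev (y : D) : G.mark (G.rev y) = (G.mark y)⁻¹ :=
  eq_inv_of_mul_eq_one_left (hG.orientation y)

theorem attach_closedNext :
    attach G.rev G.closedNext G.tail (G.next G.rightEdge) G.rightEdge G.mark = G := by
  obtain ⟨c1, c2, c3, c4, c5, c6, c7, c8, c9, c10, c11⟩ := hG.closedNext_eq rfl rfl rfl rfl rfl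
  have hxt : G.next (G.next G.rightEdge) = G.tail := hG.isSlide.next_x
  have n3 := hG.closedNext_closedNext_closedNext
  have hm : G.mark G.tail = (boundary g)⁻¹ := by
    rw [← hG.geometric, hG.mark_rev, inv_inv]
  have hv := hG.vertex G.rightEdge (Ne.symm hG.isSlide.ne.2.2.1.1)
  rw [hxt, hm] at hv
  have hx : G.mark (G.next G.rightEdge) = (G.mark G.rightEdge)⁻¹ * boundary g := by
    rw [eq_inv_mul_iff_mul_eq]
    exact mul_inv_eq_one.1 hv
  refine Fatgraph.ext (funext fun y => ?_) rfl rfl (funext fun y => ?_)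
  · simp only [attach]
    split_ifs with h1 h2 h3 h4 h5 h6
    · rw [h1]; rfl
    · rw [h2]
    · rw [h3, hxt]
    · rw [h4, hG.next_rev_tail]
    · rw [h5, c1]
    · rw [← c11, ← c2, ← c1, ← h6, n3]
    · by_cases h : y = G.next (G.rev (G.next G.rightEdge))
      · rw [h, c2]
      · exact (c4 y ⟨h1, h4, h3, h5⟩ h2 h (fun h => h6 (by rw [h, c3]))).1
  · simp only [attach]
    split_ifs with h1 h2 h3 h4
    · rw [h1, hm]
    · rw [h2, hG.geometric]
    · rw [h3, hx]
    · rw [h4, hG.mark_rev, hx, mul_inv_rev, inv_inv]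
    · rfl

/-- Moving the tail once around a fatgraph represents the boundary twist. -/
theorem moveRight_iterate_iso_act :
    (Fatgraph.moveRight^[12 * g - 6] G).Iso (G.act (boundaryTwist g)) := by
  have hD := hG.genus
  have hg : g ≠ 0 := by rintro rfl; omega
  have : Finite D := Nat.finite_of_card_ne_zero (by omega)
  have h := hG.isClosed_closedNext.moveRight_iterate_iso_act (fun y => hG.passStep_orbit)
    hG.inner_rightEdge hG.mark_rev
  rwa [hG.attach_closedNext, show Nat.card D - 4 = 12 * g - 6 by omega] at h

end IsMarkedTrivalent

end Fatgraph

/-! ### Naturality of the expansion under mapping classes -/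

namespace Fatgraph

/-- `ℓ` depends on homology classes only, which `φ` preserves. The edges of `G` and of `φ(G)`
therefore have the same logarithms, and precomposing with `φ` adjusts the markings. -/
theorem IsFatgraphMagnus.compAut {D D' : Type} {G : Fatgraph g D} {G' : Fatgraph g D'}
    {φ : MulAut (Pi1 g)} {θ : MagnusExpansion g} (hθ : G'.IsFatgraphMagnus θ)
    (h : G'.Iso (G.act φ)) (hφ : ∀ x, cls (φ x) = cls x) :
    G.IsFatgraphMagnus (θ.compAut φ hφ) := by
  obtain ⟨f, h1, h2, h3, h4⟩ := h
  intro x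
  have hx : φ (G.mark x) = G'.mark (f.symm x) := by
    rw [h4, Equiv.apply_symm_apply]; rfl
  have hl (n : ℕ) : G'.ell n (f.symm x) = G.ell n x := by
    rw [← ell_eq_of_equiv (G' := G) f h1 h2 h3 (fun e => by rw [h4]; exact hφ _) n (f.symm x),
      Equiv.apply_symm_apply]
  change (θ.toMonoidHom (φ (G.mark x)) : PowerSeries (T g)) = _
  rw [hx, hθ (f.symm x)]
  simp only [hl]

end Fatgraph

/-! ### The sequence of moves -/

theorem tailSequence_succ (hg : 0 < g) (i : ℕ) :
    tailSequence g hg (i + 1) = (tailSequence g hg i).moveRight :=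
  Function.iterate_succ_apply' _ _ _

theorem tailSequence_isMarkedTrivalent (hg : 0 < g) (i : ℕ) :
    (tailSequence g hg i).IsMarkedTrivalent := by
  induction i with
  | zero => exact sympFatgraph_isMarkedTrivalent hg
  | succ i ih => rw [tailSequence_succ]; exact ih.moveRight

theorem tailSequence_isPresentation (hg : 0 < g) (i : ℕ) :
    (tailSequence g hg i).IsPresentation := by
  induction i with
  | zero => exact sympFatgraph_isPresentation hg
  | succ i ih =>
    rw [tailSequence_succ]
    exact Fatgraph.IsPresentation.moveRight (tailSequence_isMarkedTrivalent hg i) ih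

theorem tailSequence_iso (hg : 0 < g) :
    (tailSequence g hg (12 * g - 6)).Iso ((sympFatgraph g hg).act (boundaryTwist g)) :=
  (sympFatgraph_isMarkedTrivalent hg).moveRight_iterate_iso_act

theorem tailSequence_existsUnique_isFatgraphMagnus (hg : 0 < g) (i : ℕ) :
    ∃! θ : MagnusExpansion g, (tailSequence g hg i).IsFatgraphMagnus θ :=
  (tailSequence_isMarkedTrivalent hg i).existsUnique_isFatgraphMagnus
    (tailSequence_isPresentation hg i)

section

variable {hg : 0 < g} {i : ℕ} {θ θ' : MagnusExpansion g} {U : IA g}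
  (hθ : (tailSequence g hg i).IsFatgraphMagnus θ)
  (hθ' : (tailSequence g hg (i + 1)).IsFatgraphMagnus θ') (hU : IsFatgraphJohnson θ θ' U)

include hθ hθ' hU

theorem tailSequence_hom_one : U.hom 1 = 0 := by
  rw [tailSequence_succ] at hθ'
  have hG := tailSequence_isMarkedTrivalent hg i
  exact hG.isSlide.hom_one_eq_zero hG hθ hθ' hU

theorem tailSequence_tau_one : U.tau 1 = 0 := by
  rw [IA.tau, tailSequence_hom_one hθ hθ' hU, map_zero]

theorem tailSequence_tau_two_mem : U.tau 2 ∈ HL3 g := by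
  rw [tailSequence_succ] at hθ'
  have hG := tailSequence_isMarkedTrivalent hg i
  exact poincare_symm_mem_HL3 (hG.isSlide.hom_two_mem hG hθ hθ' hU)

end

/-- Because `τ₁` vanishes for every move, each summand is the drop of the degree three part from one
expansion to the next. The sum telescopes to `θ₀ - θ_N`, and uniqueness of the expansion of `G₀`
gives `θ₀ = θ_N ∘ T_∂`. -/
theorem sum_tau_two (hg : 0 < g) {θ : ℕ → MagnusExpansion g}
    (hθ : ∀ i ≤ 12 * g - 6, (tailSequence g hg i).IsFatgraphMagnus (θ i)) {U : ℕ → IA g}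
    (hU : ∀ i < 12 * g - 6, IsFatgraphJohnson (θ i) (θ (i + 1)) (U i)) :
    ∑ i ∈ Finset.range (12 * g - 6), (U i).tau 2 = tensorSq (omega g) := by
  have h0 : (θ (12 * g - 6)).compAut (boundaryTwist g) cls_boundaryTwist = θ 0 :=
    (tailSequence_existsUnique_isFatgraphMagnus hg 0).unique
      ((hθ _ le_rfl).compAut (tailSequence_iso hg) cls_boundaryTwist) (hθ 0 (Nat.zero_le _))
  apply poincare.injective
  refine linearMap_ext_cls fun x => ?_
  rw [map_sum, LinearMap.sum_apply]
  have hi (i : ℕ) (h : i ∈ Finset.range (12 * g - 6)) : poincare ((U i).tau 2) (cls x) =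
      comp 3 ((θ i).toMonoidHom x) - comp 3 ((θ (i + 1)).toMonoidHom x) := by
    have h := Finset.mem_range.1 h
    rw [IA.tau, LinearEquiv.apply_symm_apply]
    exact (hU i h).hom_two (tailSequence_hom_one (hθ i h.le) (hθ _ h) (hU i h)) x
  rw [Finset.sum_congr rfl hi, Finset.sum_range_sub' fun i => comp 3 ((θ i).toMonoidHom x),
    ← h0, sub_eq_iff_eq_add']
  exact (θ _).comp_three_boundaryTwist x

end FatgraphJohnson

/-! ### The main theorem -/

open FatgraphJohnson

theorem mainTheorem10 (g : ℕ) (hg : 0 < g) :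
    -- the formula for `ω^{⊗ 2}`
    (tensorSq (omega g) =
        ∑ i : Fin g, (1 / 2 : ℚ) • arrow (wedge (uH i) (vH i)) (omega g) ∧
      tensorSq (omega g) =
        ∑ i : Fin g, (uH i ⊗ₜ[ℚ] ⁅inc (vH i), toT (omega g)⁆
          - vH i ⊗ₜ[ℚ] ⁅inc (uH i), toT (omega g)⁆)) ∧
    -- the values of the Johnson homomorphism, and of its symmetrization, at the boundary twist
    IsJohnson 2 (boundaryTwist g) (tensorSq (omega g)) ∧
    (∀ θ : MagnusExpansion g,
      (∃! U : IA g, IsTotalJohnson θ (boundaryTwist g) U) ∧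
      ∀ U : IA g, IsTotalJohnson θ (boundaryTwist g) U →
        U.tau 1 = 0 ∧ U.tau 2 = tensorSq (omega g) ∧ U.tau 2 ∈ HL3 g ∧
          bar (U.tau 2) = tensorSq (omega g)) ∧
    -- moving the tail to the right around `G₀` is a sequence of Whitehead moves of marked
    -- trivalent fatgraphs, which represents the boundary twist
    (∀ i ≤ 12 * g - 6, (tailSequence g hg i).IsMarkedTrivalent) ∧
    (∀ i < 12 * g - 6, (tailSequence g hg i).CanMove (tailSequence g hg i).rightEdge) ∧
    (tailSequence g hg (12 * g - 6)).Iso ((sympFatgraph g hg).act (boundaryTwist g)) ∧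
    -- the fatgraph Magnus expansions and the fatgraph Johnson maps along this sequence
    (∀ i ≤ 12 * g - 6, ∃! θ : MagnusExpansion g, (tailSequence g hg i).IsFatgraphMagnus θ) ∧
    ∀ θ : ℕ → MagnusExpansion g,
      (∀ i ≤ 12 * g - 6, (tailSequence g hg i).IsFatgraphMagnus (θ i)) →
      (∀ i < 12 * g - 6, ∃! U : IA g, IsFatgraphJohnson (θ i) (θ (i + 1)) U) ∧
      ∀ U : ℕ → IA g,
        (∀ i < 12 * g - 6, IsFatgraphJohnson (θ i) (θ (i + 1)) (U i)) →
        (∀ i < 12 * g - 6, (U i).tau 1 = 0 ∧ (U i).tau 2 ∈ HL3 g) ∧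
        ∑ i ∈ Finset.range (12 * g - 6), (U i).tau 2 = tensorSq (omega g) ∧
        ∑ i ∈ Finset.range (12 * g - 6), bar ((U i).tau 2) = tensorSq (omega g) := by
  refine ⟨⟨sum_half_arrow_omega.symm, tensorSq_omega⟩, isJohnson_boundaryTwist, fun θ => ⟨?_, ?_⟩,
    fun i _ => tailSequence_isMarkedTrivalent hg i,
    fun i _ => (tailSequence_isMarkedTrivalent hg i).canMove, tailSequence_iso hg,
    fun i _ => tailSequence_existsUnique_isFatgraphMagnus hg i, fun θ hθ => ⟨?_, ?_⟩⟩
  · simp only [isTotalJohnson_iff]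
    exact existsUnique_isFatgraphJohnson _ _
  · intro U hU
    rw [hU.tau_two_boundaryTwist]
    refine ⟨?_, rfl, tensorSq_omega_mem_HL3, bar_tensorSq_omega⟩
    rw [IA.tau, hU.hom_one_boundaryTwist, map_zero]
  · exact fun i _ => existsUnique_isFatgraphJohnson _ _
  · intro U hU
    refine ⟨fun i hi => ⟨tailSequence_tau_one (hθ i hi.le) (hθ _ hi) (hU i hi),
      tailSequence_tau_two_mem (hθ i hi.le) (hθ _ hi) (hU i hi)⟩, sum_tau_two hg hθ hU, ?_⟩
    rw [← map_sum, sum_tau_two hg hθ hU, bar_tensorSq_omega]
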